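/- Let $n\ge 1$ and let $U\subset\mathbb R^n$ be a bounded Lipschitz domain (open, connected, nonempty, and near each boundary point, in rotated coordinates $y=(y',y_n)$, of the form $\{y_n>\zeta(y')\}$ inside a closed cube centred at that point, with $\zeta:\mathbb R^{n-1}\to\mathbb R$ Lipschitz). Then the following hold. (A) $\partial U$ is a Lipschitz deformable boundary in the sense of Chen–Frid: $\partial U$ is locally a Lipschitz graph as above, and there is a map $\Psi:\partial U\times[0,1]\to\overline U$ which is bi-Lipschitz onto its image (jointly in $(x,\tau)$), satisfies $\Psi(x,0)=x$ for all $x\in\partial U$, and is such that for every $\tau\in(0,1]$ the set $\Psi(\partial U\times\{\tau\})$ is the boundary of an open subset of $U$. Such a $\Psi$ is called a Lipschitz deformation of $\partial U$. (B) A Lipschitz deformation is given by the Ball–Zarnescu maps, which are uniformly bi-Lipschitz. Precisely, let $d$ be the signed distance from $\partial U$ (positive in $U$, nonpositive outside), let $\eta\in C^2(\mathbb R^n)$ satisfy $\eta\ge0$, $\operatorname{supp}\eta\subset B(0,1)$ and $\int\eta=1$, and let $\rho$ be the regularized distance, $\rho(x)$ being the unique solution $\tau$ of $$\tau=\int d\big(x-\tfrac{\tau}{2}z\big)\,\eta(z)\,dz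 .$$ A unit vector $\nu$ is called a good direction at $P$ if for some ball $B(P,\delta)$ meeting $\partial U$, in orthonormal coordinates centred at $P$ with $e_n=\nu$, $U\cap B(P,\delta)=\{y_n>\zeta(y')\}\cap B(P,\delta)$ for a Lipschitz function $\zeta:\mathbb R^{n-1}\to\mathbb R$. Consider any choice of: - an open neighbourhood $V$ of $\partial U$ and a $C^\infty$ map $G:V\to S^{n-1}$ such that $G(P)$ is a good direction at $P$ for each $P\in V$; a function $\gamma\in C_c^\infty(V;[0,1])$ equal to $1$ in a neighbourhood of $\partial U$; and the flow $S(t)$ of the vector field $\gamma G$ (extended by $0$ outside $V$); - functions $h(\varepsilon,\cdot):[0,\infty)\to[0,\varepsilon]$ that, for all sufficiently small $\varepsilon>0$, are smooth with $h(\varepsilon,r)=\varepsilon$ for $0\le r\le\varepsilon$, $h(\varepsilon,r)=0$ for $r\ge\frac52\varepsilon$, and $-1+\sigma<\partial_rh(\varepsilon,r)\le0$ for $r>0$, with some $\sigma>0$ independent of $\varepsilon$; - a smooth function $u:(0,1)\times(0,1)\times\mathbb R\to\mathbb R$ such that each $u(a,b,\cdot)$ is an increasing $C^\infty$ diffeomorphism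 of $\mathbb R$ with $u(a,b,c)=c$ for $c\notin[0,1]$ and $u(a,b,a)=b$. For small $\varepsilon>0$ and $x\in\overline U$, let $f(\varepsilon,x)=S(t)x$ if $\rho(x)\le3\varepsilon$, where $t\ge0$ is the unique solution of $\rho(S(t)x)=\rho(x)+h(\varepsilon,\rho(x))$, and $f(\varepsilon,x)=x$ if $\rho(x)>3\varepsilon$; let $f(0,x)=x$; and for small $\varepsilon<0$ let $f(\varepsilon,x)=g(-\varepsilon,\varepsilon,f(-\varepsilon,x))$. Here, for $\varepsilon'<0<\tilde\varepsilon$, $g(\tilde\varepsilon,\varepsilon',y)=y$ unless $3\varepsilon'<\rho(y)<3\tilde\varepsilon$, in which case, denoting by $\theta(\tau,y)$ the unique $\theta\in\mathbb R$ with $\rho(S(\theta)y)=\tau$ and setting $\Delta=\theta(2\tilde\varepsilon,y)-\theta(2\varepsilon',y)$, $$g(\tilde\varepsilon,\varepsilon',y)=S(w)y,\qquad w=\Delta\; u\Big(\tfrac{\theta(\tilde\varepsilon,y)-\theta(2\varepsilon',y)}{\Delta},\ \tfrac{\theta(\varepsilon',y)-\theta(2\varepsilon',y)}{\Delta},\ \tfrac{-\theta(2\varepsilon',y)}{\Delta}\Big)+\theta(2\varepsilon',y).$$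 Such choices of $(V,G,\gamma,S,h,u)$ exist, and for every such choice there are $\varepsilon_0>0$ and $K$ such that for all $\varepsilon\in(-\varepsilon_0,\varepsilon_0)$ the map $f(\varepsilon,\cdot)$ maps $\overline U$ onto $\overline{\{\rho>\varepsilon\}}$ and $\partial U$ onto $\partial\{\rho>\varepsilon\}$, and $$K^{-1}|x-y|\le|f(\varepsilon,x)-f(\varepsilon,y)|\le K|x-y|\qquad\text{for all }x,y\in\overline U;$$ moreover, for every $\varepsilon_1\in(0,\varepsilon_0)$, $\Psi(x,\tau)=f(\tau\varepsilon_1,x)$ is a Lipschitz deformation of $\partial U$. -/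

import Mathlib

open Set Metric MeasureTheory
open scoped ContDiff

noncomputable section

/-- The Euclidean space `ℝⁿ` with `n = m + 1 ≥ 1`. -/
abbrev Euc (m : ℕ) : Type := EuclideanSpace ℝ (Fin (m + 1))

/-- The first `n - 1` coordinates `y' = (y₁, …, yₙ₋₁)` of `y`. -/
def horiz {m : ℕ} (y : Euc m) : EuclideanSpace ℝ (Fin m) :=
  WithLp.toLp 2 (fun i : Fin m => y i.castSucc)

/-- The last coordinate `yₙ` of `y`. -/
def vert {m : ℕ} (y : Euc m) : ℝ := y (Fin.last m)

/-! ### Lipschitz domains and Lipschitz deformable boundaries -/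

/-- Near every boundary point, in suitable rotated coordinates `R y`, the set `Ω` is, inside the
closed cube `Q(x, r)` of these coordinates, the region above the graph of a Lipschitz function. -/
def HasLipschitzBoundary {m : ℕ} (Ω : Set (Euc m)) : Prop :=
  ∀ x ∈ frontier Ω, ∃ r : ℝ, 0 < r ∧ ∃ R : Euc m ≃ₗᵢ[ℝ] Euc m,
    ∃ ζ : EuclideanSpace ℝ (Fin m) → ℝ, (∃ L : NNReal, LipschitzWith L ζ) ∧
      ∀ y : Euc m, (∀ i, |R y i - R x i| ≤ r) → (y ∈ Ω ↔ ζ (horiz (R y)) < vert (R y))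

/-- A Lipschitz domain: a (nonempty) connected open set with Lipschitz boundary. -/
structure IsLipschitzDomain {m : ℕ} (U : Set (Euc m)) : Prop where
  isOpen : IsOpen U
  isConnected : IsConnected U
  lipschitz : HasLipschitzBoundary U

/-- `Φ` is bi-Lipschitz on `s`: the constant `K` is a Lipschitz constant for `Φ` on `s` and for the
inverse of `Φ` on `Φ(s)`. -/
def BiLipschitzOnWith {X Y : Type*} [PseudoMetricSpace X] [PseudoMetricSpace Y]
    (K : ℝ) (Φ : X → Y) (s : Set X) : Prop :=
  ∀ x ∈ s, ∀ y ∈ s, dist (Φ x) (Φ y) ≤ K * dist x y ∧ dist x y ≤ K * dist (Φ x) (Φ y)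

/-- `Ψ : ∂Ω × [0,1] → closure Ω` is a Lipschitz deformation of `∂Ω`: it is bi-Lipschitz onto its
image (jointly in both variables), starts at the identity, and every `Ψ(∂Ω × {τ})`, `0 < τ ≤ 1`,
is the boundary of an open subset of `Ω`. Values outside `∂Ω × [0,1]` are irrelevant. -/
structure IsLipschitzDeformation {m : ℕ} (Ω : Set (Euc m)) (Ψ : Euc m → ℝ → Euc m) : Prop where
  mapsTo : ∀ x ∈ frontier Ω, ∀ τ ∈ Icc (0 : ℝ) 1, Ψ x τ ∈ closure Ω
  biLipschitz : ∃ K : ℝ,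
    BiLipschitzOnWith K (fun p : Euc m × ℝ => Ψ p.1 p.2) (frontier Ω ×ˢ Icc (0 : ℝ) 1)
  initial : ∀ x ∈ frontier Ω, Ψ x 0 = x
  bounds : ∀ τ ∈ Ioc (0 : ℝ) 1, ∃ W : Set (Euc m), IsOpen W ∧ W ⊆ Ω ∧
    frontier W = (fun x => Ψ x τ) '' frontier Ω

/-- `∂Ω` is a deformable Lipschitz boundary, in the sense of Chen and Frid. -/
def IsLipschitzDeformable {m : ℕ} (Ω : Set (Euc m)) : Prop :=
  HasLipschitzBoundary Ω ∧ ∃ Ψ : Euc m → ℝ → Euc m, IsLipschitzDeformation Ω Ψ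

/-! ### The regularized distance -/

open Classical in
/-- The signed distance from `∂U`, positive in `U`. -/
def signedBdryDist {m : ℕ} (U : Set (Euc m)) (x : Euc m) : ℝ :=
  if x ∈ U then infDist x (frontier U) else -infDist x (frontier U)

/-- The kernels `η` used to regularize the distance. -/
structure IsMollifier {m : ℕ} (η : Euc m → ℝ) : Prop where
  smooth : ContDiff ℝ 2 η
  supp : tsupport η ⊆ ball 0 1
  nonneg : ∀ z, 0 ≤ η z
  integral_eq_one : ∫ z, η z = 1

/-- `G(x, τ) = ∫ d(x - (τ/2) z) η(z) dz`. -/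
def mollifiedDist {m : ℕ} (U : Set (Euc m)) (η : Euc m → ℝ) (x : Euc m) (τ : ℝ) : ℝ :=
  ∫ z, signedBdryDist U (x - (τ / 2) • z) * η z

/-- The regularized distance `ρ`: the value `ρ(x)` is the unique solution `τ` of `τ = G(x, τ)`
(see `existsUnique_regularizedDist`). -/
def regularizedDist {m : ℕ} (U : Set (Euc m)) (η : Euc m → ℝ) (x : Euc m) : ℝ :=
  Classical.epsilon (fun τ : ℝ => τ = mollifiedDist U η x τ)

theorem signedBdryDist_lipschitz {m : ℕ} (U : Set (Euc m)) : LipschitzWith 1 (signedBdryDist U) := by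
  have key : ∀ x ∈ U, ∀ y ∉ U,
      infDist x (frontier U) + infDist y (frontier U) ≤ dist x y := by
    intro x hx y hy
    obtain ⟨z, hz, hzf⟩ : ∃ z ∈ segment ℝ x y, z ∈ frontier U := by
      by_contra! hne
      have hxs := left_mem_segment ℝ x y
      have hys := right_mem_segment ℝ x y
      have hint : ∀ z ∈ segment ℝ x y, z ∈ closure U → z ∈ interior U := fun z hz hc => by
        by_contra h
        exact hne z hz ⟨hc, h⟩
      obtain ⟨z, -, hz1, hz2⟩ := (convex_segment (𝕜 := ℝ) x y).isPreconnected (interior U)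
        (closure U)ᶜ isOpen_interior isClosed_closure.isOpen_compl
        (fun z hz => by
          by_cases h : z ∈ closure U
          · exact Or.inl (hint z hz h)
          · exact Or.inr h)
        ⟨x, hxs, hint x hxs (subset_closure hx)⟩
        ⟨y, hys, fun h => hy (interior_subset (hint y hys h))⟩
      exact hz2 (subset_closure (interior_subset hz1))
    have h1 := infDist_le_dist_of_mem (x := x) hzf
    have h2 := infDist_le_dist_of_mem (x := y) hzf
    have h3 := dist_add_dist_of_mem_segment hz
    rw [dist_comm y z] at h2
    linarith
  refine LipschitzWith.of_dist_le_mul fun x y => ?_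
  have e1 := infDist_le_infDist_add_dist (s := frontier U) (x := x) (y := y)
  have e2 := infDist_le_infDist_add_dist (s := frontier U) (x := y) (y := x)
  rw [dist_comm y x] at e2
  have n1 := infDist_nonneg (x := x) (s := frontier U)
  have n2 := infDist_nonneg (x := y) (s := frontier U)
  rw [Real.dist_eq, NNReal.coe_one, one_mul, abs_le]
  by_cases hx : x ∈ U <;> by_cases hy : y ∈ U
  · simp only [signedBdryDist, hx, hy, if_true]; constructor <;> linarith
  · have := key x hx y hy
    simp only [signedBdryDist, hx, hy, if_true, if_false]; constructor <;> linarith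
  · have := key y hy x hx
    rw [dist_comm y x] at this
    simp only [signedBdryDist, hx, hy, if_true, if_false]; constructor <;> linarith
  · simp only [signedBdryDist, hx, hy, if_false]; constructor <;> linarith

theorem existsUnique_regularizedDist {m : ℕ} (U : Set (Euc m)) {η : Euc m → ℝ}
    (hη : IsMollifier η) (x : Euc m) : ∃! τ : ℝ, τ = mollifiedDist U η x τ := by
  have hcs : HasCompactSupport η :=
    HasCompactSupport.of_support_subset_isCompact (isCompact_closedBall (0 : Euc m) 1)
      ((subset_tsupport η).trans (hη.supp.trans ball_subset_closedBall))
  have hηc : Continuous η := hη.smooth.continuous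
  have hηi : Integrable η := hηc.integrable_of_hasCompactSupport hcs
  have hi : ∀ τ : ℝ, Integrable fun z => signedBdryDist U (x - (τ / 2) • z) * η z := fun τ =>
    (((signedBdryDist_lipschitz U).continuous.comp (by fun_prop)).mul
      hηc).integrable_of_hasCompactSupport hcs.mul_left
  have hK : ContractingWith (1 / 2) (mollifiedDist U η x) := by
    refine ⟨by rw [← NNReal.coe_lt_coe]; norm_num, LipschitzWith.of_dist_le_mul fun τ σ => ?_⟩
    rw [Real.dist_eq, Real.dist_eq, mollifiedDist, mollifiedDist, ← integral_sub (hi τ) (hi σ)]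
    calc _ ≤ ∫ z, (1 / 2 * |τ - σ|) * η z := by
          refine norm_integral_le_of_norm_le (f := fun z => signedBdryDist U (x - (τ / 2) • z) * η z
            - signedBdryDist U (x - (σ / 2) • z) * η z) (hηi.const_mul _)
            (Filter.Eventually.of_forall fun z => ?_)
          rw [← sub_mul, norm_mul, Real.norm_eq_abs, Real.norm_eq_abs, abs_of_nonneg (hη.nonneg z)]
          by_cases hz : η z = 0
          · simp [hz]
          have hz1 : ‖z‖ ≤ 1 := by
            have := hη.supp (subset_tsupport η hz)
            rw [mem_ball_zero_iff] at this
            exact this.le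
          refine mul_le_mul_of_nonneg_right ?_ (hη.nonneg z)
          have h := (signedBdryDist_lipschitz U).dist_le_mul (x - (τ / 2) • z) (x - (σ / 2) • z)
          rw [Real.dist_eq, NNReal.coe_one, one_mul, dist_eq_norm] at h
          have e : x - (τ / 2) • z - (x - (σ / 2) • z) = ((σ - τ) / 2) • z := by module
          rw [e, norm_smul, Real.norm_eq_abs, abs_div, abs_sub_comm σ τ, abs_two] at h
          have : |τ - σ| / 2 * ‖z‖ ≤ |τ - σ| / 2 * 1 := by gcongr
          linarith
      _ = _ := by rw [integral_const_mul, hη.integral_eq_one]; norm_num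
  refine ⟨_, (hK.fixedPoint_isFixedPt).eq.symm, fun τ hτ => hK.fixedPoint_unique hτ.symm⟩

theorem regularizedDist_eq {m : ℕ} (U : Set (Euc m)) {η : Euc m → ℝ}
    (hη : IsMollifier η) (x : Euc m) :
    regularizedDist U η x = mollifiedDist U η x (regularizedDist U η x) :=
  Classical.epsilon_spec (existsUnique_regularizedDist U hη x).exists

/-- The superlevel sets `{ρ > ε}`: this is `U^{ε,ρ}` for `ε > 0` and `U_{-ε,ρ}` for `ε < 0`. -/
def superlevel {m : ℕ} (ρ : Euc m → ℝ) (ε : ℝ) : Set (Euc m) := {x | ε < ρ x}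

/-! ### The Ball–Zarnescu maps -/

/-- `ν` is a good direction at `P` for a set with Lipschitz boundary: in some ball `B(P, δ)`
meeting `∂U`, and in orthonormal coordinates with origin `P` whose last axis points along `ν`,
the set `U` is the region above the graph of a Lipschitz function. -/
def IsGoodDirection {m : ℕ} (U : Set (Euc m)) (P ν : Euc m) : Prop :=
  ∃ δ : ℝ, 0 < δ ∧ (ball P δ ∩ frontier U).Nonempty ∧
    ∃ R : Euc m ≃ₗᵢ[ℝ] Euc m, R ν = EuclideanSpace.single (Fin.last m) 1 ∧
      ∃ ζ : EuclideanSpace ℝ (Fin m) → ℝ, (∃ L : NNReal, LipschitzWith L ζ) ∧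
        ∀ y ∈ ball P δ, (y ∈ U ↔ ζ (horiz (R (y - P))) < vert (R (y - P)))

/-- `S` is the global flow of the vector field `X`. -/
def IsFlow {m : ℕ} (X : Euc m → Euc m) (S : ℝ → Euc m → Euc m) : Prop :=
  ∀ x, S 0 x = x ∧ ∀ t, HasDerivAt (fun s => S s x) (X (S t x)) t

/-- The level shift functions `h(ε, ·) : [0,∞) → [0,ε]`. -/
def IsLevelShift (h : ℝ → ℝ → ℝ) : Prop :=
  ∃ σ : ℝ, 0 < σ ∧ ∃ εh : ℝ, 0 < εh ∧ ∀ ε ∈ Ioo 0 εh,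
    ContDiffOn ℝ ∞ (h ε) (Ici 0) ∧
    (∀ r, 0 ≤ r → h ε r ∈ Icc 0 ε) ∧
    (∀ r ∈ Icc 0 ε, h ε r = ε) ∧
    (∀ r, 5 * ε / 2 ≤ r → h ε r = 0) ∧
    (∀ r, 0 < r → -1 + σ < deriv (h ε) r ∧ deriv (h ε) r ≤ 0)

/-- A smooth family of diffeomorphisms `u(a, b, ·)` of `ℝ`, `a, b ∈ (0,1)`, that fix every point
outside `[0,1]` and satisfy `u(a, b, a) = b`. (Being increasing, with positive derivative and
equal to the identity outside `[0,1]`, each `u(a, b, ·)` is a diffeomorphism of `ℝ`.) -/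
structure IsDiffeoFamily (u : ℝ → ℝ → ℝ → ℝ) : Prop where
  smooth : ContDiffOn ℝ ∞ (fun p : ℝ × ℝ × ℝ => u p.1 p.2.1 p.2.2)
    (Ioo (0 : ℝ) 1 ×ˢ Ioo (0 : ℝ) 1 ×ˢ (univ : Set ℝ))
  deriv_pos : ∀ a ∈ Ioo (0 : ℝ) 1, ∀ b ∈ Ioo (0 : ℝ) 1, ∀ c, 0 < deriv (u a b) c
  fixed : ∀ a ∈ Ioo (0 : ℝ) 1, ∀ b ∈ Ioo (0 : ℝ) 1, ∀ c, c ∉ Icc (0 : ℝ) 1 → u a b c = c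
  apply_self : ∀ a ∈ Ioo (0 : ℝ) 1, ∀ b ∈ Ioo (0 : ℝ) 1, u a b a = b

/-- The choices that enter the construction of the Ball–Zarnescu maps of `U`: a smooth field `G`
of good directions on a neighbourhood `V` of `∂U`, a smooth cut-off function `γ` supported in `V`
and equal to `1` near `∂U`, the flow `S` of `γ G`, and the auxiliary functions `h` and `u`. -/
structure BallZarnescuData {m : ℕ} (U : Set (Euc m)) where
  V : Set (Euc m)
  isOpen_V : IsOpen V
  frontier_subset : frontier U ⊆ V
  G : Euc m → Euc m
  smooth_G : ContDiffOn ℝ ∞ G V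
  norm_G : ∀ P ∈ V, ‖G P‖ = 1
  good_G : ∀ P ∈ V, IsGoodDirection U P (G P)
  γ : Euc m → ℝ
  smooth_γ : ContDiff ℝ ∞ γ
  range_γ : ∀ x, γ x ∈ Icc (0 : ℝ) 1
  compact_γ : HasCompactSupport γ
  supp_γ : tsupport γ ⊆ V
  one_γ : ∃ N : Set (Euc m), IsOpen N ∧ frontier U ⊆ N ∧ ∀ x ∈ N, γ x = 1
  S : ℝ → Euc m → Euc m
  flow_S : IsFlow (fun x => γ x • G x) S
  h : ℝ → ℝ → ℝ
  shift_h : IsLevelShift h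
  u : ℝ → ℝ → ℝ → ℝ
  diffeo_u : IsDiffeoFamily u

namespace BallZarnescuData

variable {m : ℕ} {U : Set (Euc m)} (D : BallZarnescuData U) (ρ : Euc m → ℝ)

/-- `t(ε, x)`, the unique `t ≥ 0` with `ρ(S(t)x) = ρ(x) + h(ε, ρ(x))`. -/
def shiftTime (ε : ℝ) (x : Euc m) : ℝ :=
  Classical.epsilon (fun t : ℝ => 0 ≤ t ∧ ρ (D.S t x) = ρ x + D.h ε (ρ x))

/-- `θ(τ, y)`, the unique time `θ` with `ρ(S(θ)y) = τ`. -/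
def levelTime (τ : ℝ) (y : Euc m) : ℝ :=
  Classical.epsilon (fun θ : ℝ => ρ (D.S θ y) = τ)

/-- `q(ε, ε', y)`. -/
def q (ε ε' : ℝ) (y : Euc m) : ℝ :=
  -D.levelTime ρ (2 * ε') y / (D.levelTime ρ (2 * ε) y - D.levelTime ρ (2 * ε') y)

/-- `r(ε, ε', y)`. -/
def r (ε ε' : ℝ) (y : Euc m) : ℝ :=
  (D.levelTime ρ ε y - D.levelTime ρ (2 * ε') y) /
    (D.levelTime ρ (2 * ε) y - D.levelTime ρ (2 * ε') y)

/-- `s(ε, ε', y)`. -/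
def s (ε ε' : ℝ) (y : Euc m) : ℝ :=
  (D.levelTime ρ ε' y - D.levelTime ρ (2 * ε') y) /
    (D.levelTime ρ (2 * ε) y - D.levelTime ρ (2 * ε') y)

/-- `w(ε, ε', y)`, the time for which `y` is moved by the flow. -/
def w (ε ε' : ℝ) (y : Euc m) : ℝ :=
  (D.levelTime ρ (2 * ε) y - D.levelTime ρ (2 * ε') y) *
      D.u (D.r ρ ε ε' y) (D.s ρ ε ε' y) (D.q ρ ε ε' y) +
    D.levelTime ρ (2 * ε') y

open Classical in
/-- The map `g(ε, ε', ·)`, `ε' < 0 < ε`, which carries `{ρ > ε}` to `{ρ > ε'}`. -/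
def g (ε ε' : ℝ) (y : Euc m) : Euc m :=
  if ρ y ∈ Ioo (3 * ε') (3 * ε) then D.S (D.w ρ ε ε' y) y else y

open Classical in
/-- The map `f(ε, ·)` on `closure U`, for `ε > 0`. -/
def fpos (ε : ℝ) (x : Euc m) : Euc m :=
  if x ∈ closure U \ superlevel ρ (3 * ε) then D.S (D.shiftTime ρ ε x) x else x

/-- The Ball–Zarnescu map `f(ε, ·)` on `closure U`; here `f(0, ·)` is the identity, and
`f(ε, x) = g(-ε, ε, f(-ε, x))` for `ε < 0`. -/
def f (ε : ℝ) (x : Euc m) : Euc m :=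
  if 0 < ε then D.fpos ρ ε x
  else if ε < 0 then D.g ρ (-ε) ε (D.fpos ρ (-ε) x)
  else x

end BallZarnescuData

end

/-! ### Cone conditions and good directions -/

/-! No derivative of ρ is needed. Everything follows from one quantitative fact: along the flow of a
field of good directions, ρ grows at a uniform positive rate near ∂U (`exists_transverseFlow`,
recorded in the structure `TransverseFlow`).

To see this, replace "graph of a Lipschitz function" by "stable under translation along an open
cone" (`coneOn_of_graph`). A translation of the cone that carries p to q pushes every point of U
near p well into U, so the signed distance increases from p to q (`signedBdryDist_add_le`).
Averaging against η and solving the implicit equation costs a factor 2/3 (`regularizedDist_add_le`).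
On short times the flow moves almost in a fixed direction G(x), hence inside the cone.

Cone directions at a point form a convex set (`convex_coneAt`), so a partition of unity gives a
smooth field of them. Cone conditions also return good directions (`ConeAt.isGoodDirection`). This
yields existence of the field.

Growth makes the time at which a flow line reaches a given level unique and a Lipschitz function of
the starting point (`mul_abs_time_sub_le`). All the maps have the form Φ(x) = S(T(x))x. Such a map
is bi-Lipschitz as soon as T is Lipschitz both as a function of x and as a function of Φ(x)
(`TransverseFlow.biLipschitzOnWith`).

For ε > 0 both properties hold because r ↦ r + h(ε, r) is bi-Lipschitz uniformly in ε. For ε < 0,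
describe a point by the relative position q of its flow parameter between the levels ±2e, where e =
-ε; g replaces q by u(r, s, q), where r and s are the relative positions of the levels e and -e. The
parameters are Lipschitz only with constant O(1/e), but they are multiplied by a time span of size
O(e). Since r and s stay in a fixed compact part of (0,1), the bounds on u do not depend on e
(`exists_g_biLipschitz`).

Finally f(τε₁, ·) sends ∂U to the level τε₁, so ρ recovers τ from the image point; this gives the
joint bi-Lipschitz bound for Ψ. -/

/-- Inside `B`, the set `U` is stable under translations by positive multiples of the vectors in
`ball v κ`. -/
def ConeOn {m : ℕ} (U : Set (Euc m)) (v : Euc m) (κ : ℝ) (B : Set (Euc m)) : Prop :=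
  ∀ x ∈ U ∩ B, ∀ ξ ∈ ball v κ, ∀ s : ℝ, 0 < s → x + s • ξ ∈ B → x + s • ξ ∈ U

/-- `U` satisfies a cone condition with axis `v` in a ball about `P` that meets `∂U`. -/
def ConeAt {m : ℕ} (U : Set (Euc m)) (P v : Euc m) : Prop :=
  ∃ δ : ℝ, 0 < δ ∧ ∃ κ : ℝ, 0 < κ ∧ (ball P δ ∩ frontier U).Nonempty ∧ ConeOn U v κ (ball P δ)

/-! ### Horizontal and vertical coordinates, and the cone condition above a Lipschitz graph. -/

section Coordinates

variable {m : ℕ}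

theorem horiz_add (x y : Euc m) : horiz (x + y) = horiz x + horiz y := rfl

theorem horiz_smul (s : ℝ) (x : Euc m) : horiz (s • x) = s • horiz x := rfl

theorem horiz_sub (x y : Euc m) : horiz (x - y) = horiz x - horiz y := rfl

theorem vert_add (x y : Euc m) : vert (x + y) = vert x + vert y := rfl

theorem vert_smul (s : ℝ) (x : Euc m) : vert (s • x) = s * vert x := rfl

theorem vert_sub (x y : Euc m) : vert (x - y) = vert x - vert y := rfl

theorem norm_sq_eq_horiz_vert (x : Euc m) : ‖x‖ ^ 2 = ‖horiz x‖ ^ 2 + vert x ^ 2 := by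
  rw [EuclideanSpace.norm_sq_eq, EuclideanSpace.norm_sq_eq, Fin.sum_univ_castSucc]
  simp [horiz, vert]

theorem norm_horiz_le (x : Euc m) : ‖horiz x‖ ≤ ‖x‖ := by
  have := norm_sq_eq_horiz_vert x
  exact abs_le_of_sq_le_sq' (by nlinarith [sq_nonneg (vert x)]) (norm_nonneg _) |>.2

theorem abs_vert_le (x : Euc m) : |vert x| ≤ ‖x‖ := by
  have := norm_sq_eq_horiz_vert x
  refine abs_le_of_sq_le_sq (by nlinarith [sq_nonneg ‖horiz x‖]) (norm_nonneg _)

theorem norm_eq_horiz_of_vert_eq_zero {x : Euc m} (h : vert x = 0) : ‖x‖ = ‖horiz x‖ := by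
  have := norm_sq_eq_horiz_vert x
  rw [h] at this
  nlinarith [norm_nonneg x, norm_nonneg (horiz x), sq_nonneg (‖x‖ - ‖horiz x‖)]

theorem vert_single_last : vert (EuclideanSpace.single (Fin.last m) (1 : ℝ)) = 1 := by
  simp [vert]

theorem horiz_single_last : horiz (EuclideanSpace.single (Fin.last m) (1 : ℝ)) = 0 := by
  ext i
  simp [horiz]

/-- Write e = R(ξ - v), so that (1 + L)‖e‖ < 1. A step of length s raises the vertical coordinate by
at least s(1 - ‖e‖), which exceeds sL‖e‖, the largest possible rise of ζ below it. The offset b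
serves both normalisations in use: b = R P for coordinates centred at P, and b = 0 for the local
charts of a Lipschitz boundary. -/
theorem coneOn_of_graph {U : Set (Euc m)} {B : Set (Euc m)} {L : NNReal}
    {ζ : EuclideanSpace ℝ (Fin m) → ℝ} (hζ : LipschitzWith L ζ) (R : Euc m ≃ₗᵢ[ℝ] Euc m)
    {v b : Euc m} (hv : R v = EuclideanSpace.single (Fin.last m) 1)
    (hB : ∀ y ∈ B, (y ∈ U ↔ ζ (horiz (R y - b)) < vert (R y - b))) :
    ConeOn U v (1 / (1 + L)) B := by
  rintro x ⟨hxU, hxB⟩ ξ hξ s hs hB'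
  have hx := (hB x hxB).1 hxU
  rw [hB _ hB']
  have e : R (x + s • ξ) - b = (R x - b) + s • (R v + R (ξ - v)) := by
    simp only [map_add, map_sub, map_smul]; module
  have hn : ‖R (ξ - v)‖ < 1 / (1 + L) := by
    rw [R.norm_map, ← dist_eq_norm]; exact hξ
  have hL : (0 : ℝ) < 1 + L := by positivity
  rw [lt_div_iff₀ hL] at hn
  rw [e, horiz_add, vert_add, vert_smul, horiz_smul, horiz_add, vert_add, hv, vert_single_last,
    horiz_single_last, zero_add]
  have h1 := hζ.dist_le_mul (horiz (R x - b) + s • horiz (R (ξ - v))) (horiz (R x - b))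
  rw [dist_eq_norm, dist_eq_norm, add_sub_cancel_left, norm_smul, Real.norm_eq_abs,
    Real.norm_eq_abs, abs_of_pos hs] at h1
  have h2 := (abs_le.1 h1).2
  have h3 := norm_horiz_le (R (ξ - v))
  have h4 := (abs_le.1 (abs_vert_le (R (ξ - v)))).1
  have h5 : (L : ℝ) * (s * ‖horiz (R (ξ - v))‖) ≤ s * (L * ‖R (ξ - v)‖) := by
    have : (0 : ℝ) ≤ L := L.2
    nlinarith [mul_le_mul_of_nonneg_left h3 (mul_nonneg this hs.le)]
  nlinarith

theorem exists_isometry_single_last {v : Euc m} (hv : ‖v‖ = 1) :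
    ∃ R : Euc m ≃ₗᵢ[ℝ] Euc m, R v = EuclideanSpace.single (Fin.last m) 1 :=
  ⟨Submodule.reflection (ℝ ∙ (v - EuclideanSpace.single (Fin.last m) 1))ᗮ,
    Submodule.reflection_sub (by simp [hv])⟩

end Coordinates

/-! ### Calculus of cone conditions and their equivalence with good directions. -/

section Cones

variable {m : ℕ} {U : Set (Euc m)}

theorem ConeOn.mono {v v' : Euc m} {κ κ' : ℝ} {B B' : Set (Euc m)} (h : ConeOn U v κ B)
    (hB : B' ⊆ B) (hv : dist v' v + κ' ≤ κ) : ConeOn U v' κ' B' :=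
  fun x hx ξ hξ s hs hs' => h x ⟨hx.1, hB hx.2⟩ ξ
    (ball_subset_ball' (by linarith) hξ) s hs (hB hs')

theorem IsGoodDirection.coneAt {P v : Euc m} (h : IsGoodDirection U P v) : ConeAt U P v := by
  obtain ⟨δ, hδ, hne, R, hR, ζ, ⟨L, hL⟩, hU⟩ := h
  exact ⟨δ, hδ, 1 / (1 + L), by positivity, hne, coneOn_of_graph hL R (b := R P) hR
    fun y hy => by rw [hU y hy, map_sub]⟩

/-- Halving the radius does two things: the ball about Q stays inside the original one, and it still
contains the boundary point P. -/
theorem ConeAt.of_mem_ball {P Q v : Euc m} {δ κ : ℝ} (hκ : 0 < κ) (hP : P ∈ frontier U)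
    (h : ConeOn U v κ (ball P δ)) (hQ : Q ∈ ball P (δ / 2)) : ConeAt U Q v := by
  have hd := mem_ball.1 hQ
  have := dist_nonneg (x := Q) (y := P)
  exact ⟨δ / 2, by linarith, κ, hκ, ⟨P, by rwa [mem_ball, dist_comm], hP⟩,
    h.mono (ball_subset_ball' (by linarith)) (by simp)⟩

theorem HasLipschitzBoundary.exists_coneOn (h : HasLipschitzBoundary U) {x : Euc m}
    (hx : x ∈ frontier U) : ∃ v : Euc m, ∃ δ > 0, ∃ κ > 0, ConeOn U v κ (ball x δ) := by
  obtain ⟨r, hr, R, ζ, ⟨L, hL⟩, hU⟩ := h x hx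
  refine ⟨R.symm (EuclideanSpace.single (Fin.last m) 1), r, hr, 1 / (1 + L), by positivity,
    coneOn_of_graph hL R (b := 0) (by simp) fun y hy => ?_⟩
  rw [sub_zero]
  refine hU y fun i => ?_
  have h1 : |(R (y - x)) i| ≤ ‖R (y - x)‖ := by
    simpa using PiLp.norm_apply_le (R (y - x)) i
  rw [R.norm_map, ← dist_eq_norm, map_sub] at h1
  exact h1.trans (le_of_lt hy)

/-- A cone with axis 0 contains every direction, so U would fill the whole ball, which contains a
boundary point of the open set U. This is what allows an averaged field of cone directions to be
normalised. -/
theorem ConeAt.ne_zero {P v : Euc m} (hU : IsOpen U) (h : ConeAt U P v) : v ≠ 0 := by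
  rintro rfl
  obtain ⟨δ, hδ, κ, hκ, ⟨z, hz, hzf⟩, hc⟩ := h
  have hzU : z ∉ U := fun h' => hzf.2 (hU.interior_eq.symm ▸ h')
  obtain ⟨x, hx, hxU⟩ := mem_closure_iff.1 hzf.1 _ isOpen_ball hz
  obtain ⟨s, hs, hs'⟩ : ∃ s : ℝ, 0 < s ∧ s⁻¹ * ‖z - x‖ < κ := by
    refine ⟨(‖z - x‖ + 1) / κ, by positivity, ?_⟩
    rw [inv_div, div_mul_eq_mul_div, div_lt_iff₀ (by positivity)]
    nlinarith
  have e : x + s • (s⁻¹ • (z - x)) = z := by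
    rw [smul_smul, mul_inv_cancel₀ hs.ne', one_smul]; abel
  have := hc x ⟨hxU, hx⟩ (s⁻¹ • (z - x)) (by
    rw [mem_ball_zero_iff, norm_smul, Real.norm_of_nonneg (by positivity)]; exact hs') s hs
    (by rwa [e])
  rw [e] at this
  exact hzU this

theorem ConeAt.smul {P v : Euc m} {a : ℝ} (ha : 0 < a) (h : ConeAt U P v) :
    ConeAt U P (a • v) := by
  obtain ⟨δ, hδ, κ, hκ, hne, hc⟩ := h
  refine ⟨δ, hδ, a * κ, by positivity, hne, fun x hx ξ hξ s hs hs' => ?_⟩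
  have e : s • ξ = (s * a) • (a⁻¹ • ξ) := by
    rw [smul_smul, mul_assoc, mul_inv_cancel₀ ha.ne', mul_one]
  rw [e] at hs' ⊢
  refine hc x hx _ ?_ _ (by positivity) hs'
  have : a⁻¹ • ξ - v = a⁻¹ • (ξ - a • v) := by
    rw [smul_sub, smul_smul, inv_mul_cancel₀ ha.ne', one_smul]
  rw [mem_ball, dist_eq_norm] at hξ ⊢
  rw [this, norm_smul, Real.norm_of_nonneg (by positivity), inv_mul_lt_iff₀ ha]
  exact hξ

/-- Stability under two cones implies stability under their sum: a segment that would leave `U`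
is approximated by a broken line near its first exit point. -/
theorem ConeOn.convex_comb {v₁ v₂ : Euc m} {κ a b : ℝ} {B : Set (Euc m)} (hU : IsOpen U)
    (hB : IsOpen B) (hBc : Convex ℝ B)
    (h₁ : ConeOn U v₁ κ B) (h₂ : ConeOn U v₂ κ B) (ha : 0 < a) (hb : 0 < b) (hab : a + b = 1) :
    ConeOn U (a • v₁ + b • v₂) κ B := by
  rintro x ⟨hxU, hxB⟩ ξ hξ s hs hs'
  by_contra hcon
  set p : ℝ → Euc m := fun t => x + t • s • ξ with hp
  have hpc : Continuous p := by fun_prop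
  have hp1 : p 1 = x + s • ξ := by simp [hp]
  have hpB : ∀ t ∈ Icc (0 : ℝ) 1, p t ∈ B := by
    intro t ht
    have := hBc.add_smul_mem hxB hs' ht
    exact this
  have hK : IsCompact (Icc (0 : ℝ) 1 ∩ p ⁻¹' Uᶜ) :=
    isCompact_Icc.inter_right (hU.isClosed_compl.preimage hpc)
  obtain ⟨t₀, ⟨ht₀, htU⟩, hmin⟩ := hK.exists_isLeast ⟨1, by simp, by simpa [hp1] using hcon⟩
  have ht₀pos : 0 < t₀ := by
    rcases ht₀.1.eq_or_lt with h | h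
    · exact absurd hxU (by simpa [← h, hp] using htU)
    · exact h
  set e := ξ - (a • v₁ + b • v₂) with he
  have hne : ‖e‖ < κ := by rw [he, ← dist_eq_norm]; exact hξ
  -- The corner of the broken line from p(t) to p(t₀) tends to p(t₀) as t increases to t₀, so it
  -- lies in the open set B for t close to t₀.
  have hc : Filter.Tendsto (fun t => p t + ((t₀ - t) * s * a) • (v₁ + e)) (nhdsWithin t₀ (Iio t₀))
      (nhds (p t₀)) := by
    have : Continuous (fun t => p t + ((t₀ - t) * s * a) • (v₁ + e)) := by fun_prop
    have h := this.tendsto t₀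
    simp only [sub_self, zero_mul, zero_smul, add_zero] at h
    exact h.mono_left nhdsWithin_le_nhds
  have hev := hc.eventually (hB.mem_nhds (hpB t₀ ht₀))
  have hlt : ∀ᶠ t in nhdsWithin t₀ (Iio t₀), t < t₀ := self_mem_nhdsWithin
  obtain ⟨t, ht, htt, ht0⟩ := (hev.and (hlt.and
    (nhdsWithin_le_nhds (lt_mem_nhds ht₀pos)))).exists
  have htI : t ∈ Icc (0 : ℝ) 1 := ⟨le_of_lt ht0, htt.le.trans ht₀.2⟩
  have htU' : p t ∈ U := by
    by_contra h
    exact absurd (hmin ⟨htI, h⟩) (not_le.2 htt)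
  have hpos : 0 < (t₀ - t) * s := mul_pos (sub_pos.2 htt) hs
  have step1 := h₁ (p t) ⟨htU', hpB t htI⟩ (v₁ + e) (by simpa using hne) _ (mul_pos hpos ha) ht
  have e2 : p t + ((t₀ - t) * s * a) • (v₁ + e) + ((t₀ - t) * s * b) • (v₂ + e) = p t₀ := by
    have : (t₀ - t) • s • ξ = ((t₀ - t) * s * a) • (v₁ + e) + ((t₀ - t) * s * b) • (v₂ + e) := by
      have : ξ = a • (v₁ + e) + b • (v₂ + e) := by
        have : a • (v₁ + e) + b • (v₂ + e) = a • v₁ + b • v₂ + (a + b) • e := by module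
        rw [this, hab, one_smul, he]; abel
      nth_rw 1 [this]
      module
    rw [add_assoc, ← this]
    simp only [hp]; module
  have step2 := h₂ _ ⟨step1, ht⟩ (v₂ + e) (by simpa using hne) _ (mul_pos hpos hb)
    (by rw [e2]; exact hpB t₀ ht₀)
  rw [e2] at step2
  exact htU step2

theorem convex_coneAt (hU : IsOpen U) (P : Euc m) : Convex ℝ {v | ConeAt U P v} := by
  intro v₁ h₁ v₂ h₂ a b ha hb hab
  rcases ha.eq_or_lt with rfl | ha
  · simp only [zero_add] at hab; simpa [hab] using h₂
  rcases hb.eq_or_lt with rfl | hb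
  · simp only [add_zero] at hab; simpa [hab] using h₁
  obtain ⟨δ₁, hδ₁, κ₁, hκ₁, hne₁, hc₁⟩ := h₁
  obtain ⟨δ₂, hδ₂, κ₂, hκ₂, hne₂, hc₂⟩ := h₂
  refine ⟨min δ₁ δ₂, by positivity, min κ₁ κ₂, by positivity, ?_, ?_⟩
  · rcases min_choice δ₁ δ₂ with h | h <;> rw [h] <;> assumption
  · exact ConeOn.convex_comb hU isOpen_ball (convex_ball _ _)
      (hc₁.mono (ball_subset_ball (min_le_left _ _)) (by simp))
      (hc₂.mono (ball_subset_ball (min_le_right _ _)) (by simp)) ha hb hab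

/-- A unit vector satisfying a cone condition is a good direction. -/
theorem ConeAt.isGoodDirection {P v : Euc m} (hU : IsOpen U) (hv : ‖v‖ = 1) (h : ConeAt U P v) :
    IsGoodDirection U P v := by
  obtain ⟨δ, hδ, κ, hκ, hne, hc⟩ := h
  obtain ⟨R, hR⟩ := exists_isometry_single_last hv
  -- The graph function is the infimum of the upward cones of slope κ⁻¹ with vertices at the points
  -- of U in the ball; the region above it is the union of the open cones issuing from these points.
  set L : NNReal := ⟨κ⁻¹, by positivity⟩ with hL
  set φ : Euc m → EuclideanSpace ℝ (Fin m) → ℝ := fun x y' =>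
    vert (R (x - P)) + L * ‖y' - horiz (R (x - P))‖ with hφ
  obtain ⟨z, hz, hzf⟩ := hne
  obtain ⟨x₀, hx₀, hx₀U⟩ := mem_closure_iff.1 hzf.1 _ isOpen_ball hz
  let I := {x // x ∈ U ∩ ball P δ}
  have : Nonempty I := ⟨⟨x₀, hx₀U, hx₀⟩⟩
  have hbdd : ∀ y', BddBelow (range fun x : I => φ x y') := by
    refine fun y' => ⟨-δ, ?_⟩
    rintro _ ⟨x, rfl⟩
    have h1 := (abs_le.1 (abs_vert_le (R (x.1 - P)))).1
    rw [R.norm_map, ← dist_eq_norm] at h1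
    have h2 : dist x.1 P < δ := x.2.2
    have : (0 : ℝ) ≤ L * ‖y' - horiz (R (x - P))‖ := by positivity
    simp only [hφ]; linarith
  refine ⟨δ, hδ, ⟨z, hz, hzf⟩, R, hR, fun y' => ⨅ x : I, φ x y', ⟨L, ?_⟩, fun y hy => ?_⟩
  · refine LipschitzWith.of_le_add_mul _ fun y z => ?_
    rw [← sub_le_iff_le_add]
    refine le_ciInf fun x => ?_
    rw [sub_le_iff_le_add]
    refine (ciInf_le (hbdd y) x).trans ?_
    simp only [hφ]
    have : ‖y - horiz (R (x - P))‖ ≤ ‖z - horiz (R (x - P))‖ + dist y z := by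
      rw [dist_eq_norm]
      have := norm_add_le (z - horiz (R (x - P))) (y - z)
      simpa [add_comm] using this
    nlinarith [mul_le_mul_of_nonneg_left this L.2]
  · constructor
    -- Openness gives the strict inequality: a point slightly below y in direction v is still in U,
    -- and y lies strictly above the vertex of its cone.
    · intro hyU
      have hopen : IsOpen (U ∩ ball P δ) := hU.inter isOpen_ball
      have hcont : Continuous fun s : ℝ => y - s • v := by fun_prop
      have : ∀ᶠ s in nhds (0 : ℝ), y - s • v ∈ U ∩ ball P δ :=
        hcont.continuousAt.eventually (hopen.mem_nhds (by simpa using ⟨hyU, hy⟩))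
      obtain ⟨s, hs, hs0⟩ := ((this.filter_mono nhdsWithin_le_nhds).and
        (self_mem_nhdsWithin (a := (0 : ℝ)) (s := Ioi 0))).exists
      have hs0 : 0 < s := hs0
      refine (ciInf_le (hbdd _) (⟨_, hs⟩ : I)).trans_lt ?_
      have e : R (y - s • v - P) = R (y - P) - s • EuclideanSpace.single (Fin.last m) 1 := by
        rw [← hR, ← map_smul, ← map_sub]; congr 1; abel
      simp only [hφ, e, horiz_sub, vert_sub, horiz_smul, vert_smul, horiz_single_last,
        vert_single_last, smul_zero, sub_zero, sub_self, norm_zero]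
      linarith
    · intro hlt
      obtain ⟨⟨x, hxU, hxB⟩, hx⟩ := exists_lt_of_ciInf_lt hlt
      simp only [hφ] at hx
      set s := vert (R (y - P)) - vert (R (x - P)) with hs
      set n := ‖horiz (R (y - P)) - horiz (R (x - P))‖ with hn
      have hLn : (L : ℝ) * n < s := by linarith
      have hs0 : 0 < s := lt_of_le_of_lt (by positivity) hLn
      -- Here y lies in the open cone with vertex x, so y - x is s times a vector at distance n / s
      -- < κ from v.
      have e : x + s • (s⁻¹ • (y - x)) = y := by
        rw [smul_smul, mul_inv_cancel₀ hs0.ne', one_smul]; abel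
      have := hc x ⟨hxU, hxB⟩ (s⁻¹ • (y - x)) ?_ s hs0 (by rwa [e])
      · rwa [e] at this
      · have e1 : s⁻¹ • (y - x) - v = s⁻¹ • ((y - x) - s • v) := by
          rw [smul_sub _ (y - x), smul_smul, inv_mul_cancel₀ hs0.ne', one_smul]
        have e3 : R ((y - x) - s • v) = (R (y - P) - R (x - P)) -
            s • EuclideanSpace.single (Fin.last m) 1 := by
          rw [← hR, ← map_smul, ← map_sub, ← map_sub]; congr 1; abel
        have e2 : ‖(y - x) - s • v‖ = n := by
          rw [← R.norm_map, norm_eq_horiz_of_vert_eq_zero, e3]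
          · simp only [horiz_sub, horiz_smul, horiz_single_last, smul_zero, sub_zero, hn]
          · rw [e3]; simp only [vert_sub, vert_smul, vert_single_last, mul_one, hs, sub_self]
        rw [mem_ball, dist_eq_norm, e1, norm_smul, e2, Real.norm_of_nonneg (by positivity),
          inv_mul_lt_iff₀ hs0]
        have : (L : ℝ) = κ⁻¹ := rfl
        rw [this, inv_mul_lt_iff₀ hκ] at hLn
        linarith

end Cones

/-! ### Smooth profiles with nearly optimal slope -/

/-- A smooth function equal to `s` for `s ≥ 1` and to `0` near `s ≤ 0`, of slope at most
`1 + O(w)`. -/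
noncomputable def softRamp (w s : ℝ) : ℝ :=
  if 0 < s then s * Real.smoothTransition (1 + w * Real.log s) else 0

/-- A smooth step from `0` on `s ≤ 0` to `1` on `s ≥ 1`, of slope at most `1 + O(w)`. -/
noncomputable def softStep (w s : ℝ) : ℝ := 1 - softRamp w (1 - softRamp w s)

theorem softRamp_of_nonpos {w s : ℝ} (hs : s ≤ 0) : softRamp w s = 0 := if_neg (not_lt.2 hs)

theorem softRamp_of_one_le {w s : ℝ} (hw : 0 < w) (hs : 1 ≤ s) : softRamp w s = s := by
  rw [softRamp, if_pos (by linarith), Real.smoothTransition.one_of_one_le, mul_one]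
  have := Real.log_nonneg hs
  nlinarith [mul_nonneg hw.le this]

/-- The cutoff vanishes as soon as log s ≤ -1/w. The neighbourhood is taken in both variables
because the diffeomorphism family uses a width w that depends on its parameter b. -/
theorem softRamp_eventuallyEq_zero {w s : ℝ} (hw : 0 < w) (hs : s ≤ 0) :
    ∀ᶠ p : ℝ × ℝ in nhds (w, s), softRamp p.1 p.2 = 0 := by
  have h1 : ∀ᶠ p : ℝ × ℝ in nhds (w, s), w / 2 < p.1 :=
    continuous_fst.continuousAt.eventually (lt_mem_nhds (by simpa using hw))
  have h2 : ∀ᶠ p : ℝ × ℝ in nhds (w, s), p.2 < Real.exp (-(2 / w)) :=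
    continuous_snd.continuousAt.eventually (gt_mem_nhds (hs.trans_lt (Real.exp_pos _)))
  filter_upwards [h1, h2] with p hp1 hp2
  by_cases hp : 0 < p.2
  · rw [softRamp, if_pos hp, Real.smoothTransition.zero_of_nonpos, mul_zero]
    have hl := (Real.log_lt_iff_lt_exp hp).2 hp2
    have : 2 / w * (w / 2) = 1 := by field_simp
    have h3 : 0 < 2 / w := by positivity
    nlinarith
  · exact softRamp_of_nonpos (not_lt.1 hp)

theorem contDiffAt_softRamp {w : ℝ} (hw : 0 < w) (s : ℝ) :
    ContDiffAt ℝ ∞ (fun p : ℝ × ℝ => softRamp p.1 p.2) (w, s) := by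
  rcases le_or_gt s 0 with hs | hs
  · exact contDiffAt_const.congr_of_eventuallyEq (softRamp_eventuallyEq_zero hw hs)
  · have h : ∀ᶠ p : ℝ × ℝ in nhds (w, s), softRamp p.1 p.2 =
        p.2 * Real.smoothTransition (1 + p.1 * Real.log p.2) := by
      filter_upwards [continuous_snd.continuousAt.eventually (lt_mem_nhds hs)] with p hp
      exact if_pos hp
    refine ContDiffAt.congr_of_eventuallyEq ?_ h
    refine contDiffAt_snd.mul (Real.smoothTransition.contDiffAt.comp (w, s) ?_)
    exact contDiffAt_const.add (contDiffAt_fst.mul (contDiffAt_snd.log hs.ne'))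

theorem contDiff_softRamp {w : ℝ} (hw : 0 < w) : ContDiff ℝ ∞ (softRamp w) :=
  contDiff_iff_contDiffAt.2 fun s =>
    (contDiffAt_softRamp hw s).comp s (contDiffAt_const.prodMk contDiffAt_id)

theorem contDiffAt_softStep {w : ℝ} (hw : 0 < w) (s : ℝ) :
    ContDiffAt ℝ ∞ (fun p : ℝ × ℝ => softStep p.1 p.2) (w, s) := by
  refine contDiffAt_const.sub ?_
  exact (contDiffAt_softRamp hw (1 - softRamp w s)).comp (w, s)
    (contDiffAt_fst.prodMk (contDiffAt_const.sub (contDiffAt_softRamp hw s)))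

theorem contDiff_softStep {w : ℝ} (hw : 0 < w) : ContDiff ℝ ∞ (softStep w) :=
  contDiff_iff_contDiffAt.2 fun s =>
    (contDiffAt_softStep hw s).comp s (contDiffAt_const.prodMk contDiffAt_id)

theorem exists_deriv_smoothTransition_bound :
    ∃ C : ℝ, 0 ≤ C ∧ ∀ x, deriv Real.smoothTransition x ∈ Icc 0 C := by
  have hd : Continuous (deriv Real.smoothTransition) :=
    (Real.smoothTransition.contDiff (n := 1)).continuous_deriv le_rfl
  obtain ⟨C, hC⟩ := isCompact_Icc.bddAbove_image (hd.continuousOn (s := Icc 0 1))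
  refine ⟨max C 0, le_max_right _ _, fun x => ⟨Real.smoothTransition.monotone.deriv_nonneg, ?_⟩⟩
  by_cases hx : x ∈ Icc (0 : ℝ) 1
  · exact (hC (mem_image_of_mem _ hx)).trans (le_max_left _ _)
  · have : deriv Real.smoothTransition x = 0 := by
      rw [mem_Icc, not_and_or, not_le, not_le] at hx
      rcases hx with hx | hx
      · have : Real.smoothTransition =ᶠ[nhds x] fun _ => 0 := by
          filter_upwards [gt_mem_nhds hx] with y hy
          exact Real.smoothTransition.zero_of_nonpos hy.le
        rw [this.deriv_eq, deriv_const]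
      · have : Real.smoothTransition =ᶠ[nhds x] fun _ => 1 := by
          filter_upwards [lt_mem_nhds hx] with y hy
          exact Real.smoothTransition.one_of_one_le hy.le
        rw [this.deriv_eq, deriv_const]
    rw [this]; exact le_max_right _ _

/-- Logarithmic cutoff: with T the smooth transition evaluated at 1 + w log s, the factor s cancels
the 1/s from the logarithm, and the derivative is T + wT'. -/
theorem exists_deriv_softRamp_bound :
    ∃ C : ℝ, 0 ≤ C ∧ ∀ w, 0 < w → ∀ s, deriv (softRamp w) s ∈ Icc 0 (1 + C * w) := by
  obtain ⟨C, hC0, hC⟩ := exists_deriv_smoothTransition_bound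
  refine ⟨C, hC0, fun w hw s => ?_⟩
  rcases le_or_gt s 0 with hs | hs
  · have : softRamp w =ᶠ[nhds s] fun _ => 0 := by
      have := (softRamp_eventuallyEq_zero hw hs)
      exact (Continuous.prodMk_right w).continuousAt.eventually this
    rw [this.deriv_eq, deriv_const]
    exact ⟨le_rfl, by positivity⟩
  · have h : softRamp w =ᶠ[nhds s] fun s => s * Real.smoothTransition (1 + w * Real.log s) := by
      filter_upwards [lt_mem_nhds hs] with y hy
      exact if_pos hy
    have hst : HasDerivAt Real.smoothTransition
        (deriv Real.smoothTransition (1 + w * Real.log s)) (1 + w * Real.log s) :=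
      ((Real.smoothTransition.contDiff (n := 1)).differentiable one_ne_zero _).hasDerivAt
    have hd := (hasDerivAt_id s).mul
      (hst.comp s (((Real.hasDerivAt_log hs.ne').const_mul w).const_add 1))
    have hd' : deriv (softRamp w) s = Real.smoothTransition (1 + w * Real.log s) +
        deriv Real.smoothTransition (1 + w * Real.log s) * w := by
      rw [h.deriv_eq]
      refine (HasDerivAt.deriv (f := fun s => s * Real.smoothTransition (1 + w * Real.log s))
        hd).trans ?_
      simp only [Function.comp, id]; field_simp
    rw [hd']
    have h1 := hC (1 + w * Real.log s)
    have h2 := Real.smoothTransition.nonneg (1 + w * Real.log s)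
    have h3 := Real.smoothTransition.le_one (1 + w * Real.log s)
    exact ⟨by nlinarith [h1.1], by nlinarith [h1.2]⟩

theorem softRamp_le_self {w s : ℝ} (hs : 0 ≤ s) : softRamp w s ≤ s := by
  unfold softRamp
  split_ifs
  · exact mul_le_of_le_one_right hs (Real.smoothTransition.le_one _)
  · exact hs

theorem softRamp_nonneg (w s : ℝ) : 0 ≤ softRamp w s := by
  unfold softRamp
  split_ifs with h
  · exact mul_nonneg h.le (Real.smoothTransition.nonneg _)
  · exact le_rfl

theorem softStep_of_nonpos {w s : ℝ} (hw : 0 < w) (hs : s ≤ 0) : softStep w s = 0 := by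
  rw [softStep, softRamp_of_nonpos hs, sub_zero, softRamp_of_one_le hw le_rfl, sub_self]

theorem softStep_of_one_le {w s : ℝ} (hw : 0 < w) (hs : 1 ≤ s) : softStep w s = 1 := by
  rw [softStep, softRamp_of_one_le hw hs, softRamp_of_nonpos (by linarith), sub_zero]

theorem softStep_mem_Icc (w s : ℝ) : softStep w s ∈ Icc (0 : ℝ) 1 := by
  refine ⟨?_, by unfold softStep; linarith [softRamp_nonneg w (1 - softRamp w s)]⟩
  unfold softStep
  rcases le_or_gt (softRamp w s) 1 with h | h
  · linarith [softRamp_le_self (w := w) (sub_nonneg.2 h), softRamp_nonneg w s]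
  · rw [softRamp_of_nonpos (by linarith)]; norm_num

theorem hasDerivAt_softStep {w : ℝ} (hw : 0 < w) (s : ℝ) :
    HasDerivAt (softStep w) (deriv (softStep w) s) s :=
  ((contDiff_softStep hw).differentiable (by simp) s).hasDerivAt

theorem exists_deriv_softStep_bound :
    ∃ C : ℝ, 0 ≤ C ∧ ∀ w, 0 < w → ∀ s, deriv (softStep w) s ∈ Icc 0 ((1 + C * w) ^ 2) := by
  obtain ⟨C, hC0, hC⟩ := exists_deriv_softRamp_bound
  refine ⟨C, hC0, fun w hw s => ?_⟩
  have hd : ∀ s, HasDerivAt (softRamp w) (deriv (softRamp w) s) s := fun s =>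
    ((contDiff_softRamp hw).differentiable (by simp) s).hasDerivAt
  have h := ((hd (1 - softRamp w s)).comp s ((hd s).const_sub 1)).const_sub 1
  have e : deriv (softStep w) s =
      deriv (softRamp w) (1 - softRamp w s) * deriv (softRamp w) s := by
    refine (HasDerivAt.deriv (f := softStep w) h).trans ?_
    ring
  have h1 := hC w hw s
  have h2 := hC w hw (1 - softRamp w s)
  rw [e, sq]
  exact ⟨mul_nonneg h2.1 h1.1, mul_le_mul h2.2 h1.2 h1.1 (by positivity)⟩

theorem deriv_softStep_of_one_le {w s : ℝ} (hw : 0 < w) (hs : 1 ≤ s) :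
    deriv (softStep w) s = 0 := by
  have h : IsMaxOn (softStep w) univ s := fun y _ => by
    rw [mem_ofPred, softStep_of_one_le hw hs]; exact (softStep_mem_Icc w y).2
  exact (h.isLocalMax Filter.univ_mem).deriv_eq_zero

/-- The function must drop by ε over an interval of length 3ε/2, with mean slope -2/3. A step of
nearly optimal slope therefore stays above -1 with room to spare. -/
theorem exists_isLevelShift : ∃ h, IsLevelShift h := by
  obtain ⟨C, hC0, hC⟩ := exists_deriv_softStep_bound
  -- With Cw ≤ 1/10 the slope is at most (2/3)(11/10)² < 9/10 in absolute value, which allows σ =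
  -- 1/10.
  set w : ℝ := 1 / (10 * (C + 1)) with hwdef
  have hw : 0 < w := by positivity
  have hCw : C * w ≤ 1 / 10 := by
    rw [hwdef, mul_one_div, div_le_div_iff₀ (by positivity) (by norm_num)]; linarith
  have hCw0 : 0 ≤ C * w := by positivity
  refine ⟨fun ε r => ε * softStep w ((5 / 2 - r / ε) / (3 / 2)), 1 / 10, by norm_num, 1, one_pos,
    fun ε hε => ?_⟩
  have hε0 : 0 < ε := hε.1
  have hd : ∀ r, HasDerivAt (fun r => ε * softStep w ((5 / 2 - r / ε) / (3 / 2)))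
      (-(2 / 3 * deriv (softStep w) ((5 / 2 - r / ε) / (3 / 2)))) r := by
    intro r
    have h := ((hasDerivAt_softStep hw ((5 / 2 - r / ε) / (3 / 2))).comp r
      ((((hasDerivAt_id r).div_const ε).const_sub (5 / 2)).div_const (3 / 2))).const_mul ε
    refine h.congr_deriv ?_
    field_simp
  refine ⟨?_, fun r hr => ?_, fun r hr => ?_, fun r hr => ?_, fun r hr => ?_⟩
  · have : ContDiff ℝ ∞ (fun r : ℝ => (5 / 2 - r / ε) / (3 / 2)) := by fun_prop
    exact (contDiff_const.mul ((contDiff_softStep hw).comp this)).contDiffOn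
  · have := softStep_mem_Icc w ((5 / 2 - r / ε) / (3 / 2))
    exact ⟨mul_nonneg hε0.le this.1, mul_le_of_le_one_right hε0.le this.2⟩
  · change ε * softStep w ((5 / 2 - r / ε) / (3 / 2)) = ε
    rw [softStep_of_one_le hw, mul_one]
    have : r / ε ≤ 1 := (div_le_one hε0).2 hr.2
    linarith
  · change ε * softStep w ((5 / 2 - r / ε) / (3 / 2)) = 0
    rw [softStep_of_nonpos hw, mul_zero]
    have : 5 / 2 ≤ r / ε := by rw [le_div_iff₀ hε0]; linarith
    linarith
  · rw [(hd r).deriv]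
    have := hC w hw ((5 / 2 - r / ε) / (3 / 2))
    have h2 : (1 + C * w) ^ 2 ≤ (11 / 10) ^ 2 := by gcongr; linarith
    constructor <;> nlinarith [this.1, this.2]

/-- The identity is corrected by (b - a) times a bump equal to 1 at a and to 0 outside [0,1]. On
each side of a only one factor of the bump varies. The piecewise linear bump gives slopes b/a and (1
- b)/(1 - a), both positive; the smooth one stays close enough to it if its width is small compared
with b(1 - b). -/
theorem exists_isDiffeoFamily : ∃ u, IsDiffeoFamily u := by
  obtain ⟨C, hC0, hC⟩ := exists_deriv_softStep_bound
  set W : ℝ → ℝ := fun b => b * (1 - b) / (10 * (C + 1)) with hW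
  have hW0 : ∀ b ∈ Ioo (0 : ℝ) 1, 0 < W b := fun b hb =>
    div_pos (mul_pos hb.1 (sub_pos.2 hb.2)) (by positivity)
  have hslope : ∀ b ∈ Ioo (0 : ℝ) 1, (1 + C * W b) ^ 2 * (1 - b * (1 - b)) < 1 := by
    intro b hb
    have hk0 : 0 < b * (1 - b) := mul_pos hb.1 (sub_pos.2 hb.2)
    have hk1 : b * (1 - b) < 1 := by nlinarith [hb.1, hb.2]
    have h0 : 0 ≤ C * W b := mul_nonneg hC0 (hW0 b hb).le
    have h1 : C * W b ≤ b * (1 - b) / 10 := by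
      simp only [hW]
      rw [← mul_div_assoc, div_le_div_iff₀ (by positivity) (by norm_num)]; nlinarith
    set k := b * (1 - b)
    have : (1 + C * W b) ^ 2 ≤ (1 + k / 10) ^ 2 := by gcongr
    refine (mul_le_mul_of_nonneg_right this (by linarith)).trans_lt ?_
    nlinarith [mul_pos hk0 hk0, mul_pos (mul_pos hk0 hk0) hk0]
  refine ⟨fun a b c => c + (b - a) * (softStep (W b) (c / a) *
    softStep (W b) ((1 - c) / (1 - a))), ?_, ?_, ?_, ?_⟩
  · rintro ⟨a, b, c⟩ ⟨ha, hb, -⟩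
    simp only at ha hb
    have ha' : (1 - a) ≠ 0 := (sub_pos.2 ha.2).ne'
    refine ContDiffAt.contDiffWithinAt ?_
    have hWs : ContDiffAt ℝ ∞ (fun p : ℝ × ℝ × ℝ => W p.2.1) (a, b, c) := by
      simp only [hW]; fun_prop
    have pa : ContDiffAt ℝ ∞ (fun p : ℝ × ℝ × ℝ => p.1) (a, b, c) := by fun_prop
    have pc : ContDiffAt ℝ ∞ (fun p : ℝ × ℝ × ℝ => p.2.2) (a, b, c) := by fun_prop
    have pb : ContDiffAt ℝ ∞ (fun p : ℝ × ℝ × ℝ => p.2.1) (a, b, c) := by fun_prop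
    have h1 : ContDiffAt ℝ ∞ (fun p : ℝ × ℝ × ℝ => p.2.2 / p.1) (a, b, c) := pc.div pa ha.1.ne'
    have h2 : ContDiffAt ℝ ∞ (fun p : ℝ × ℝ × ℝ => (1 - p.2.2) / (1 - p.1)) (a, b, c) :=
      (contDiffAt_const.sub pc).div (contDiffAt_const.sub pa) ha'
    have h3 : ContDiffAt ℝ ∞ (fun p : ℝ × ℝ × ℝ => softStep (W p.2.1) (p.2.2 / p.1)) (a, b, c) :=
      ContDiffAt.comp (g := fun p : ℝ × ℝ => softStep p.1 p.2) (a, b, c)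
        (contDiffAt_softStep (hW0 b hb) (c / a)) (hWs.prodMk h1)
    have h4 : ContDiffAt ℝ ∞ (fun p : ℝ × ℝ × ℝ => softStep (W p.2.1) ((1 - p.2.2) / (1 - p.1)))
        (a, b, c) :=
      ContDiffAt.comp (g := fun p : ℝ × ℝ => softStep p.1 p.2) (a, b, c)
        (contDiffAt_softStep (hW0 b hb) ((1 - c) / (1 - a))) (hWs.prodMk h2)
    exact pc.add ((pb.sub pa).mul (h3.mul h4))
  · intro a ha b hb c
    have hw := hW0 b hb
    have ha1 : 0 < 1 - a := sub_pos.2 ha.2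
    have hb1 : 0 < 1 - b := sub_pos.2 hb.2
    have h1 := (hasDerivAt_softStep hw (c / a)).comp c ((hasDerivAt_id c).div_const a)
    have h2 := (hasDerivAt_softStep hw ((1 - c) / (1 - a))).comp c
      (((hasDerivAt_id c).const_sub 1).div_const (1 - a))
    have h := (hasDerivAt_id c).add ((h1.mul h2).const_mul (b - a))
    refine lt_of_lt_of_eq ?_ (HasDerivAt.deriv (f := fun c => c + (b - a) *
      (softStep (W b) (c / a) * softStep (W b) ((1 - c) / (1 - a)))) h).symm
    simp only [Function.comp, id]
    have d1 := hC _ hw (c / a)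
    have d2 := hC _ hw ((1 - c) / (1 - a))
    have hs := hslope b hb
    rcases le_total c a with hca | hca
    · have e : 1 ≤ (1 - c) / (1 - a) := by rw [le_div_iff₀ ha1]; linarith
      rw [softStep_of_one_le hw e, deriv_softStep_of_one_le hw e]
      set X := deriv (softStep (W b)) (c / a)
      have key : (a - b) / a * X < 1 := by
        rcases le_total a b with hab | hab
        · have : (a - b) / a ≤ 0 := div_nonpos_of_nonpos_of_nonneg (by linarith) ha.1.le
          nlinarith [d1.1]
        -- The left side is 1 - b/a, and b/a ≥ b ≥ b(1 - b). On the other side of a the roles of b/a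
        -- are played by (1 - b)/(1 - a).
        · have h3 : (a - b) / a ≤ 1 - b * (1 - b) := by
            rw [div_le_iff₀ ha.1]
            nlinarith [mul_pos hb.1 hb1, mul_pos hb.1 (sub_pos.2 ha.2), mul_pos ha.1 hb.1,
              mul_pos (mul_pos ha.1 hb.1) hb.1]
          have h4 : 0 ≤ (a - b) / a := div_nonneg (by linarith) ha.1.le
          nlinarith [mul_le_mul h3 d1.2 d1.1 (h4.trans h3)]
      have : (b - a) * (X * (1 / a) * 1 + softStep (W b) (c / a) * (0 * (-1 / (1 - a)))) =
        -((a - b) / a * X) := by ring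
      rw [this]; linarith
    · have e : 1 ≤ c / a := by rw [le_div_iff₀ ha.1]; linarith
      rw [softStep_of_one_le hw e, deriv_softStep_of_one_le hw e]
      set X := deriv (softStep (W b)) ((1 - c) / (1 - a))
      have key : (b - a) / (1 - a) * X < 1 := by
        rcases le_total b a with hab | hab
        · have : (b - a) / (1 - a) ≤ 0 := div_nonpos_of_nonpos_of_nonneg (by linarith) ha1.le
          nlinarith [d2.1]
        · have h3 : (b - a) / (1 - a) ≤ 1 - b * (1 - b) := by
            rw [div_le_iff₀ ha1]
            nlinarith [mul_pos hb.1 hb1, mul_pos hb1 ha.1, mul_pos ha1 hb1,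
              mul_pos (mul_pos ha1 hb1) hb1]
          have h4 : 0 ≤ (b - a) / (1 - a) := div_nonneg (by linarith) ha1.le
          nlinarith [mul_le_mul h3 d2.2 d2.1 (h4.trans h3)]
      have : (b - a) * (0 * (1 / a) * softStep (W b) ((1 - c) / (1 - a)) +
          1 * (X * (-1 / (1 - a)))) = -((b - a) / (1 - a) * X) := by ring
      rw [this]; linarith
  · intro a ha b hb c hc
    have ha1 : 0 < 1 - a := sub_pos.2 ha.2
    rw [mem_Icc, not_and_or, not_le, not_le] at hc
    rcases hc with hc | hc
    · rw [softStep_of_nonpos (hW0 b hb) (div_nonpos_of_nonpos_of_nonneg hc.le ha.1.le)]; ring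
    · rw [softStep_of_nonpos (s := (1 - c) / (1 - a)) (hW0 b hb)
        (div_nonpos_of_nonpos_of_nonneg (by linarith) ha1.le)]; ring
  · intro a ha b hb
    have ha1 : (1 - a) ≠ 0 := (sub_pos.2 ha.2).ne'
    rw [div_self ha.1.ne', div_self ha1, softStep_of_one_le (hW0 b hb) le_rfl]; ring

/-! ### Flows of bounded Lipschitz vector fields -/

section Flow

variable {m : ℕ} {X : Euc m → Euc m} {S : ℝ → Euc m → Euc m} {K : NNReal}

/-- Since the speed is at most 1, a solution stays in the ball of radius T during the time interval
[-T, T], so Picard–Lindelöf applies on every such interval. By uniqueness the solutions agree, and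
at time t the one with T = |t| + 1 is used. -/
theorem LipschitzWith.exists_isFlow (hX : LipschitzWith K X) (hb : ∀ x, ‖X x‖ ≤ 1) :
    ∃ S, IsFlow X S := by
  have hex : ∀ x : Euc m, ∀ T : NNReal, ∃ α : ℝ → Euc m, α 0 = x ∧
      ∀ t ∈ Ioo (-T : ℝ) T, HasDerivAt α (X (α t)) t := by
    intro x T
    have h0 : (0 : ℝ) ∈ Icc (-T : ℝ) T := ⟨by simp, T.2⟩
    have hp : IsPicardLindelof (fun _ => X) (tmin := -T) (tmax := T) ⟨0, h0⟩ x T 0 1 K :=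
      ⟨fun _ _ => hX.lipschitzOnWith, fun _ _ => continuousOn_const, fun _ _ x _ => hb x, by simp⟩
    obtain ⟨α, hα0, hα⟩ := hp.exists_eq_forall_mem_Icc_hasDerivWithinAt₀
    exact ⟨α, hα0, fun t ht => (hα t ⟨ht.1.le, ht.2.le⟩).hasDerivAt (Icc_mem_nhds ht.1 ht.2)⟩
  choose α hα0 hα using hex
  have huniq : ∀ x, ∀ T T' : NNReal, T ≤ T' → EqOn (α x T) (α x T') (Ioo (-T : ℝ) T) := by
    intro x T T' hT t ht
    have hT0 : (0 : ℝ) < T := by linarith [ht.1, ht.2]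
    have hTT : (T : ℝ) ≤ T' := hT
    refine ODE_solution_unique_of_mem_Ioo (v := fun _ => X) (s := fun _ => univ) (K := K)
      (t₀ := 0) (fun _ _ => hX.lipschitzOnWith) ⟨by linarith, hT0⟩
      (fun t ht => ⟨hα x T t ht, trivial⟩) (fun t ht => ⟨hα x T' t ⟨?_, ?_⟩, trivial⟩) ?_ ht
    · linarith [ht.1]
    · linarith [ht.2]
    · rw [hα0, hα0]
  refine ⟨fun t x => α x (‖t‖₊ + 1) t, fun x => ⟨hα0 _ _, fun t => ?_⟩⟩
  have hlt : ∀ᶠ s in nhds t, s ∈ Ioo (-(‖t‖₊ + 1 : NNReal) : ℝ) (‖t‖₊ + 1 : NNReal) := by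
    refine Ioo_mem_nhds ?_ ?_ <;> push_cast <;> rw [Real.norm_eq_abs]
    · linarith [neg_abs_le t]
    · linarith [le_abs_self t]
  refine (hα x (‖t‖₊ + 1) t hlt.self_of_nhds).congr_of_eventuallyEq ?_
  filter_upwards [hlt] with s hs
  have hs' : s ∈ Ioo (-(‖s‖₊ + 1 : NNReal) : ℝ) (‖s‖₊ + 1 : NNReal) := by
    constructor <;> push_cast <;> rw [Real.norm_eq_abs]
    · linarith [neg_abs_le s]
    · linarith [le_abs_self s]
  rcases le_total (‖s‖₊ + 1) (‖t‖₊ + 1) with h | h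
  · exact huniq x _ _ h hs'
  · exact (huniq x _ _ h hs).symm

theorem IsFlow.add (hS : IsFlow X S) (hX : LipschitzWith K X) (s t : ℝ) (x : Euc m) :
    S (s + t) x = S s (S t x) := by
  have := ODE_solution_unique_univ (v := fun _ => X) (s := fun _ => univ) (K := K) (t₀ := 0)
    (f := fun s => S (s + t) x) (g := fun s => S s (S t x)) (fun _ => hX.lipschitzOnWith)
    (fun s => ⟨((hS x).2 (s + t)).comp_add_const s t, trivial⟩)
    (fun s => ⟨(hS (S t x)).2 s, trivial⟩) (by simp [(hS _).1])
  exact congrFun this s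

theorem IsFlow.dist_time_le (hS : IsFlow X S) (hb : ∀ x, ‖X x‖ ≤ 1) (s t : ℝ) (x : Euc m) :
    dist (S s x) (S t x) ≤ |s - t| := by
  have := convex_univ.norm_image_sub_le_of_norm_hasDerivWithin_le (f := fun s => S s x)
    (fun s _ => ((hS x).2 s).hasDerivWithinAt) (fun s _ => hb _) (mem_univ t) (mem_univ s)
  rwa [one_mul, ← dist_eq_norm, Real.norm_eq_abs] at this

theorem IsFlow.dist_space_le_of_nonneg (hS : IsFlow X S) (hX : LipschitzWith K X) {t : ℝ}
    (ht : 0 ≤ t) (x y : Euc m) : dist (S t x) (S t y) ≤ dist x y * Real.exp (K * t) := by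
  have := dist_le_of_trajectories_ODE (v := fun _ => X) (a := 0) (b := t) (δ := dist x y)
    (f := fun s => S s x) (g := fun s => S s y) (fun _ => hX)
    (fun s _ => ((hS x).2 s).continuousAt.continuousWithinAt)
    (fun s _ => ((hS x).2 s).hasDerivWithinAt)
    (fun s _ => ((hS y).2 s).continuousAt.continuousWithinAt)
    (fun s _ => ((hS y).2 s).hasDerivWithinAt) (by simp [(hS _).1]) t ⟨ht, le_rfl⟩
  simpa using this

theorem IsFlow.reverse (hS : IsFlow X S) : IsFlow (fun x => -X x) (fun t => S (-t)) := by
  refine fun x => ⟨by simpa using (hS x).1, fun t => ?_⟩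
  have h := ((hS x).2 (-t)).scomp t (hasDerivAt_neg t)
  rw [neg_one_smul] at h
  exact h

theorem IsFlow.dist_space_le (hS : IsFlow X S) (hX : LipschitzWith K X) {t : ℝ}
    (ht : |t| ≤ 1) (x y : Euc m) : dist (S t x) (S t y) ≤ Real.exp K * dist x y := by
  have key : dist (S t x) (S t y) ≤ dist x y * Real.exp (K * |t|) := by
    rcases le_total 0 t with h | h
    · rw [abs_of_nonneg h]; exact hS.dist_space_le_of_nonneg hX h x y
    · have := hS.reverse.dist_space_le_of_nonneg hX.neg (neg_nonneg.2 h) x y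
      rw [abs_of_nonpos h]
      simpa using this
  rw [mul_comm]
  refine key.trans ?_
  gcongr
  exact mul_le_of_le_one_right K.2 ht

end Flow

/-! ### Existence of the choices in the Ball–Zarnescu construction -/

section Existence

variable {m : ℕ} {U : Set (Euc m)}

theorem contDiff_smul_of_tsupport_subset {V : Set (Euc m)} (hV : IsOpen V) {γ : Euc m → ℝ}
    {G : Euc m → Euc m} (hγ : ContDiff ℝ ∞ γ) (hG : ContDiffOn ℝ ∞ G V) (h : tsupport γ ⊆ V) :
    ContDiff ℝ ∞ (fun x => γ x • G x) := by
  rw [contDiff_iff_contDiffAt]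
  intro x
  by_cases hx : x ∈ tsupport γ
  · exact hγ.contDiffAt.smul (hG.contDiffAt (hV.mem_nhds (h hx)))
  · refine (contDiffAt_const (c := (0 : Euc m))).congr_of_eventuallyEq ?_
    filter_upwards [(isClosed_tsupport γ).isOpen_compl.mem_nhds hx] with y hy
    rw [image_eq_zero_of_notMem_tsupport hy, zero_smul]

theorem norm_smul_le_one {V : Set (Euc m)} {γ : Euc m → ℝ} {G : Euc m → Euc m}
    (hγ : ∀ x, γ x ∈ Icc (0 : ℝ) 1) (hG : ∀ P ∈ V, ‖G P‖ = 1) (h : tsupport γ ⊆ V) (x : Euc m) :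
    ‖γ x • G x‖ ≤ 1 := by
  by_cases hx : x ∈ tsupport γ
  · rw [norm_smul, hG x (h hx), mul_one, Real.norm_of_nonneg (hγ x).1]; exact (hγ x).2
  · rw [image_eq_zero_of_notMem_tsupport hx]; simp

theorem exists_lipschitzWith_smul {V : Set (Euc m)} (hV : IsOpen V) {γ : Euc m → ℝ}
    {G : Euc m → Euc m} (hγ : ContDiff ℝ ∞ γ) (hG : ContDiffOn ℝ ∞ G V) (h : tsupport γ ⊆ V)
    (hc : HasCompactSupport γ) : ∃ K : NNReal, LipschitzWith K (fun x => γ x • G x) := by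
  have hs := contDiff_smul_of_tsupport_subset hV hγ hG h
  exact (hs.lipschitzWith_of_hasCompactSupport (n := ∞) hc.smul_right (by simp))

/-- A smooth field of good directions near the boundary. -/
theorem exists_smooth_good_directions (hU : IsOpen U) (hL : HasLipschitzBoundary U)
    (hc : IsCompact (frontier U)) : ∃ V : Set (Euc m), IsOpen V ∧ frontier U ⊆ V ∧
      ∃ G : Euc m → Euc m, ContDiffOn ℝ ∞ G V ∧ (∀ P ∈ V, ‖G P‖ = 1) ∧
        ∀ P ∈ V, IsGoodDirection U P (G P) := by
  choose! v δ hδ κ hκ hcone using fun x (hx : x ∈ frontier U) => hL.exists_coneOn hx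
  set V₀ : Set (Euc m) := ⋃ x ∈ frontier U, ball x (δ x / 2) with hV₀
  have hV₀o : IsOpen V₀ := isOpen_biUnion fun _ _ => isOpen_ball
  have hsub : frontier U ⊆ V₀ := fun x hx =>
    mem_biUnion hx (mem_ball_self (half_pos (hδ x hx)))
  obtain ⟨r, hr, hrV⟩ := hc.exists_cthickening_subset_open hV₀o hsub
  set F := cthickening r (frontier U)
  have hFc : IsClosed F := isClosed_cthickening
  -- The condition is imposed only on the closed neighbourhood F of ∂U. Off F every vector is
  -- admissible, so the partition of unity can be taken on the whole space; locally constant axes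
  -- suffice because cones persist at nearby points.
  obtain ⟨g, hg⟩ := exists_contMDiffMap_forall_mem_convex_of_local_const (n := (⊤ : ℕ∞))
    (modelWithCornersSelf ℝ (Euc m)) (t := fun P => {v | P ∈ F → ConeAt U P v})
    (fun P => by
      by_cases hP : P ∈ F
      · simpa [hP] using convex_coneAt hU P
      · simp [hP, convex_univ])
    (fun P => by
      by_cases hP : P ∈ F
      · obtain ⟨x, hx, hPx⟩ := mem_iUnion₂.1 (hrV hP)
        refine ⟨v x, ?_⟩
        filter_upwards [isOpen_ball.mem_nhds hPx] with y hy _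
        exact ConeAt.of_mem_ball (hκ x hx) hx (hcone x hx) hy
      · refine ⟨0, ?_⟩
        filter_upwards [hFc.isOpen_compl.mem_nhds hP] with y hy h
        exact absurd h hy)
  have hgs : ContDiff ℝ ∞ g := g.contMDiff.contDiff
  have hgF : ∀ P ∈ thickening r (frontier U), ConeAt U P (g P) := fun P hP =>
    hg P (thickening_subset_cthickening _ _ hP)
  have hg0 : ∀ P ∈ thickening r (frontier U), g P ≠ 0 := fun P hP => (hgF P hP).ne_zero hU
  have hn : ∀ P ∈ thickening r (frontier U), ‖‖g P‖⁻¹ • g P‖ = 1 := fun P hP => by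
    rw [norm_smul, norm_inv, norm_norm, inv_mul_cancel₀ (norm_ne_zero_iff.2 (hg0 P hP))]
  refine ⟨thickening r (frontier U), isOpen_thickening, self_subset_thickening hr _,
    fun P => ‖g P‖⁻¹ • g P, fun P hP => ?_, hn, fun P hP => ?_⟩
  · exact (((hgs.contDiffAt.norm ℝ (hg0 P hP)).inv (norm_ne_zero_iff.2 (hg0 P hP))).smul
      hgs.contDiffAt).contDiffWithinAt
  · exact ((hgF P hP).smul (inv_pos.2 (norm_pos_iff.2 (hg0 P hP)))).isGoodDirection hU (hn P hP)

/-- The choices in the Ball–Zarnescu construction exist. -/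
theorem nonempty_ballZarnescuData (hU : IsOpen U) (hL : HasLipschitzBoundary U)
    (hc : IsCompact (frontier U)) : Nonempty (BallZarnescuData U) := by
  obtain ⟨V, hV, hUV, G, hG, hG1, hGg⟩ := exists_smooth_good_directions hU hL hc
  obtain ⟨r, hr, hrV⟩ := hc.exists_cthickening_subset_open hV hUV
  have hd : Disjoint (thickening r (frontier U))ᶜ (cthickening (r / 2) (frontier U)) :=
    disjoint_compl_left_iff_subset.2 (cthickening_subset_thickening' hr (by linarith) _)
  obtain ⟨γ, hγ0, hγ1, hγr⟩ := exists_contMDiffMap_zero_one_of_isClosed (n := (⊤ : ℕ∞))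
    (modelWithCornersSelf ℝ (Euc m)) isOpen_thickening.isClosed_compl isClosed_cthickening hd
  have hγs : ContDiff ℝ ∞ γ := γ.contMDiff.contDiff
  have hts : tsupport γ ⊆ cthickening r (frontier U) := by
    refine closure_minimal (fun x hx => ?_) isClosed_cthickening
    by_contra h
    exact hx (hγ0 fun h' => h (thickening_subset_cthickening _ _ h'))
  have hcs : HasCompactSupport γ := hc.cthickening.of_isClosed_subset (isClosed_tsupport _) hts
  obtain ⟨K, hK⟩ := exists_lipschitzWith_smul hV hγs hG (hts.trans hrV) hcs
  obtain ⟨S, hS⟩ := hK.exists_isFlow (norm_smul_le_one hγr hG1 (hts.trans hrV))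
  obtain ⟨h, hh⟩ := exists_isLevelShift
  obtain ⟨u, hu⟩ := exists_isDiffeoFamily
  exact ⟨⟨V, hV, hUV, G, hG, hG1, hGg, γ, hγs, hγr, hcs, hts.trans hrV,
    ⟨thickening (r / 2) (frontier U), isOpen_thickening, self_subset_thickening (half_pos hr) _,
      fun x hx => hγ1 (thickening_subset_cthickening _ _ hx)⟩, S, hS, h, hh, u, hu⟩⟩

end Existence

/-! ### Monotonicity of the signed distance and of the regularized distance -/

section Distance

variable {m : ℕ} {U : Set (Euc m)} {η : Euc m → ℝ}

theorem signedBdryDist_of_mem {x : Euc m} (hx : x ∈ U) :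
    signedBdryDist U x = infDist x (frontier U) := if_pos hx

theorem signedBdryDist_of_notMem {x : Euc m} (hx : x ∉ U) :
    signedBdryDist U x = -infDist x (frontier U) := if_neg hx

theorem abs_signedBdryDist (U : Set (Euc m)) (x : Euc m) :
    |signedBdryDist U x| = infDist x (frontier U) := by
  unfold signedBdryDist
  split_ifs
  · exact abs_of_nonneg infDist_nonneg
  · rw [abs_neg, abs_of_nonneg infDist_nonneg]

theorem signedBdryDist_pos_iff (hU : IsOpen U) (hne : (frontier U).Nonempty) {x : Euc m} :
    0 < signedBdryDist U x ↔ x ∈ U := by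
  constructor
  · intro h
    by_contra hx
    rw [signedBdryDist_of_notMem hx] at h
    linarith [infDist_nonneg (x := x) (s := frontier U)]
  · intro hx
    rw [signedBdryDist_of_mem hx]
    refine (isClosed_frontier.notMem_iff_infDist_pos hne).1 fun h => ?_
    rw [hU.frontier_eq] at h
    exact h.2 hx

theorem signedBdryDist_eq_zero_iff (hne : (frontier U).Nonempty) {x : Euc m} :
    signedBdryDist U x = 0 ↔ x ∈ frontier U := by
  rw [← abs_eq_zero, abs_signedBdryDist, isClosed_frontier.mem_iff_infDist_zero hne]

theorem signedBdryDist_sub_le (U : Set (Euc m)) (x y : Euc m) :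
    |signedBdryDist U x - signedBdryDist U y| ≤ dist x y := by
  simpa [Real.dist_eq] using (signedBdryDist_lipschitz U).dist_le_mul x y

/-- Under a cone condition, the signed distance grows along the directions of the cone. -/
theorem signedBdryDist_add_le (hU : IsOpen U) {x₀ ξ p : Euc m} {c δ s : ℝ}
    (hx₀ : x₀ ∈ frontier U) (hc : 0 < c) (h : ConeOn U ξ c (ball x₀ δ)) (hs : 0 < s)
    (hδ : 2 * dist p x₀ + 2 * dist (p + s • ξ) x₀ + c * s < δ) :
    signedBdryDist U p + c * s ≤ signedBdryDist U (p + s • ξ) := by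
  set q := p + s • ξ with hq
  have hne : (frontier U).Nonempty := ⟨x₀, hx₀⟩
  have hcs : 0 < c * s := mul_pos hc hs
  have hdp := dist_nonneg (x := p) (y := x₀)
  have hdq := dist_nonneg (x := q) (y := x₀)
  have hf : ∀ z ∈ frontier U, z ∉ U := fun z hz => by
    rw [hU.frontier_eq] at hz; exact hz.2
  -- If z' is in U and z is not, then z - z' cannot lie in s times the cone about ξ. The remainder
  -- of the proof tests this with suitable pairs.
  have key : ∀ z' ∈ U, ∀ z, z ∉ U → dist z' x₀ < δ → dist z x₀ < δ →
      c * s ≤ ‖(z - q) - (z' - p)‖ := by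
    intro z' hz' z hz hz'B hzB
    by_contra! hlt
    have e : z' + s • (ξ + s⁻¹ • ((z - q) - (z' - p))) = z := by
      rw [smul_add, smul_smul, mul_inv_cancel₀ hs.ne', one_smul, hq]; abel
    have := h z' ⟨hz', hz'B⟩ (ξ + s⁻¹ • ((z - q) - (z' - p))) (by
      rw [mem_ball_iff_norm, add_sub_cancel_left, norm_smul, Real.norm_of_nonneg (by positivity),
        inv_mul_lt_iff₀ hs]
      linarith) s hs (by rwa [e])
    rw [e] at this
    exact hz this
  -- A vector shorter than D + cs is a part of length at most D, absorbed by the distance to ∂U,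
  -- plus a part shorter than cs, forbidden by `key`. The strict bound is needed to remain in U
  -- around p; the weak one suffices to remain outside U around q, where D may be 0.
  have split : ∀ (D : ℝ) (e : Euc m), 0 ≤ D → ‖e‖ < D + c * s →
      ∃ e₁ : Euc m, ‖e₁‖ ≤ D ∧ (0 < D → ‖e₁‖ < D) ∧ ‖e - e₁‖ < c * s := by
    intro D e hD he
    have hpos : 0 < D + c * s := by linarith
    have hlt : ‖e‖ / (D + c * s) < 1 := (div_lt_one hpos).2 he
    have e1 : ‖(D / (D + c * s)) • e‖ = D * (‖e‖ / (D + c * s)) := by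
      rw [norm_smul, Real.norm_of_nonneg (by positivity)]; ring
    have e2 : ‖e - (D / (D + c * s)) • e‖ = c * s * (‖e‖ / (D + c * s)) := by
      have : e - (D / (D + c * s)) • e = (c * s / (D + c * s)) • e := by
        have : c * s / (D + c * s) = 1 - D / (D + c * s) := by field_simp; ring
        rw [this]; module
      rw [this, norm_smul, Real.norm_of_nonneg (by positivity)]; ring
    refine ⟨(D / (D + c * s)) • e, ?_, fun hD0 => ?_, ?_⟩
    · rw [e1]; nlinarith
    · rw [e1]; nlinarith
    · rw [e2]; nlinarith
  by_cases hpU : p ∈ U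
  · have hDp : infDist p (frontier U) ≤ dist p x₀ := infDist_le_dist_of_mem hx₀
    have hD0 := (signedBdryDist_pos_iff hU hne).2 hpU
    have hqU : q ∈ U := by
      by_contra hqU
      have := key p hpU q hqU (by linarith) (by linarith)
      simp only [sub_self, norm_zero] at this
      linarith
    rw [signedBdryDist_of_mem hpU] at hD0
    rw [signedBdryDist_of_mem hpU, signedBdryDist_of_mem hqU]
    refine (le_infDist hne).2 fun z hz => ?_
    by_contra! hlt
    rw [dist_comm, dist_eq_norm] at hlt
    obtain ⟨e₁, -, h2, h3⟩ := split _ (z - q) hD0.le hlt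
    have h1 := h2 hD0
    refine absurd (key (p + e₁) ?_ z (hf z hz) ?_ ?_) (not_le.2 (by simpa using h3))
    · rw [← signedBdryDist_pos_iff hU hne]
      have := (abs_le.1 (signedBdryDist_sub_le U (p + e₁) p)).1
      rw [dist_self_add_left, signedBdryDist_of_mem hpU] at this
      linarith
    · have := dist_triangle (p + e₁) p x₀
      rw [dist_self_add_left] at this
      linarith
    · have := dist_triangle z q x₀
      rw [dist_eq_norm z q] at this
      linarith
  · by_cases hqU : q ∈ U
    · rw [signedBdryDist_of_notMem hpU, signedBdryDist_of_mem hqU]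
      by_contra! hlt
      have hlt' : infDist p (frontier U) < c * s - infDist q (frontier U) := by linarith
      obtain ⟨z', hz', hz'd⟩ := (infDist_lt_iff hne).1 hlt'
      obtain ⟨z, hz, hzd⟩ := (infDist_lt_iff hne).1 (lt_sub_comm.1 hz'd)
      obtain ⟨z'', hz''U, hz''⟩ := Metric.mem_closure_iff.1 hz'.1 (c * s - dist q z - dist p z')
        (by linarith)
      have h3 := dist_triangle p z' z''
      refine absurd (key z'' hz''U z (hf z hz) ?_ ?_) (not_le.2 ?_)
      · have := dist_triangle_left z'' x₀ p
        linarith [dist_nonneg (x := q) (y := z)]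
      · have := dist_triangle_left z x₀ q
        linarith [dist_nonneg (x := p) (y := z')]
      · have := norm_sub_le (z - q) (z'' - p)
        rw [← dist_eq_norm z q, ← dist_eq_norm z'' p, dist_comm z q, dist_comm z'' p] at this
        linarith
    · have hDq : infDist q (frontier U) ≤ dist q x₀ := infDist_le_dist_of_mem hx₀
      rw [signedBdryDist_of_notMem hpU, signedBdryDist_of_notMem hqU]
      suffices infDist q (frontier U) + c * s ≤ infDist p (frontier U) by linarith
      refine (le_infDist hne).2 fun z hz => ?_
      by_contra! hlt
      obtain ⟨z', hz'U, hz'⟩ := Metric.mem_closure_iff.1 hz.1 _ (sub_pos.2 hlt)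
      have h0 := dist_triangle p z z'
      have hlt' : ‖z' - p‖ < infDist q (frontier U) + c * s := by
        rw [← dist_eq_norm, dist_comm]; linarith
      obtain ⟨e₁, h1, -, h3⟩ := split _ (z' - p) infDist_nonneg hlt'
      refine absurd (key z' hz'U (q + e₁) ?_ ?_ ?_) (not_le.2 ?_)
      · rw [← signedBdryDist_pos_iff hU hne]
        have := (abs_le.1 (signedBdryDist_sub_le U (q + e₁) q)).2
        rw [dist_self_add_left, signedBdryDist_of_notMem hqU] at this
        linarith
      · have := dist_triangle z' p x₀
        rw [dist_eq_norm z' p] at this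
        linarith
      · have := dist_triangle (q + e₁) q x₀
        rw [dist_self_add_left] at this
        linarith
      · rw [add_sub_cancel_left, norm_sub_rev]; exact h3

theorem IsMollifier.hasCompactSupport (hη : IsMollifier η) : HasCompactSupport η :=
  HasCompactSupport.of_support_subset_isCompact (isCompact_closedBall (0 : Euc m) 1)
    ((subset_tsupport η).trans (hη.supp.trans ball_subset_closedBall))

theorem IsMollifier.norm_lt_one (hη : IsMollifier η) {z : Euc m} (hz : η z ≠ 0) : ‖z‖ < 1 :=
  mem_ball_zero_iff.1 (hη.supp (subset_tsupport η hz))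

theorem integrable_mollifiedDist (U : Set (Euc m)) (hη : IsMollifier η) (x : Euc m) (τ : ℝ) :
    Integrable fun z => signedBdryDist U (x - (τ / 2) • z) * η z :=
  (((signedBdryDist_lipschitz U).continuous.comp (by fun_prop)).mul
    hη.smooth.continuous).integrable_of_hasCompactSupport hη.hasCompactSupport.mul_left

theorem mollifiedDist_add_le (hη : IsMollifier η) {x y : Euc m} {τ σ a : ℝ}
    (h : ∀ z : Euc m, ‖z‖ < 1 →
      signedBdryDist U (x - (τ / 2) • z) + a ≤ signedBdryDist U (y - (σ / 2) • z)) :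
    mollifiedDist U η x τ + a ≤ mollifiedDist U η y σ := by
  have hi : Integrable η :=
    hη.smooth.continuous.integrable_of_hasCompactSupport hη.hasCompactSupport
  have e : a = ∫ z, a * η z := by rw [integral_const_mul, hη.integral_eq_one, mul_one]
  rw [mollifiedDist, mollifiedDist, e,
    ← integral_add (integrable_mollifiedDist U hη x τ) (hi.const_mul a)]
  refine integral_mono ((integrable_mollifiedDist U hη x τ).add (hi.const_mul a))
    (integrable_mollifiedDist U hη y σ) fun z => ?_
  by_cases hz : η z = 0
  · simp [hz]
  · simp only [← add_mul]
    exact mul_le_mul_of_nonneg_right (h z (hη.norm_lt_one hz)) (hη.nonneg z)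

theorem mollifiedDist_le_add (U : Set (Euc m)) (hη : IsMollifier η) (x y : Euc m) (τ σ : ℝ) :
    mollifiedDist U η x τ ≤ mollifiedDist U η y σ + (dist x y + |τ - σ| / 2) := by
  have := mollifiedDist_add_le (U := U) hη (x := x) (y := y) (τ := τ) (σ := σ)
    (a := -(dist x y + |τ - σ| / 2)) fun z hz => by
      have h1 := (abs_le.1 (signedBdryDist_sub_le U (x - (τ / 2) • z) (y - (σ / 2) • z))).2
      have h2 : dist (x - (τ / 2) • z) (y - (σ / 2) • z) ≤ dist x y + |τ - σ| / 2 := by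
        have e : x - (τ / 2) • z - (y - (σ / 2) • z) = (x - y) - ((τ - σ) / 2) • z := by module
        rw [dist_eq_norm, e, dist_eq_norm]
        refine (norm_sub_le _ _).trans ?_
        rw [norm_smul, Real.norm_eq_abs, abs_div, abs_two]
        have : |τ - σ| / 2 * ‖z‖ ≤ |τ - σ| / 2 := mul_le_of_le_one_right (by positivity) hz.le
        linarith
      linarith
  linarith

theorem mollifiedDist_zero (U : Set (Euc m)) (hη : IsMollifier η) (x : Euc m) :
    mollifiedDist U η x 0 = signedBdryDist U x := by
  simp [mollifiedDist, integral_const_mul, hη.integral_eq_one]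

/-- The mollified distance is 1-Lipschitz in x and 1/2-Lipschitz in τ, so the fixed points a and b
satisfy |a - b| ≤ |x - y| + |a - b|/2. -/
theorem abs_regularizedDist_sub_le (U : Set (Euc m)) (hη : IsMollifier η) (x y : Euc m) :
    |regularizedDist U η x - regularizedDist U η y| ≤ 2 * dist x y := by
  have hx := regularizedDist_eq U hη x
  have hy := regularizedDist_eq U hη y
  have h1 := mollifiedDist_le_add U hη x y (regularizedDist U η x) (regularizedDist U η y)
  have h2 := mollifiedDist_le_add U hη y x (regularizedDist U η y) (regularizedDist U η x)
  rw [← hx, ← hy] at h1 h2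
  rw [dist_comm, abs_sub_comm] at h2
  have : |regularizedDist U η x - regularizedDist U η y| ≤
      dist x y + |regularizedDist U η x - regularizedDist U η y| / 2 :=
    abs_le.2 ⟨by linarith, by linarith⟩
  linarith

/-- The implicit equation is compared with its value at τ = 0, which is the signed distance.
Consequently ρ and d have the same sign and 2|d|/3 ≤ |ρ| ≤ 2|d|. -/
theorem abs_regularizedDist_sub_signedBdryDist (U : Set (Euc m)) (hη : IsMollifier η)
    (x : Euc m) :
    |regularizedDist U η x - signedBdryDist U x| ≤ |regularizedDist U η x| / 2 := by
  have hx := regularizedDist_eq U hη x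
  have h1 := mollifiedDist_le_add U hη x x (regularizedDist U η x) 0
  have h2 := mollifiedDist_le_add U hη x x 0 (regularizedDist U η x)
  rw [← hx, mollifiedDist_zero U hη, dist_self, sub_zero, zero_add] at h1
  rw [← hx, mollifiedDist_zero U hη, dist_self, zero_sub, zero_add, abs_neg] at h2
  exact abs_le.2 ⟨by linarith, by linarith⟩

theorem abs_regularizedDist_le (U : Set (Euc m)) (hη : IsMollifier η) (x : Euc m) :
    |regularizedDist U η x| ≤ 2 * infDist x (frontier U) := by
  have h := abs_regularizedDist_sub_signedBdryDist U hη x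
  have h2 := abs_sub_abs_le_abs_sub (regularizedDist U η x) (signedBdryDist U x)
  rw [abs_signedBdryDist] at h2
  linarith

theorem infDist_le_abs_regularizedDist (U : Set (Euc m)) (hη : IsMollifier η) (x : Euc m) :
    infDist x (frontier U) ≤ 3 / 2 * |regularizedDist U η x| := by
  have h := abs_regularizedDist_sub_signedBdryDist U hη x
  have h2 := abs_sub_abs_le_abs_sub (signedBdryDist U x) (regularizedDist U η x)
  rw [abs_signedBdryDist, abs_sub_comm] at h2
  linarith

theorem regularizedDist_pos_iff (hU : IsOpen U) (hne : (frontier U).Nonempty)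
    (hη : IsMollifier η) {x : Euc m} : 0 < regularizedDist U η x ↔ x ∈ U := by
  rw [← signedBdryDist_pos_iff hU hne]
  have h := abs_le.1 (abs_regularizedDist_sub_signedBdryDist U hη x)
  constructor
  · intro hp
    rw [abs_of_pos hp] at h; linarith
  · intro hd
    by_contra! hn
    rw [abs_of_nonpos hn] at h; linarith

theorem regularizedDist_eq_zero_iff (hne : (frontier U).Nonempty)
    (hη : IsMollifier η) {x : Euc m} : regularizedDist U η x = 0 ↔ x ∈ frontier U := by
  rw [← signedBdryDist_eq_zero_iff hne]
  constructor
  · intro h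
    have := abs_regularizedDist_sub_signedBdryDist U hη x
    rw [h, zero_sub, abs_neg, abs_zero, zero_div] at this
    exact abs_nonpos_iff.1 this
  · intro h
    have := abs_regularizedDist_le U hη x
    rw [← abs_signedBdryDist, h, abs_zero, mul_zero] at this
    exact abs_nonpos_iff.1 this

theorem regularizedDist_nonneg_iff (hU : IsOpen U) (hne : (frontier U).Nonempty)
    (hη : IsMollifier η) {x : Euc m} : 0 ≤ regularizedDist U η x ↔ x ∈ closure U := by
  rw [le_iff_lt_or_eq, regularizedDist_pos_iff hU hne hη, eq_comm,
    regularizedDist_eq_zero_iff hne hη, closure_eq_self_union_frontier, mem_union]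

/-- The regularized distance grows along the directions of a cone condition. -/
theorem regularizedDist_add_le (hU : IsOpen U) (hη : IsMollifier η) {x₀ ξ p : Euc m} {c δ s : ℝ}
    (hx₀ : x₀ ∈ frontier U) (hc : 0 < c) (h : ConeOn U ξ c (ball x₀ δ)) (hs : 0 < s)
    (hδ : 6 * dist p x₀ + 2 * dist (p + s • ξ) x₀ + c * s < δ) :
    2 / 3 * c * s ≤ regularizedDist U η (p + s • ξ) - regularizedDist U η p := by
  set q := p + s • ξ with hq
  set a := regularizedDist U η p with ha
  set b := regularizedDist U η q with hb
  have hpa : |a| ≤ 2 * dist p x₀ := (abs_regularizedDist_le U hη p).trans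
    (by linarith [infDist_le_dist_of_mem (x := p) hx₀])
  -- The scale is frozen at a = ρ(p), and the growth of d is averaged. The shift by (a/2)z moves
  -- both points by at most |a|/2 ≤ dist p x₀, which is why the coefficient of dist p x₀ in the
  -- hypothesis is 6 rather than 2. Returning to the scale b = ρ(q) costs |a - b|/2.
  have h1 : mollifiedDist U η p a + c * s ≤ mollifiedDist U η q a := by
    refine mollifiedDist_add_le hη fun z hz => ?_
    have e : q - (a / 2) • z = (p - (a / 2) • z) + s • ξ := by rw [hq]; module
    have hb : ∀ y : Euc m, dist (y - (a / 2) • z) x₀ ≤ dist y x₀ + |a| / 2 := by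
      intro y
      refine (dist_triangle _ y _).trans ?_
      rw [dist_eq_norm (y - _), sub_sub_cancel_left, norm_neg, norm_smul, Real.norm_eq_abs,
        abs_div, abs_two]
      have : |a| / 2 * ‖z‖ ≤ |a| / 2 := mul_le_of_le_one_right (by positivity) hz.le
      linarith
    rw [e]
    refine signedBdryDist_add_le hU hx₀ hc h hs ?_
    rw [← e]
    linarith [hb p, hb q]
  have h2 := mollifiedDist_le_add U hη q q a b
  rw [← regularizedDist_eq U hη p] at h1
  rw [← regularizedDist_eq U hη q, dist_self, zero_add, ← hb] at h2
  rw [← ha] at h1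
  have hcs : 0 < c * s := mul_pos hc hs
  have h3 : c * s ≤ (b - a) + |a - b| / 2 := by linarith
  rcases le_total a b with hab | hab
  · rw [abs_of_nonpos (by linarith)] at h3; linarith
  · rw [abs_of_nonneg (by linarith)] at h3; linarith

end Distance

/-! ### Flows transverse to the level sets of a function -/

/-- The flow `S` of a field of speed at most `1` is transverse to the level sets of `ρ` near
`{ρ = 0}`: along it, `ρ` grows at least at rate `c`. -/
structure TransverseFlow {m : ℕ} (ρ : Euc m → ℝ) (S : ℝ → Euc m → Euc m) (c L δ : ℝ) : Prop where
  c_pos : 0 < c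
  one_le_L : 1 ≤ L
  δ_pos : 0 < δ
  δ_le : δ ≤ 1
  zero : ∀ x, S 0 x = x
  add : ∀ s t x, S (s + t) x = S s (S t x)
  dist_time : ∀ s t x, dist (S s x) (S t x) ≤ |s - t|
  dist_space : ∀ t x y, |t| ≤ 1 → dist (S t x) (S t y) ≤ L * dist x y
  lip : ∀ x y, |ρ x - ρ y| ≤ 2 * dist x y
  growth : ∀ x, |ρ x| < δ → ∀ s t, -δ ≤ s → s ≤ t → t ≤ δ → c * (t - s) ≤ ρ (S t x) - ρ (S s x)

namespace BallZarnescuData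

variable {m : ℕ} {U : Set (Euc m)} {η : Euc m → ℝ}

/-- Compactness of ∂U makes the opening and the radius uniform: near a boundary point, half of its
cone opening absorbs the variation of the continuous field G. -/
theorem exists_coneOn (D : BallZarnescuData U) (hc : IsCompact (frontier U)) :
    ∃ κ > 0, ∃ δ > 0, ∀ x ∈ frontier U, ConeOn U (D.G x) κ (ball x δ) := by
  refine hc.induction_on (p := fun s => ∃ κ > 0, ∃ δ > 0, ∀ x ∈ s, ConeOn U (D.G x) κ (ball x δ))
    ⟨1, one_pos, 1, one_pos, by simp⟩ ?_ ?_ ?_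
  · rintro s t hst ⟨κ, hκ, δ, hδ, h⟩
    exact ⟨κ, hκ, δ, hδ, fun x hx => h x (hst hx)⟩
  · rintro s t ⟨κ, hκ, δ, hδ, h⟩ ⟨κ', hκ', δ', hδ', h'⟩
    refine ⟨min κ κ', lt_min hκ hκ', min δ δ', lt_min hδ hδ', ?_⟩
    rintro x (hx | hx)
    · exact (h x hx).mono (ball_subset_ball (min_le_left _ _)) (by simp)
    · exact (h' x hx).mono (ball_subset_ball (min_le_right _ _)) (by simp)
  · intro x hx
    have hxV := D.frontier_subset hx
    obtain ⟨δ, hδ, κ, hκ, -, hcone⟩ := (D.good_G x hxV).coneAt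
    have hcont : ContinuousAt D.G x :=
      (D.smooth_G.contDiffAt (D.isOpen_V.mem_nhds hxV)).continuousAt
    refine ⟨ball x (δ / 2) ∩ D.G ⁻¹' ball (D.G x) (κ / 2), mem_nhdsWithin_of_mem_nhds
      (Filter.inter_mem (ball_mem_nhds x (half_pos hδ))
        (hcont (ball_mem_nhds _ (half_pos hκ)))), κ / 2, half_pos hκ, δ / 2, half_pos hδ, ?_⟩
    rintro y ⟨hy, hyG⟩
    have hyG : dist (D.G y) (D.G x) < κ / 2 := hyG
    have hy : dist y x < δ / 2 := hy
    exact hcone.mono (ball_subset_ball' (by linarith)) (by linarith)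

/-- Uniform continuity of G near the compact set ∂U, in a region where the cutoff is 1 and the flow
is really that of G. -/
theorem exists_dist_G_le (D : BallZarnescuData U) (hc : IsCompact (frontier U)) {κ : ℝ}
    (hκ : 0 < κ) : ∃ δ > 0, ∀ x ∈ frontier U, ∀ P ∈ ball x δ,
      D.γ P = 1 ∧ dist (D.G P) (D.G x) ≤ κ := by
  refine hc.induction_on (p := fun s => ∃ δ > 0, ∀ x ∈ s, ∀ P ∈ ball x δ,
      D.γ P = 1 ∧ dist (D.G P) (D.G x) ≤ κ)
    ⟨1, one_pos, by simp⟩ ?_ ?_ ?_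
  · rintro s t hst ⟨δ, hδ, h⟩
    exact ⟨δ, hδ, fun x hx => h x (hst hx)⟩
  · rintro s t ⟨δ, hδ, h⟩ ⟨δ', hδ', h'⟩
    refine ⟨min δ δ', lt_min hδ hδ', ?_⟩
    rintro x (hx | hx) P hP
    · exact h x hx P (ball_subset_ball (min_le_left _ _) hP)
    · exact h' x hx P (ball_subset_ball (min_le_right _ _) hP)
  · intro x hx
    have hxV := D.frontier_subset hx
    have hcont : ContinuousAt D.G x :=
      (D.smooth_G.contDiffAt (D.isOpen_V.mem_nhds hxV)).continuousAt
    obtain ⟨N, hN, hUN, hN1⟩ := D.one_γ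
    have hpre : D.G ⁻¹' ball (D.G x) (κ / 2) ∈ nhds x :=
      hcont.preimage_mem_nhds (ball_mem_nhds _ (half_pos hκ))
    obtain ⟨δ, hδ, hball⟩ := Metric.mem_nhds_iff.1 (Filter.inter_mem (hN.mem_nhds (hUN hx)) hpre)
    refine ⟨ball x (δ / 2), mem_nhdsWithin_of_mem_nhds (ball_mem_nhds x (half_pos hδ)), δ / 2,
      half_pos hδ, fun y hy P hP => ?_⟩
    rw [mem_ball] at hy hP
    have h1 := hball (show P ∈ ball x δ from mem_ball.2 (by linarith [dist_triangle P y x]))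
    have h2 := hball (show y ∈ ball x δ from mem_ball.2 (by linarith))
    refine ⟨hN1 P h1.1, ?_⟩
    have h3 : dist (D.G P) (D.G x) < κ / 2 := h1.2
    have h4 : dist (D.G y) (D.G x) < κ / 2 := h2.2
    linarith [dist_triangle_right (D.G P) (D.G y) (D.G x)]

/-- The flow of a field of good directions is transverse to the regularized distance. -/
theorem exists_transverseFlow (D : BallZarnescuData U) (hU : IsOpen U)
    (hc : IsCompact (frontier U)) (hne : (frontier U).Nonempty) (hη : IsMollifier η) :
    ∃ c L δ, TransverseFlow (regularizedDist U η) D.S c L δ := by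
  obtain ⟨κ₀, hκ₀, δ₀, hδ₀, hcone⟩ := D.exists_coneOn hc
  -- Half of the opening is spent on the deviation of the flow from G(x), the other half remains as
  -- the opening of the cone about the mean velocity.
  set κ := min κ₀ 1 / 2 with hκdef
  have hκ : 0 < κ := by positivity
  have hκ1 : κ ≤ 1 / 2 := by have := min_le_right κ₀ 1; linarith
  have hκ2 : κ + κ ≤ κ₀ := by have := min_le_left κ₀ 1; linarith
  obtain ⟨δ₁, hδ₁, hG⟩ := D.exists_dist_G_le hc hκ
  obtain ⟨K, hK⟩ := exists_lipschitzWith_smul D.isOpen_V D.smooth_γ D.smooth_G D.supp_γ D.compact_γ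
  have hb := norm_smul_le_one D.range_γ D.norm_G D.supp_γ
  have hS := D.flow_S
  -- A point with |ρ| < δ is within 2δ of some x in ∂U and remains within 3δ of x for times in [-δ,
  -- δ]. The growth lemma needs at most 6·3δ + 2·3δ + 2κδ ≤ 25δ, so 64 is ample.
  set δ := min (min δ₀ δ₁) 1 / 64 with hδdef
  have hδ : 0 < δ := by positivity
  have h64 : 64 * δ = min (min δ₀ δ₁) 1 := by rw [hδdef]; ring
  have hd0 : 64 * δ ≤ δ₀ := by rw [h64]; exact (min_le_left _ _).trans (min_le_left _ _)
  have hd1 : 64 * δ ≤ δ₁ := by rw [h64]; exact (min_le_left _ _).trans (min_le_right _ _)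
  have hd2 : 64 * δ ≤ 1 := by rw [h64]; exact min_le_right _ _
  refine ⟨2 / 3 * κ, Real.exp K, δ, by positivity, Real.one_le_exp K.2, hδ, by linarith,
    fun x => (hS x).1, hS.add hK, hS.dist_time_le hb, fun t x y ht => hS.dist_space_le hK ht x y,
    abs_regularizedDist_sub_le U hη, fun p hp s t hs hst ht => ?_⟩
  rcases hst.eq_or_lt with rfl | hst
  · simp
  obtain ⟨x, hx, hpx⟩ := (infDist_lt_iff hne).1
    (lt_of_le_of_lt (infDist_le_abs_regularizedDist U hη p)
      (show 3 / 2 * |regularizedDist U η p| < 2 * δ by linarith))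
  have hnear : ∀ r ∈ Icc (-δ) δ, dist (D.S r p) x ≤ 3 * δ := by
    intro r hr
    have h1 := hS.dist_time_le hb r 0 p
    rw [(hS p).1, sub_zero] at h1
    have h2 : |r| ≤ δ := abs_le.2 hr
    linarith [dist_triangle (D.S r p) p x]
  have hmv : ‖(D.S t p - t • D.G x) - (D.S s p - s • D.G x)‖ ≤ κ * ‖t - s‖ := by
    refine (convex_Icc s t).norm_image_sub_le_of_norm_hasDerivWithin_le
      (f := fun r => D.S r p - r • D.G x)
      (f' := fun r => D.γ (D.S r p) • D.G (D.S r p) - (1 : ℝ) • D.G x)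
      (fun r _ => (((hS p).2 r).sub ((hasDerivAt_id r).smul_const (D.G x))).hasDerivWithinAt)
      (fun r hr => ?_) (left_mem_Icc.2 hst.le) (right_mem_Icc.2 hst.le)
    obtain ⟨h1, h2⟩ := hG x hx (D.S r p) (mem_ball.2 (by
      linarith [hnear r ⟨hs.trans hr.1, hr.2.trans ht⟩]))
    rw [h1, one_smul, one_smul, ← dist_eq_norm]
    exact h2
  have hts : 0 < t - s := sub_pos.2 hst
  -- The mean velocity between the times s and t; by the mean value inequality it is within κ of
  -- G(x), so the displacement is a translation along a cone.
  set ξ : Euc m := (t - s)⁻¹ • (D.S t p - D.S s p) with hξ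
  have e : D.S s p + (t - s) • ξ = D.S t p := by
    rw [hξ, smul_smul, mul_inv_cancel₀ hts.ne', one_smul]; abel
  have hξG : dist ξ (D.G x) ≤ κ := by
    have e2 : ξ - D.G x = (t - s)⁻¹ • ((D.S t p - t • D.G x) - (D.S s p - s • D.G x)) := by
      have : (D.S t p - t • D.G x) - (D.S s p - s • D.G x) =
          (D.S t p - D.S s p) - (t - s) • D.G x := by module
      rw [this, smul_sub _ (D.S t p - D.S s p), smul_smul (t - s)⁻¹ (t - s),
        inv_mul_cancel₀ hts.ne', one_smul]
    rw [dist_eq_norm, e2, norm_smul, Real.norm_of_nonneg (by positivity), inv_mul_le_iff₀ hts]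
    rwa [Real.norm_of_nonneg hts.le, mul_comm] at hmv
  have h := regularizedDist_add_le hU hη (x₀ := x) (ξ := ξ) (p := D.S s p) (c := κ) (δ := δ₀)
    (s := t - s) hx hκ ((hcone x hx).mono le_rfl (by linarith)) hts (by
      rw [e]
      have h1 := hnear s ⟨hs, hst.le.trans ht⟩
      have h2 := hnear t ⟨hs.trans hst.le, ht⟩
      nlinarith)
  rwa [e] at h

end BallZarnescuData

/-! ### Times at which flow lines reach given levels. -/

namespace TransverseFlow

variable {m : ℕ} {ρ : Euc m → ℝ} {S : ℝ → Euc m → Euc m} {c L δ : ℝ}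

theorem continuous_time (F : TransverseFlow ρ S c L δ) (x : Euc m) :
    Continuous fun t => S t x := by
  refine (LipschitzWith.of_dist_le_mul (K := 1) fun s t => ?_).continuous
  rw [NNReal.coe_one, one_mul, Real.dist_eq]; exact F.dist_time s t x

theorem continuous_level (F : TransverseFlow ρ S c L δ) : Continuous ρ := by
  refine (LipschitzWith.of_dist_le_mul (K := 2) fun s t => ?_).continuous
  rw [Real.dist_eq]; exact F.lip s t

theorem continuous_along (F : TransverseFlow ρ S c L δ) (x : Euc m) :
    Continuous fun t => ρ (S t x) := F.continuous_level.comp (F.continuous_time x)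

theorem neg_apply (F : TransverseFlow ρ S c L δ) (t : ℝ) (x : Euc m) : S (-t) (S t x) = x := by
  rw [← F.add, neg_add_cancel, F.zero]

theorem abs_level_sub_le (F : TransverseFlow ρ S c L δ) (s t : ℝ) (x : Euc m) :
    |ρ (S s x) - ρ (S t x)| ≤ 2 * |s - t| :=
  (F.lip _ _).trans (by linarith [F.dist_time s t x])

theorem level_lt_of_lt_of_le (F : TransverseFlow ρ S c L δ) {x : Euc m} {a b : ℝ}
    (hx : |ρ (S a x)| < δ) (hab : a < b) (hb : b ≤ a + δ) : ρ (S a x) < ρ (S b x) := by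
  have h := F.growth (S a x) hx 0 (b - a) (by linarith [F.δ_pos]) (by linarith) (by linarith)
  rw [F.zero, ← F.add, sub_add_cancel, sub_zero] at h
  nlinarith [mul_pos F.c_pos (sub_pos.2 hab)]

theorem level_lt_of_le_of_lt (F : TransverseFlow ρ S c L δ) {x : Euc m} {a b : ℝ}
    (hx : |ρ (S b x)| < δ) (hab : a < b) (hb : b ≤ a + δ) : ρ (S a x) < ρ (S b x) := by
  have h := F.growth (S b x) hx (a - b) 0 (by linarith [F.δ_pos]) (by linarith) (by
    linarith [F.δ_pos])
  rw [F.zero, ← F.add, sub_add_cancel] at h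
  nlinarith [mul_pos F.c_pos (sub_pos.2 hab)]

/-- A flow line never returns to a level close to `0`. -/
theorem level_lt (F : TransverseFlow ρ S c L δ) {x : Euc m} {a b : ℝ}
    (hx : |ρ (S a x)| < δ) (hab : a < b) : ρ (S a x) < ρ (S b x) := by
  by_contra! hle
  have hδ := F.δ_pos
  set K : Set ℝ := Icc (a + δ) b ∩ {t | ρ (S t x) ≤ ρ (S a x)} with hK
  have hKc : IsCompact K :=
    isCompact_Icc.inter_right (isClosed_le (F.continuous_along x) continuous_const)
  have hbK : b ∈ K := by
    refine ⟨⟨?_, le_rfl⟩, hle⟩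
    by_contra! h
    exact absurd (F.level_lt_of_lt_of_le hx hab h.le) (not_lt.2 hle)
  obtain ⟨t, ⟨⟨hat, htb⟩, ht⟩, hmin⟩ := hKc.exists_isLeast ⟨b, hbK⟩
  have ht : ρ (S t x) ≤ ρ (S a x) := ht
  have hgt : ∀ s, a < s → s < t → ρ (S a x) < ρ (S s x) := by
    intro s has hst
    by_contra! h
    rcases le_total s (a + δ) with hs | hs
    · exact absurd (F.level_lt_of_lt_of_le hx has hs) (not_lt.2 h)
    · exact absurd (hmin ⟨⟨hs, hst.le.trans htb⟩, h⟩) (not_le.2 hst)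
  have hge : ρ (S a x) ≤ ρ (S t x) := by
    have hlt : ∀ᶠ s in nhdsWithin t (Iio t), ρ (S a x) ≤ ρ (S s x) := by
      filter_upwards [Ioo_mem_nhdsLT (show a < t by linarith)] with s hs
      exact (hgt s hs.1 hs.2).le
    exact ge_of_tendsto (((F.continuous_along x).tendsto t).mono_left nhdsWithin_le_nhds) hlt
  have heq := le_antisymm ht hge
  -- At the first return time t the level is again small, so growth applies backwards from t and
  -- puts ρ below the initial level just before t, contradicting minimality.
  have h := F.level_lt_of_le_of_lt (x := x) (a := t - δ / 2) (b := t) (by rwa [heq])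
    (by linarith) (by linarith)
  exact absurd (hgt (t - δ / 2) (by linarith) (by linarith)) (not_lt.2 (by linarith))

theorem time_unique (F : TransverseFlow ρ S c L δ) {x : Euc m} {a b : ℝ}
    (hx : |ρ (S a x)| < δ) (h : ρ (S a x) = ρ (S b x)) : a = b := by
  rcases lt_trichotomy a b with hab | hab | hab
  · exact absurd h (F.level_lt hx hab).ne
  · exact hab
  · exact absurd h (F.level_lt (by rwa [← h]) hab).ne'

/-- During [-δ, δ] the level sweeps at least the interval of radius cδ about ρ(x); the time is found
by the intermediate value theorem. -/
theorem exists_time (F : TransverseFlow ρ S c L δ) {x : Euc m} {τ : ℝ}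
    (hx : |ρ x| < δ) (h : |τ - ρ x| ≤ c * δ) : ∃ t, |t| ≤ δ ∧ ρ (S t x) = τ := by
  have hδ := F.δ_pos
  have h1 := F.growth x hx 0 δ (by linarith) hδ.le le_rfl
  have h2 := F.growth x hx (-δ) 0 le_rfl (by linarith) hδ.le
  rw [F.zero] at h1 h2
  have h3 := abs_le.1 h
  obtain ⟨t, ht, htτ⟩ := intermediate_value_Icc (show -δ ≤ δ by linarith)
    (F.continuous_along x).continuousOn (show τ ∈ Icc (ρ (S (-δ) x)) (ρ (S δ x)) from
      ⟨by linarith, by linarith⟩)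
  exact ⟨t, abs_le.2 ht, htτ⟩

/-- Changing the signs of ρ and of time preserves all the axioms, so statements about the future
give statements about the past. -/
theorem reverse (F : TransverseFlow ρ S c L δ) :
    TransverseFlow (fun x => -ρ x) (fun t => S (-t)) c L δ where
  c_pos := F.c_pos
  one_le_L := F.one_le_L
  δ_pos := F.δ_pos
  δ_le := F.δ_le
  zero x := by rw [neg_zero, F.zero]
  add s t x := by rw [neg_add, F.add]
  dist_time s t x := (F.dist_time _ _ x).trans_eq (by rw [neg_sub_neg, abs_sub_comm])
  dist_space t x y ht := F.dist_space _ x y (by rwa [abs_neg])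
  lip x y := by
    rw [neg_sub_neg, abs_sub_comm]; exact F.lip x y
  growth x hx s t hs hst ht := by
    rw [abs_neg] at hx
    have := F.growth x hx (-t) (-s) (by linarith) (by linarith) (by linarith)
    linarith

theorem level_lt' (F : TransverseFlow ρ S c L δ) {x : Euc m} {a b : ℝ}
    (hx : |ρ (S b x)| < δ) (hab : a < b) : ρ (S a x) < ρ (S b x) := by
  have := F.reverse.level_lt (x := x) (a := -b) (b := -a) (by simpa using hx) (by linarith)
  simpa using this

theorem level_lt_level_iff (F : TransverseFlow ρ S c L δ) {x : Euc m} {a b : ℝ}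
    (hx : |ρ (S a x)| < δ) : ρ (S a x) < ρ (S b x) ↔ a < b := by
  refine ⟨fun h => ?_, F.level_lt hx⟩
  by_contra! hba
  rcases hba.eq_or_lt with rfl | hba
  · exact lt_irrefl _ h
  · exact lt_asymm h (F.level_lt' hx hba)

theorem level_lt_level_iff' (F : TransverseFlow ρ S c L δ) {x : Euc m} {a b : ℝ}
    (hx : |ρ (S b x)| < δ) : ρ (S a x) < ρ (S b x) ↔ a < b := by
  refine ⟨fun h => ?_, F.level_lt' hx⟩
  by_contra! hba
  rcases hba.eq_or_lt with rfl | hba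
  · exact lt_irrefl _ h
  · exact lt_asymm h (F.level_lt hx hba)

/-- Comparison of the times needed to reach given levels from two points. -/
theorem mul_abs_time_sub_le (F : TransverseFlow ρ S c L δ) {x : Euc m} (hx : |ρ x| < δ)
    (y : Euc m) {a b : ℝ} (ha : |a| ≤ δ) (hb : |b| ≤ δ) :
    c * |a - b| ≤ |ρ (S a x) - ρ (S b y)| + 2 * L * dist x y := by
  have h1 : c * |a - b| ≤ |ρ (S a x) - ρ (S b x)| := by
    obtain ⟨ha1, ha2⟩ := abs_le.1 ha
    obtain ⟨hb1, hb2⟩ := abs_le.1 hb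
    rcases le_total a b with h | h
    · have := F.growth x hx a b ha1 h hb2
      rw [abs_of_nonpos (sub_nonpos.2 h), neg_sub, abs_sub_comm]
      exact this.trans (le_abs_self _)
    · have := F.growth x hx b a hb1 h ha2
      rw [abs_of_nonneg (sub_nonneg.2 h)]
      exact this.trans (le_abs_self _)
  have h2 := F.lip (S b y) (S b x)
  have h3 := F.dist_space b y x (hb.trans F.δ_le)
  have h4 := abs_sub_le (ρ (S a x)) (ρ (S b y)) (ρ (S b x))
  rw [dist_comm y x] at h3
  linarith

theorem mul_abs_time_le (F : TransverseFlow ρ S c L δ) {x : Euc m} (hx : |ρ x| < δ)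
    {t : ℝ} (ht : |t| ≤ δ) : c * |t| ≤ |ρ (S t x) - ρ x| := by
  have := F.mul_abs_time_sub_le hx x ht (b := 0) (by simpa using F.δ_pos.le)
  simpa [F.zero] using this

/-- Moving along the flow by times that are Lipschitz functions of both the source and the target
is bi-Lipschitz. -/
theorem biLipschitzOnWith (F : TransverseFlow ρ S c L δ) {A : ℝ} {T : Euc m → ℝ} {s : Set (Euc m)}
    {Φ : Euc m → Euc m} (hΦ : ∀ x ∈ s, Φ x = S (T x) x) (hT : ∀ x ∈ s, |T x| ≤ 1)
    (h₁ : ∀ x ∈ s, ∀ y ∈ s, |T x - T y| ≤ A * dist x y)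
    (h₂ : ∀ x ∈ s, ∀ y ∈ s, |T x - T y| ≤ A * dist (Φ x) (Φ y)) :
    BiLipschitzOnWith (L + A) Φ s := by
  intro x hx y hy
  have e1 := h₁ x hx y hy
  have e2 := h₂ x hx y hy
  constructor
  · rw [hΦ x hx, hΦ y hy]
    have := dist_triangle (S (T x) x) (S (T x) y) (S (T y) y)
    linarith [F.dist_space (T x) x y (hT x hx), F.dist_time (T x) (T y) y]
  · have hx' : x = S (-T x) (Φ x) := by rw [hΦ x hx, F.neg_apply]
    have hy' : y = S (-T y) (Φ y) := by rw [hΦ y hy, F.neg_apply]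
    have h := dist_triangle (S (-T x) (Φ x)) (S (-T x) (Φ y)) (S (-T y) (Φ y))
    rw [← hx', ← hy'] at h
    have h3 := F.dist_space (-T x) (Φ x) (Φ y) (by rw [abs_neg]; exact hT x hx)
    have h4 := F.dist_time (-T x) (-T y) (Φ y)
    rw [neg_sub_neg, abs_sub_comm, ← hy'] at h4
    rw [← hx'] at h3
    linarith

theorem isOpen_superlevel (F : TransverseFlow ρ S c L δ) (ε : ℝ) : IsOpen (superlevel ρ ε) :=
  isOpen_lt continuous_const F.continuous_level

/-- A point at the level ε is a limit of points above it, namely its images under the flow for small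
positive times. -/
theorem closure_superlevel (F : TransverseFlow ρ S c L δ) {ε : ℝ} (hε : |ε| < δ) :
    closure (superlevel ρ ε) = {x | ε ≤ ρ x} := by
  refine subset_antisymm (closure_minimal (fun x (hx : ε < ρ x) => hx.le)
    (isClosed_le continuous_const F.continuous_level)) fun x hx => ?_
  rcases eq_or_lt_of_le (show ε ≤ ρ x from hx) with h | h
  · have hc := (F.continuous_time x).tendsto 0
    rw [F.zero] at hc
    refine mem_closure_of_tendsto (hc.mono_left nhdsWithin_le_nhds)
      (b := nhdsWithin (0 : ℝ) (Ioi 0)) ?_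
    filter_upwards [self_mem_nhdsWithin] with t ht
    have := F.level_lt (x := x) (a := 0) (b := t) (by rwa [F.zero, ← h]) ht
    rw [F.zero, ← h] at this
    exact this
  · exact subset_closure h

theorem frontier_superlevel (F : TransverseFlow ρ S c L δ) {ε : ℝ} (hε : |ε| < δ) :
    frontier (superlevel ρ ε) = {x | ρ x = ε} := by
  rw [(F.isOpen_superlevel ε).frontier_eq, F.closure_superlevel hε]
  ext x
  simp only [superlevel, mem_sdiff, mem_ofPred, not_lt]
  exact ⟨fun h => le_antisymm h.2 h.1, fun h => ⟨h.ge, h.le⟩⟩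

end TransverseFlow

/-! ### The Ball–Zarnescu maps for positive parameters -/

/-- Extracts the only form in which h is used: r ↦ r + h(ε, r) has difference quotients between σ
and 1, uniformly in ε. -/
theorem IsLevelShift.exists_bounds {h : ℝ → ℝ → ℝ} (hh : IsLevelShift h) :
    ∃ σ > 0, ∃ εh > 0, ∀ ε, 0 < ε → ε < εh → ContinuousOn (h ε) (Ici 0) ∧
      (∀ r, 0 ≤ r → h ε r ∈ Icc 0 ε) ∧ h ε 0 = ε ∧ (∀ r, 5 * ε / 2 ≤ r → h ε r = 0) ∧
      ∀ r r', 0 ≤ r → r ≤ r' →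
        σ * (r' - r) ≤ (r' + h ε r') - (r + h ε r) ∧ (r' + h ε r') - (r + h ε r) ≤ r' - r := by
  obtain ⟨σ, hσ, εh, hεh, H⟩ := hh
  refine ⟨σ, hσ, εh, hεh, fun ε hε0 hε => ?_⟩
  obtain ⟨hs, h0, h1, h2, hd⟩ := H ε ⟨hε0, hε⟩
  have hdiff : DifferentiableOn ℝ (h ε) (interior (Ici 0)) :=
    (hs.differentiableOn (by simp)).mono interior_subset
  refine ⟨hs.continuousOn, h0, h1 0 ⟨le_rfl, hε0.le⟩, h2, fun r r' hr hrr' => ?_⟩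
  have hr' : 0 ≤ r' := hr.trans hrr'
  have e1 := (convex_Ici (0 : ℝ)).mul_sub_le_image_sub_of_le_deriv (C := -1 + σ) hs.continuousOn
    hdiff (fun x hx => (hd x (by rwa [interior_Ici] at hx)).1.le) r hr r' hr' hrr'
  have e2 := (convex_Ici (0 : ℝ)).image_sub_le_mul_sub_of_deriv_le (C := 0) hs.continuousOn
    hdiff (fun x hx => (hd x (by rwa [interior_Ici] at hx)).2) r hr r' hr' hrr'
  constructor <;> linarith

namespace BallZarnescuData

variable {m : ℕ} {U : Set (Euc m)} {D : BallZarnescuData U} {ρ : Euc m → ℝ} {c L δ : ℝ}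

theorem levelTime_eq (F : TransverseFlow ρ D.S c L δ) {x : Euc m} {τ t : ℝ} (hτ : |τ| < δ)
    (h : ρ (D.S t x) = τ) : D.levelTime ρ τ x = t := by
  have h' : ρ (D.S (D.levelTime ρ τ x) x) = τ :=
    Classical.epsilon_spec (p := fun t : ℝ => ρ (D.S t x) = τ) ⟨t, h⟩
  exact F.time_unique (by rwa [h']) (h'.trans h.symm)

theorem shiftTime_eq (F : TransverseFlow ρ D.S c L δ) {x : Euc m} {ε t : ℝ} (ht : 0 ≤ t)
    (hτ : |ρ x + D.h ε (ρ x)| < δ)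
    (h : ρ (D.S t x) = ρ x + D.h ε (ρ x)) : D.shiftTime ρ ε x = t := by
  have h' := Classical.epsilon_spec
    (p := fun t : ℝ => 0 ≤ t ∧ ρ (D.S t x) = ρ x + D.h ε (ρ x)) ⟨t, ht, h⟩
  exact F.time_unique (x := x) (a := D.shiftTime ρ ε x) (b := t)
    (by rw [show ρ (D.S (D.shiftTime ρ ε x) x) = _ from h'.2]; exact hτ) (h'.2.trans h.symm)

/-- For small `ε > 0`, the map `f(ε, ·)` moves `x` along the flow, to the level
`ρ(x) + h(ε, ρ(x))`. -/
theorem exists_fpos_eq (F : TransverseFlow ρ D.S c L δ) (hcl : ∀ x, x ∈ closure U ↔ 0 ≤ ρ x)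
    {ε : ℝ} (hε : 0 < ε) (hεδ : 5 * ε < δ) (hεc : 5 * ε ≤ c * δ)
    (hh : ∀ r, 0 ≤ r → D.h ε r ∈ Icc 0 ε) (hh0 : ∀ r, 5 * ε / 2 ≤ r → D.h ε r = 0)
    {x : Euc m} (hx : 0 ≤ ρ x) : ∃ t, |t| ≤ δ ∧ D.fpos ρ ε x = D.S t x ∧
      ρ (D.S t x) = ρ x + D.h ε (ρ x) ∧ (3 * ε < ρ x → t = 0) := by
  by_cases hx3 : ρ x ≤ 3 * ε
  · have hb := hh (ρ x) hx
    have hxδ : |ρ x| < δ := by rw [abs_of_nonneg hx]; linarith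
    have hτ : |ρ x + D.h ε (ρ x)| < δ := by
      rw [abs_of_nonneg (by linarith [hb.1])]; linarith [hb.2]
    obtain ⟨t, ht, htτ⟩ := F.exists_time (τ := ρ x + D.h ε (ρ x)) hxδ (by
      rw [add_sub_cancel_left, abs_of_nonneg hb.1]; linarith [hb.2])
    have ht0 : 0 ≤ t := by
      by_contra! h
      have := F.level_lt (x := x) (a := t) (b := 0) (by rwa [htτ]) h
      rw [htτ, F.zero] at this
      linarith [hb.1]
    refine ⟨t, ht, ?_, htτ, fun h => absurd hx3 (not_le.2 h)⟩
    rw [fpos, if_pos ⟨(hcl x).2 hx, fun h => absurd hx3 (not_le.2 h)⟩, shiftTime_eq F ht0 hτ htτ]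
  · rw [not_le] at hx3
    refine ⟨0, by simpa using F.δ_pos.le, ?_, ?_, fun _ => rfl⟩
    · rw [fpos, if_neg fun h => h.2 hx3, F.zero]
    · rw [F.zero, hh0 _ (by linarith), add_zero]

/-- The maps `f(ε, ·)`, `ε > 0` small, are uniformly bi-Lipschitz and carry `{ρ ≥ 0}` and
`{ρ = 0}` onto `{ρ ≥ ε}` and `{ρ = ε}`. -/
theorem exists_fpos_bounds (D : BallZarnescuData U) (F : TransverseFlow ρ D.S c L δ)
    (hcl : ∀ x, x ∈ closure U ↔ 0 ≤ ρ x) : ∃ ε₀ > 0, ∃ K ≥ 1, ∀ ε, 0 < ε → ε < ε₀ →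
      D.fpos ρ ε '' {x | 0 ≤ ρ x} = {x | ε ≤ ρ x} ∧ D.fpos ρ ε '' {x | ρ x = 0} = {x | ρ x = ε} ∧
      BiLipschitzOnWith K (D.fpos ρ ε) {x | 0 ≤ ρ x} ∧
      ∀ x, ρ x = 0 → ∃ t, |t| ≤ δ ∧ D.fpos ρ ε x = D.S t x ∧ ρ (D.S t x) = ε := by
  obtain ⟨σ, hσ, εh, hεh, H⟩ := D.shift_h.exists_bounds
  have hc := F.c_pos
  have hδ := F.δ_pos
  have hL := F.one_le_L
  have hcδ : 0 < c * δ := mul_pos hc hδ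
  have hA : 0 ≤ (2 / σ + 2 + 2 * L) / c := by positivity
  refine ⟨min εh (min (δ / 5) (c * δ / 5)), by positivity, L + (2 / σ + 2 + 2 * L) / c,
    by linarith, fun ε hε0 hε => ?_⟩
  obtain ⟨hε1, hε2⟩ := lt_min_iff.1 hε
  obtain ⟨hε2, hε3⟩ := lt_min_iff.1 hε2
  obtain ⟨hcont, hh, hh00, hh0, hσh⟩ := H ε hε0 hε1
  have hex := fun (x : Euc m) (hx : 0 ≤ ρ x) =>
    exists_fpos_eq F hcl hε0 (by linarith) (by linarith) hh hh0 hx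
  choose! T hTδ hTf hTρ hT0 using hex
  have hρf : ∀ x, 0 ≤ ρ x → ρ (D.fpos ρ ε x) = ρ x + D.h ε (ρ x) := fun x hx => by
    rw [hTf x hx, hTρ x hx]
  have hge : ∀ r, 0 ≤ r → ε ≤ r + D.h ε r := by
    intro r hr
    have := (hσh 0 r le_rfl hr).1
    rw [hh00] at this
    nlinarith [mul_nonneg hσ.le hr]
  -- A preimage of y is found on its own flow line: go to the level r, from which f returns to y
  -- because the time of return is unique.
  have hback : ∀ y, ∀ r, 0 ≤ r → r ≤ 3 * ε → ρ y = r + D.h ε r →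
      ∃ x, ρ x = r ∧ D.fpos ρ ε x = y := by
    intro y r hr hr3 hy
    have hb := hh r hr
    have hyδ : |ρ y| < δ := by rw [hy, abs_of_nonneg (by linarith [hb.1])]; linarith [hb.2]
    obtain ⟨t, -, ht⟩ := F.exists_time (τ := r) hyδ (by
      rw [hy, sub_add_cancel_left, abs_neg, abs_of_nonneg hb.1]; linarith [hb.2])
    refine ⟨D.S t y, ht, ?_⟩
    have h1 := hTρ (D.S t y) (by rw [ht]; exact hr)
    rw [hTf _ (by rw [ht]; exact hr)]
    rw [ht, ← hy, ← F.add] at h1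
    have h2 : T (D.S t y) + t = 0 :=
      F.time_unique (x := y) (by rwa [h1]) (h1.trans (by rw [F.zero]))
    rw [← F.add, h2, F.zero]
  refine ⟨subset_antisymm ?_ fun y hy => ?_, subset_antisymm ?_ fun y hy => ?_, ?_,
    fun x hx => ⟨T x, hTδ x hx.ge, hTf x hx.ge, by rw [hTρ x hx.ge, hx, hh00, zero_add]⟩⟩
  · rintro _ ⟨x, hx, rfl⟩
    change ε ≤ ρ (D.fpos ρ ε x)
    rw [hρf x hx]; exact hge _ hx
  · have hy : ε ≤ ρ y := hy
    rcases lt_or_ge (3 * ε) (ρ y) with h3 | h3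
    · have hy0 : 0 ≤ ρ y := by linarith
      exact ⟨y, hy0, by rw [hTf y hy0, hT0 y hy0 h3, F.zero]⟩
    · have hc' : ContinuousOn (fun r => r + D.h ε r) (Icc 0 (3 * ε)) :=
        continuousOn_id.add (hcont.mono Icc_subset_Ici_self)
      obtain ⟨r, hr, hry⟩ := intermediate_value_Icc (by linarith) hc'
        (show ρ y ∈ Icc ((0 : ℝ) + D.h ε 0) (3 * ε + D.h ε (3 * ε)) from
          ⟨by rw [hh00]; linarith, by linarith [(hh (3 * ε) (by linarith)).1]⟩)
      obtain ⟨x, hx, hxy⟩ := hback y r hr.1 hr.2 hry.symm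
      exact ⟨x, by rw [mem_ofPred, hx]; exact hr.1, hxy⟩
  · rintro _ ⟨x, hx, rfl⟩
    have hx : ρ x = 0 := hx
    change ρ (D.fpos ρ ε x) = ε
    rw [hρf x hx.ge, hx, hh00, zero_add]
  · have hy : ρ y = ε := hy
    obtain ⟨x, hx, hxy⟩ := hback y 0 le_rfl (by linarith) (by rw [hh00, zero_add, hy])
    exact ⟨x, hx, hxy⟩
  · have hH : ∀ x, 0 ≤ ρ x → ∀ y, 0 ≤ ρ y →
        |ρ (D.S (T x) x) - ρ (D.S (T y) y)| ≤ |ρ x - ρ y| ∧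
        |ρ x - ρ y| ≤ 1 / σ * |ρ (D.S (T x) x) - ρ (D.S (T y) y)| := by
      intro x hx y hy
      rw [hTρ x hx, hTρ y hy, div_mul_eq_mul_div, one_mul, le_div_iff₀ hσ]
      rcases le_total (ρ x) (ρ y) with hxy | hxy
      · obtain ⟨h1, h2⟩ := hσh _ _ hx hxy
        have h3 := mul_nonneg hσ.le (sub_nonneg.2 hxy)
        rw [abs_of_nonpos (by linarith), abs_of_nonpos (by linarith)]
        constructor <;> linarith
      · obtain ⟨h1, h2⟩ := hσh _ _ hy hxy
        have h3 := mul_nonneg hσ.le (sub_nonneg.2 hxy)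
        rw [abs_of_nonneg (by linarith), abs_of_nonneg (by linarith)]
        constructor <;> linarith
    -- It is enough that one of the two points lies near the boundary. If neither does, both times
    -- vanish.
    have hfwd : ∀ x, 0 ≤ ρ x → ∀ y, 0 ≤ ρ y → ρ x ≤ 3 * ε →
        |T x - T y| ≤ (2 / σ + 2 + 2 * L) / c * dist x y := by
      intro x hx y hy hx3
      have h := F.mul_abs_time_sub_le (x := x) (by rw [abs_of_nonneg hx]; linarith) y
        (hTδ x hx) (hTδ y hy)
      have h1 := (hH x hx y hy).1.trans (F.lip x y)
      have h2 : 0 ≤ 2 / σ * dist x y := by positivity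
      rw [div_mul_eq_mul_div, le_div_iff₀ hc]
      linarith
    have hbwd : ∀ x, 0 ≤ ρ x → ∀ y, 0 ≤ ρ y → ρ x ≤ 3 * ε →
        |T x - T y| ≤ (2 / σ + 2 + 2 * L) / c * dist (D.fpos ρ ε x) (D.fpos ρ ε y) := by
      intro x hx y hy hx3
      have hb := hh _ hx
      rw [hTf x hx, hTf y hy]
      have h := F.mul_abs_time_sub_le (x := D.S (T x) x) (by
        rw [hTρ x hx, abs_of_nonneg (by linarith [hb.1])]; linarith [hb.2]) (D.S (T y) y)
        (a := -T x) (b := -T y) (by rw [abs_neg]; exact hTδ x hx) (by rw [abs_neg]; exact hTδ y hy)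
      rw [F.neg_apply, F.neg_apply, neg_sub_neg, abs_sub_comm] at h
      have h1 := F.lip (D.S (T x) x) (D.S (T y) y)
      have h2 : 1 / σ * |ρ (D.S (T x) x) - ρ (D.S (T y) y)| ≤
          1 / σ * (2 * dist (D.S (T x) x) (D.S (T y) y)) := by gcongr
      have h3 := (hH x hx y hy).2
      rw [div_mul_eq_mul_div, le_div_iff₀ hc]
      have h4 : 1 / σ * (2 * dist (D.S (T x) x) (D.S (T y) y)) =
        2 / σ * dist (D.S (T x) x) (D.S (T y) y) := by ring
      have h5 := dist_nonneg (x := D.S (T x) x) (y := D.S (T y) y)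
      linarith
    refine F.biLipschitzOnWith hTf (fun x hx => (hTδ x hx).trans F.δ_le) (fun x hx y hy => ?_)
      fun x hx y hy => ?_
    · rcases le_or_gt (ρ x) (3 * ε) with h | h
      · exact hfwd x hx y hy h
      · rcases le_or_gt (ρ y) (3 * ε) with h' | h'
        · rw [abs_sub_comm, dist_comm]; exact hfwd y hy x hx h'
        · rw [hT0 x hx h, hT0 y hy h', sub_self, abs_zero]
          exact mul_nonneg hA dist_nonneg
    · rcases le_or_gt (ρ x) (3 * ε) with h | h
      · exact hbwd x hx y hy h
      · rcases le_or_gt (ρ y) (3 * ε) with h' | h'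
        · rw [abs_sub_comm, dist_comm]; exact hbwd y hy x hx h'
        · rw [hT0 x hx h, hT0 y hy h', sub_self, abs_zero]
          exact mul_nonneg hA dist_nonneg

end BallZarnescuData

/-! ### Families of diffeomorphisms of the line -/

namespace IsDiffeoFamily

variable {u : ℝ → ℝ → ℝ → ℝ}

theorem strictMono (hu : IsDiffeoFamily u) {a b : ℝ} (ha : a ∈ Ioo (0 : ℝ) 1)
    (hb : b ∈ Ioo (0 : ℝ) 1) : StrictMono (u a b) :=
  strictMono_of_deriv_pos (hu.deriv_pos a ha b hb)

theorem contDiffAt (hu : IsDiffeoFamily u) {a b : ℝ} (ha : a ∈ Ioo (0 : ℝ) 1)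
    (hb : b ∈ Ioo (0 : ℝ) 1) (c : ℝ) :
    ContDiffAt ℝ ∞ (fun p : ℝ × ℝ × ℝ => u p.1 p.2.1 p.2.2) (a, b, c) :=
  hu.smooth.contDiffAt ((isOpen_Ioo.prod (isOpen_Ioo.prod isOpen_univ)).mem_nhds
    ⟨ha, hb, mem_univ c⟩)

theorem hasDerivAt (hu : IsDiffeoFamily u) {a b : ℝ} (ha : a ∈ Ioo (0 : ℝ) 1)
    (hb : b ∈ Ioo (0 : ℝ) 1) (c : ℝ) :
    HasDerivAt (u a b) (fderiv ℝ (fun p : ℝ × ℝ × ℝ => u p.1 p.2.1 p.2.2) (a, b, c) (0, 0, 1))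
      c := by
  have h1 := ((hu.contDiffAt ha hb c).differentiableAt (by simp)).hasFDerivAt
  have h2 : HasDerivAt (fun c : ℝ => (a, b, c)) (0, 0, 1) c :=
    (hasDerivAt_const c a).prodMk ((hasDerivAt_const c b).prodMk (hasDerivAt_id c))
  exact h1.comp_hasDerivAt c h2

/-- The endpoints of [0,1] are not among the prescribed fixed points; they are fixed by continuity
from outside. -/
theorem apply_zero (hu : IsDiffeoFamily u) {a b : ℝ} (ha : a ∈ Ioo (0 : ℝ) 1)
    (hb : b ∈ Ioo (0 : ℝ) 1) : u a b 0 = 0 := by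
  have hc := (hu.hasDerivAt ha hb 0).continuousAt.tendsto.mono_left
    (nhdsWithin_le_nhds (s := Iio 0))
  refine tendsto_nhds_unique hc ((Filter.tendsto_id.mono_left nhdsWithin_le_nhds).congr' ?_)
  filter_upwards [self_mem_nhdsWithin] with c hc
  exact (hu.fixed a ha b hb c fun h => not_le.2 hc h.1).symm

theorem apply_one (hu : IsDiffeoFamily u) {a b : ℝ} (ha : a ∈ Ioo (0 : ℝ) 1)
    (hb : b ∈ Ioo (0 : ℝ) 1) : u a b 1 = 1 := by
  have hc := (hu.hasDerivAt ha hb 1).continuousAt.tendsto.mono_left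
    (nhdsWithin_le_nhds (s := Ioi 1))
  refine tendsto_nhds_unique hc ((Filter.tendsto_id.mono_left nhdsWithin_le_nhds).congr' ?_)
  filter_upwards [self_mem_nhdsWithin] with c hc
  exact (hu.fixed a ha b hb c fun h => not_le.2 hc h.2).symm

theorem mapsTo_Icc (hu : IsDiffeoFamily u) {a b : ℝ} (ha : a ∈ Ioo (0 : ℝ) 1)
    (hb : b ∈ Ioo (0 : ℝ) 1) {c : ℝ} (hc : c ∈ Icc (0 : ℝ) 1) : u a b c ∈ Icc (0 : ℝ) 1 := by
  have hm := (hu.strictMono ha hb).monotone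
  exact ⟨by simpa [hu.apply_zero ha hb] using hm hc.1, by simpa [hu.apply_one ha hb] using hm hc.2⟩

theorem exists_apply_eq (hu : IsDiffeoFamily u) {a b : ℝ} (ha : a ∈ Ioo (0 : ℝ) 1)
    (hb : b ∈ Ioo (0 : ℝ) 1) {c : ℝ} (hc : c ∈ Icc (0 : ℝ) 1) :
    ∃ c' ∈ Icc (0 : ℝ) 1, u a b c' = c := by
  have := intermediate_value_Icc (f := u a b) zero_le_one
    fun c _ => (hu.hasDerivAt ha hb c).continuousAt.continuousWithinAt
  rw [hu.apply_zero ha hb, hu.apply_one ha hb] at this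
  exact this hc

/-- Away from degenerate parameters, the family is uniformly bi-Lipschitz. -/
theorem exists_bounds (hu : IsDiffeoFamily u) {κ : ℝ} (hκ : 0 < κ) (Q : ℝ) :
    ∃ M ≥ 0, ∃ μ > 0, ∀ a ∈ Icc κ (1 - κ), ∀ b ∈ Icc κ (1 - κ), ∀ c ∈ Icc (-Q) Q,
      (∀ a' ∈ Icc κ (1 - κ), ∀ b' ∈ Icc κ (1 - κ), ∀ c' ∈ Icc (-Q) Q,
        |u a b c - u a' b' c'| ≤ M * (|a - a'| + |b - b'| + |c - c'|)) ∧
      ∀ c' ∈ Icc (-Q) Q, μ * |c - c'| ≤ |u a b c - u a b c'| := by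
  set B : Set (ℝ × ℝ × ℝ) := Icc κ (1 - κ) ×ˢ Icc κ (1 - κ) ×ˢ Icc (-Q) Q with hB
  have hI : Icc κ (1 - κ) ⊆ Ioo 0 1 := Icc_subset_Ioo hκ (by linarith)
  have hBO : B ⊆ Ioo (0 : ℝ) 1 ×ˢ Ioo (0 : ℝ) 1 ×ˢ (univ : Set ℝ) :=
    prod_mono hI (prod_mono hI (subset_univ _))
  have hBc : IsCompact B := isCompact_Icc.prod (isCompact_Icc.prod isCompact_Icc)
  have hBx : Convex ℝ B := (convex_Icc _ _).prod ((convex_Icc _ _).prod (convex_Icc _ _))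
  have hO : IsOpen (Ioo (0 : ℝ) 1 ×ˢ Ioo (0 : ℝ) 1 ×ˢ (univ : Set ℝ)) :=
    isOpen_Ioo.prod (isOpen_Ioo.prod isOpen_univ)
  obtain ⟨M, hM⟩ := (hu.smooth.mono hBO).exists_lipschitzOnWith (by simp) hBx hBc
  have hderiv : ContinuousOn (fun p : ℝ × ℝ × ℝ =>
      fderiv ℝ (fun p : ℝ × ℝ × ℝ => u p.1 p.2.1 p.2.2) p (0, 0, 1)) B :=
    ((hu.smooth.continuousOn_fderiv_of_isOpen hO (by simp)).mono hBO).clm_apply continuousOn_const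
  -- The derivative in c is continuous and positive, hence bounded below on the compact parameter
  -- box.
  obtain ⟨μ, hμ, hμB⟩ : ∃ μ > 0, ∀ p ∈ B,
      μ ≤ fderiv ℝ (fun p : ℝ × ℝ × ℝ => u p.1 p.2.1 p.2.2) p (0, 0, 1) := by
    rcases B.eq_empty_or_nonempty with h | h
    · exact ⟨1, one_pos, by simp [h]⟩
    · obtain ⟨p, hp, hmin⟩ := hBc.exists_isMinOn h hderiv
      refine ⟨_, ?_, hmin⟩
      have h1 := hBO hp
      have := hu.hasDerivAt h1.1 h1.2.1 p.2.2
      exact (hu.deriv_pos _ h1.1 _ h1.2.1 p.2.2).trans_eq this.deriv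
  refine ⟨M, M.2, μ, hμ, fun a ha b hb c hc => ⟨fun a' ha' b' hb' c' hc' => ?_,
    fun c' hc' => ?_⟩⟩
  · have h := hM.dist_le_mul (a, b, c) ⟨ha, hb, hc⟩ (a', b', c') ⟨ha', hb', hc'⟩
    rw [Real.dist_eq] at h
    refine h.trans (mul_le_mul_of_nonneg_left ?_ M.2)
    simp only [Prod.dist_eq, Real.dist_eq]
    have h1 := abs_nonneg (a - a')
    have h2 := abs_nonneg (b - b')
    have h3 := abs_nonneg (c - c')
    exact max_le (by linarith) (max_le (by linarith) (by linarith))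
  · have key : ∀ x ∈ Icc (-Q) Q, ∀ y ∈ Icc (-Q) Q, x ≤ y →
        μ * (y - x) ≤ u a b y - u a b x := by
      refine (convex_Icc (-Q) Q).mul_sub_le_image_sub_of_le_deriv
        (fun x _ => (hu.hasDerivAt (hI ha) (hI hb) x).continuousAt.continuousWithinAt)
        (fun x _ => (hu.hasDerivAt (hI ha) (hI hb) x).differentiableAt.differentiableWithinAt)
        fun x hx => ?_
      rw [(hu.hasDerivAt (hI ha) (hI hb) x).deriv]
      exact hμB _ ⟨ha, hb, interior_subset hx⟩
    rcases le_total c c' with h | h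
    · rw [abs_of_nonpos (sub_nonpos.2 h), abs_sub_comm, neg_sub]
      exact (key c hc c' hc' h).trans (le_abs_self _)
    · rw [abs_of_nonneg (sub_nonneg.2 h)]
      exact (key c' hc' c hc h).trans (le_abs_self _)

end IsDiffeoFamily

theorem abs_div_sub_div_le {n₁ n₂ d₁ d₂ e B : ℝ} (he : 0 < e) (h₁ : e ≤ d₁) (h₂ : e ≤ d₂)
    (hB : |n₂ / d₂| ≤ B) : |n₁ / d₁ - n₂ / d₂| ≤ (|n₁ - n₂| + B * |d₁ - d₂|) / e := by
  have hd₁ : 0 < d₁ := by linarith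
  have hd₂ : 0 < d₂ := by linarith
  have e1 : n₁ / d₁ - n₂ / d₂ = ((n₁ - n₂) - n₂ / d₂ * (d₁ - d₂)) / d₁ := by field_simp; ring
  rw [e1, abs_div, abs_of_pos hd₁]
  have h3 : |(n₁ - n₂) - n₂ / d₂ * (d₁ - d₂)| ≤ |n₁ - n₂| + B * |d₁ - d₂| := by
    refine (abs_sub _ _).trans ?_
    rw [abs_mul]
    gcongr
  exact div_le_div₀ ((abs_nonneg _).trans h3) h3 he h₁

/-! ### The Ball–Zarnescu maps for negative parameters -/

namespace BallZarnescuData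

variable {m : ℕ} {U : Set (Euc m)} {D : BallZarnescuData U} {ρ : Euc m → ℝ} {c L δ e : ℝ}

/-- The difference `Δ` of the times at which the levels `±2e` are reached. -/
noncomputable def span (D : BallZarnescuData U) (ρ : Euc m → ℝ) (e : ℝ) (y : Euc m) : ℝ :=
  D.levelTime ρ (2 * e) y - D.levelTime ρ (2 * -e) y

/-- The budget is 5e because the starting level is within 3e of 0 and the target level within 2e. -/
theorem levelTime_spec (F : TransverseFlow ρ D.S c L δ) (he : 0 < e) (heδ : 5 * e < δ)
    (hec : 5 * e ≤ c * δ) {y : Euc m} (hy : |ρ y| < 3 * e) {τ : ℝ} (hτ : |τ| ≤ 2 * e) :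
    |D.levelTime ρ τ y| ≤ δ ∧ ρ (D.S (D.levelTime ρ τ y) y) = τ := by
  obtain ⟨t, ht, htτ⟩ := F.exists_time (τ := τ) (x := y) (by linarith)
    (by linarith [abs_sub τ (ρ y)])
  rw [levelTime_eq F (by linarith) htτ]
  exact ⟨ht, htτ⟩

theorem levelTime_lt_iff (F : TransverseFlow ρ D.S c L δ) (he : 0 < e) (heδ : 5 * e < δ)
    (hec : 5 * e ≤ c * δ) {y : Euc m} (hy : |ρ y| < 3 * e) {τ : ℝ} (hτ : |τ| ≤ 2 * e) (t : ℝ) :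
    (D.levelTime ρ τ y < t ↔ τ < ρ (D.S t y)) ∧ (t < D.levelTime ρ τ y ↔ ρ (D.S t y) < τ) := by
  obtain ⟨-, h⟩ := levelTime_spec F he heδ hec hy hτ
  constructor
  · rw [← F.level_lt_level_iff (x := y) (a := D.levelTime ρ τ y) (by rw [h]; linarith), h]
  · rw [← F.level_lt_level_iff' (x := y) (b := D.levelTime ρ τ y) (by rw [h]; linarith), h]

theorem levelTime_apply (F : TransverseFlow ρ D.S c L δ) (he : 0 < e) (heδ : 5 * e < δ)
    (hec : 5 * e ≤ c * δ) {y : Euc m} (hy : |ρ y| < 3 * e) {τ : ℝ} (hτ : |τ| ≤ 2 * e) (t : ℝ) :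
    D.levelTime ρ τ (D.S t y) = D.levelTime ρ τ y - t := by
  refine levelTime_eq F (by linarith) ?_
  rw [← F.add, sub_add_cancel]
  exact (levelTime_spec F he heδ hec hy hτ).2

/-- The lower bound holds because ρ changes at rate at most 2 along the flow, the upper bound
because it changes at rate at least c. -/
theorem levelTime_sub_bounds (F : TransverseFlow ρ D.S c L δ) (he : 0 < e) (heδ : 5 * e < δ)
    (hec : 5 * e ≤ c * δ) {y : Euc m} (hy : |ρ y| < 3 * e) {τ τ' : ℝ} (hτ : |τ| ≤ 2 * e)
    (hτ' : |τ'| ≤ 2 * e) (h : τ ≤ τ') :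
    (τ' - τ) / 2 ≤ D.levelTime ρ τ' y - D.levelTime ρ τ y ∧
      c * (D.levelTime ρ τ' y - D.levelTime ρ τ y) ≤ τ' - τ := by
  obtain ⟨h1, h2⟩ := levelTime_spec F he heδ hec hy hτ
  obtain ⟨h1', h2'⟩ := levelTime_spec F he heδ hec hy hτ'
  have hle : D.levelTime ρ τ y ≤ D.levelTime ρ τ' y := by
    by_contra! hlt
    rw [(levelTime_lt_iff F he heδ hec hy hτ' _).1, h2] at hlt
    linarith
  have h3 := F.abs_level_sub_le (D.levelTime ρ τ' y) (D.levelTime ρ τ y) y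
  rw [h2, h2', abs_of_nonneg (sub_nonneg.2 h), abs_of_nonneg (sub_nonneg.2 hle)] at h3
  have h4 := F.growth y (by linarith) _ _ (abs_le.1 h1).1 hle (abs_le.1 h1').2
  rw [h2, h2'] at h4
  exact ⟨by linarith, h4⟩

/-- The parameters of a point near the boundary along its flow line. -/
theorem parameter_bounds (F : TransverseFlow ρ D.S c L δ) (he : 0 < e) (heδ : 5 * e < δ)
    (hec : 5 * e ≤ c * δ) {y : Euc m} (hy : |ρ y| < 3 * e) :
    2 * e ≤ D.span ρ e y ∧ c * D.span ρ e y ≤ 4 * e ∧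
      D.r ρ e (-e) y ∈ Icc (c / 8) (1 - c / 8) ∧ D.s ρ e (-e) y ∈ Icc (c / 8) (1 - c / 8) ∧
      |D.q ρ e (-e) y| ≤ 5 / (2 * c) := by
  have hc := F.c_pos
  have a2 : |2 * e| ≤ 2 * e := (abs_of_pos (by linarith)).le
  have a2' : |2 * -e| ≤ 2 * e := by rw [mul_neg, abs_neg]; exact a2
  have a1 : |e| ≤ 2 * e := by rw [abs_of_pos he]; linarith
  have a1' : |-e| ≤ 2 * e := by rw [abs_neg]; exact a1
  obtain ⟨hΔ, hΔ'⟩ := levelTime_sub_bounds F he heδ hec hy a2' a2 (by linarith)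
  obtain ⟨hr, -⟩ := levelTime_sub_bounds F he heδ hec hy a2' a1 (by linarith)
  obtain ⟨hr', -⟩ := levelTime_sub_bounds F he heδ hec hy a1 a2 (by linarith)
  obtain ⟨hs, -⟩ := levelTime_sub_bounds F he heδ hec hy a2' a1' (by linarith)
  obtain ⟨hs', -⟩ := levelTime_sub_bounds F he heδ hec hy a1' a2 (by linarith)
  change _ ≤ D.span ρ e y at hΔ
  change c * D.span ρ e y ≤ _ at hΔ'
  have hpos : 0 < D.span ρ e y := by linarith
  have hspan : D.span ρ e y = D.levelTime ρ (2 * e) y - D.levelTime ρ (2 * -e) y := rfl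
  have e1 : (1 - c / 8) * D.span ρ e y = D.span ρ e y - c * D.span ρ e y / 8 := by ring
  -- Consecutive levels among -2e, -e, e, 2e are at least e apart, hence at least e/2 apart in time,
  -- while the whole span is at most 4e/c; this gives c/8. For q, a time of at most 5e/c is divided
  -- by a span of at least 2e.
  refine ⟨by linarith, by linarith, ⟨?_, ?_⟩, ⟨?_, ?_⟩, ?_⟩
  · change c / 8 ≤ (D.levelTime ρ e y - D.levelTime ρ (2 * -e) y) / D.span ρ e y
    rw [le_div_iff₀ hpos]; linarith
  · change (D.levelTime ρ e y - D.levelTime ρ (2 * -e) y) / D.span ρ e y ≤ 1 - c / 8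
    rw [div_le_iff₀ hpos, e1]; linarith
  · change c / 8 ≤ (D.levelTime ρ (-e) y - D.levelTime ρ (2 * -e) y) / D.span ρ e y
    rw [le_div_iff₀ hpos]; linarith
  · change (D.levelTime ρ (-e) y - D.levelTime ρ (2 * -e) y) / D.span ρ e y ≤ 1 - c / 8
    rw [div_le_iff₀ hpos, e1]; linarith
  · change |-D.levelTime ρ (2 * -e) y / D.span ρ e y| ≤ 5 / (2 * c)
    obtain ⟨h1, h2⟩ := levelTime_spec F he heδ hec hy a2'
    have h3 := F.mul_abs_time_le (x := y) (by linarith) h1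
    rw [h2] at h3
    have h4 := abs_sub (2 * -e) (ρ y)
    rw [abs_div, abs_neg, abs_of_pos hpos, div_le_div_iff₀ hpos (by positivity)]
    linarith

/-- The parameters along flow lines are Lipschitz, with constant `O(1 / e)`. -/
theorem exists_parameter_lipschitz (D : BallZarnescuData U) (F : TransverseFlow ρ D.S c L δ) :
    ∃ M ≥ 0, ∀ e, 0 < e → 5 * e < δ → 5 * e ≤ c * δ → ∀ y z : Euc m, |ρ y| < 3 * e →
      |ρ z| < 3 * e → |D.span ρ e y - D.span ρ e z| ≤ M * dist y z ∧
      |D.r ρ e (-e) y - D.r ρ e (-e) z| ≤ M * dist y z / e ∧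
      |D.s ρ e (-e) y - D.s ρ e (-e) z| ≤ M * dist y z / e ∧
      |D.q ρ e (-e) y - D.q ρ e (-e) z| ≤ M * dist y z / e := by
  have hc := F.c_pos
  have hL := F.one_le_L
  refine ⟨(2 * (2 * L / c)) * (1 + 1 + 5 / (2 * c)), by positivity,
    fun e he heδ hec y z hy hz => ?_⟩
  set A := 2 * L / c with hA
  have hA0 : 0 ≤ A := by positivity
  set d := dist y z
  have hd : 0 ≤ d := dist_nonneg
  have hAd : 0 ≤ A * d := mul_nonneg hA0 hd
  have hlip : ∀ τ, |τ| ≤ 2 * e → |D.levelTime ρ τ y - D.levelTime ρ τ z| ≤ A * d := by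
    intro τ hτ
    obtain ⟨h1, h2⟩ := levelTime_spec F he heδ hec hy hτ
    obtain ⟨h1', h2'⟩ := levelTime_spec F he heδ hec hz hτ
    have := F.mul_abs_time_sub_le (x := y) (by linarith) z h1 h1'
    rw [h2, h2', sub_self, abs_zero, zero_add] at this
    rw [hA, div_mul_eq_mul_div, le_div_iff₀ hc]
    linarith
  have hsub : ∀ τ τ', |τ| ≤ 2 * e → |τ'| ≤ 2 * e →
      |(D.levelTime ρ τ y - D.levelTime ρ τ' y) - (D.levelTime ρ τ z - D.levelTime ρ τ' z)| ≤
        2 * (A * d) := by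
    intro τ τ' hτ hτ'
    rw [sub_sub_sub_comm]
    exact (abs_sub _ _).trans (by linarith [hlip τ hτ, hlip τ' hτ'])
  have a2 : |2 * e| ≤ 2 * e := (abs_of_pos (by linarith)).le
  have a2' : |2 * -e| ≤ 2 * e := by rw [mul_neg, abs_neg]; exact a2
  have a1 : |e| ≤ 2 * e := by rw [abs_of_pos he]; linarith
  have a1' : |-e| ≤ 2 * e := by rw [abs_neg]; exact a1
  obtain ⟨hΔy, -, -, -, -⟩ := parameter_bounds F he heδ hec hy
  obtain ⟨hΔz, -, hrz, hsz, hqz⟩ := parameter_bounds F he heδ hec hz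
  have hΔ : |D.span ρ e y - D.span ρ e z| ≤ 2 * (A * d) := hsub _ _ a2 a2'
  have h5 : 0 ≤ 5 / (2 * c) := by positivity
  have hAdc : 0 ≤ A * d * (5 / (2 * c)) := by positivity
  have hfin : ∀ {n₁ n₂ : ℝ} (B : ℝ), 0 ≤ B → B ≤ 1 + 5 / (2 * c) → |n₁ - n₂| ≤ 2 * (A * d) →
      |n₂ / D.span ρ e z| ≤ B → |n₁ / D.span ρ e y - n₂ / D.span ρ e z| ≤
        (2 * A) * (1 + 1 + 5 / (2 * c)) * d / e := by
    intro n₁ n₂ B hB0 hB hn hB'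
    refine (abs_div_sub_div_le he (by linarith) (by linarith) hB').trans ?_
    gcongr
    -- The quotient bound with denominators at least e is where the factor 1/e in the Lipschitz
    -- constants arises.
    have := mul_le_mul hB hΔ (abs_nonneg _) (by positivity)
    linarith
  refine ⟨?_, ?_, ?_, ?_⟩
  · refine hΔ.trans ?_
    linarith
  · refine hfin 1 zero_le_one (by linarith) (hsub _ _ a1 a2') ?_
    exact (abs_of_nonneg (by linarith [hrz.1]) : |D.r ρ e (-e) z| = _).trans_le
      (hrz.2.trans (by linarith))
  · refine hfin 1 zero_le_one (by linarith) (hsub _ _ a1' a2') ?_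
    exact (abs_of_nonneg (by linarith [hsz.1]) : |D.s ρ e (-e) z| = _).trans_le
      (hsz.2.trans (by linarith))
  · refine hfin (5 / (2 * c)) h5 (by linarith) ?_ hqz
    rw [neg_sub_neg, abs_sub_comm]
    linarith [hlip _ a2']

open Classical in
/-- The time by which `g(e, -e, ·)` moves `y`. -/
noncomputable def moveTime (D : BallZarnescuData U) (ρ : Euc m → ℝ) (e : ℝ) (y : Euc m) : ℝ :=
  if |ρ y| < 3 * e then D.w ρ e (-e) y else 0

theorem g_eq (F : TransverseFlow ρ D.S c L δ) (y : Euc m) :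
    D.g ρ e (-e) y = D.S (D.moveTime ρ e y) y := by
  have : ρ y ∈ Ioo (3 * -e) (3 * e) ↔ |ρ y| < 3 * e := by rw [abs_lt, mem_Ioo, mul_neg]
  rw [g, moveTime]
  simp only [this]
  split_ifs
  · rfl
  · rw [F.zero]

/-- This form shows w as the span times the displacement from q to u(r, s, q), so that w vanishes
where u fixes q. -/
theorem w_eq (F : TransverseFlow ρ D.S c L δ) (he : 0 < e) (heδ : 5 * e < δ)
    (hec : 5 * e ≤ c * δ) {y : Euc m} (hy : |ρ y| < 3 * e) :
    D.w ρ e (-e) y = D.span ρ e y *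
      (D.u (D.r ρ e (-e) y) (D.s ρ e (-e) y) (D.q ρ e (-e) y) - D.q ρ e (-e) y) := by
  have hpos : D.span ρ e y ≠ 0 := by
    have := (parameter_bounds F he heδ hec hy).1
    linarith
  have hq : D.span ρ e y * D.q ρ e (-e) y = -D.levelTime ρ (2 * -e) y :=
    mul_div_cancel₀ _ hpos
  rw [mul_sub, hq, w, span]
  ring

theorem q_mem_Icc_iff (F : TransverseFlow ρ D.S c L δ) (he : 0 < e) (heδ : 5 * e < δ)
    (hec : 5 * e ≤ c * δ) {y : Euc m} (hy : |ρ y| < 3 * e) :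
    D.q ρ e (-e) y ∈ Icc (0 : ℝ) 1 ↔ |ρ y| ≤ 2 * e := by
  have hpos : 0 < D.span ρ e y := by linarith [(parameter_bounds F he heδ hec hy).1]
  have a2 : |2 * e| ≤ 2 * e := (abs_of_pos (by linarith)).le
  have a2' : |2 * -e| ≤ 2 * e := by rw [mul_neg, abs_neg]; exact a2
  have h1 := (levelTime_lt_iff F he heδ hec hy a2 0).2
  have h2 := (levelTime_lt_iff F he heδ hec hy a2' 0).1
  have h1' := (levelTime_lt_iff F he heδ hec hy a2 0).1
  have h2' := (levelTime_lt_iff F he heδ hec hy a2' 0).2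
  rw [F.zero] at h1 h2 h1' h2'
  have e1 : 0 ≤ D.q ρ e (-e) y ↔ D.levelTime ρ (2 * -e) y ≤ 0 := by
    change 0 ≤ -D.levelTime ρ (2 * -e) y / D.span ρ e y ↔ _
    rw [le_div_iff₀ hpos, zero_mul, neg_nonneg]
  have e2 : D.q ρ e (-e) y ≤ 1 ↔ 0 ≤ D.levelTime ρ (2 * e) y := by
    change -D.levelTime ρ (2 * -e) y / D.span ρ e y ≤ 1 ↔ _
    rw [div_le_iff₀ hpos, one_mul, span]
    constructor <;> intro h <;> linarith
  rw [mem_Icc, e1, e2, ← not_lt, ← not_lt, h2', h1', not_lt, not_lt, abs_le, mul_neg]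

/-- The span, r and s are invariants of the flow line, and q is an affine coordinate along it. Thus
g acts on a flow line exactly as u(r, s, ·) acts on q. -/
theorem parameters_apply (F : TransverseFlow ρ D.S c L δ) (he : 0 < e) (heδ : 5 * e < δ)
    (hec : 5 * e ≤ c * δ) {y : Euc m} (hy : |ρ y| < 3 * e) (t : ℝ) :
    D.span ρ e (D.S t y) = D.span ρ e y ∧ D.r ρ e (-e) (D.S t y) = D.r ρ e (-e) y ∧
      D.s ρ e (-e) (D.S t y) = D.s ρ e (-e) y ∧
      D.q ρ e (-e) (D.S t y) = D.q ρ e (-e) y + t / D.span ρ e y := by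
  have a2 : |2 * e| ≤ 2 * e := (abs_of_pos (by linarith)).le
  have a2' : |2 * -e| ≤ 2 * e := by rw [mul_neg, abs_neg]; exact a2
  have a1 : |e| ≤ 2 * e := by rw [abs_of_pos he]; linarith
  have a1' : |-e| ≤ 2 * e := by rw [abs_neg]; exact a1
  refine ⟨?_, ?_, ?_, ?_⟩
  · rw [span, levelTime_apply F he heδ hec hy a2, levelTime_apply F he heδ hec hy a2',
      sub_sub_sub_cancel_right, span]
  · rw [r, levelTime_apply F he heδ hec hy a2, levelTime_apply F he heδ hec hy a2',
      levelTime_apply F he heδ hec hy a1, sub_sub_sub_cancel_right, sub_sub_sub_cancel_right, r]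
  · rw [s, levelTime_apply F he heδ hec hy a2, levelTime_apply F he heδ hec hy a2',
      levelTime_apply F he heδ hec hy a1', sub_sub_sub_cancel_right, sub_sub_sub_cancel_right, s]
  · rw [q, levelTime_apply F he heδ hec hy a2, levelTime_apply F he heδ hec hy a2',
      sub_sub_sub_cancel_right, q, span, neg_sub, ← add_div]
    congr 1; ring

/-- Moving a point between the levels `±2e` by `Δ (q' - q)` gives the point with parameter
`q'`. -/
theorem abs_level_le_of_mem_Icc (F : TransverseFlow ρ D.S c L δ) (he : 0 < e) (heδ : 5 * e < δ)
    (hec : 5 * e ≤ c * δ) {y : Euc m} (hy : |ρ y| < 3 * e) {q' : ℝ} (hq' : q' ∈ Icc (0 : ℝ) 1) :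
    |ρ (D.S (D.span ρ e y * (q' - D.q ρ e (-e) y)) y)| ≤ 2 * e := by
  have a2 : |2 * e| ≤ 2 * e := (abs_of_pos (by linarith)).le
  have a2' : |2 * -e| ≤ 2 * e := by rw [mul_neg, abs_neg]; exact a2
  have hpos : 0 < D.span ρ e y := by linarith [(parameter_bounds F he heδ hec hy).1]
  have hq : D.span ρ e y * D.q ρ e (-e) y = -D.levelTime ρ (2 * -e) y :=
    mul_div_cancel₀ _ hpos.ne'
  have hs : D.span ρ e y = D.levelTime ρ (2 * e) y - D.levelTime ρ (2 * -e) y := rfl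
  rw [mul_sub, hq]
  have h0 := mul_nonneg hpos.le hq'.1
  have h1 := mul_le_of_le_one_right hpos.le hq'.2
  rw [abs_le, ← mul_neg, ← not_lt, ← not_lt, ← (levelTime_lt_iff F he heδ hec hy a2' _).2,
    ← (levelTime_lt_iff F he heδ hec hy a2 _).1]
  constructor <;> linarith

theorem parameters_mem_Ioo (F : TransverseFlow ρ D.S c L δ) (he : 0 < e) (heδ : 5 * e < δ)
    (hec : 5 * e ≤ c * δ) {y : Euc m} (hy : |ρ y| < 3 * e) :
    D.r ρ e (-e) y ∈ Ioo (0 : ℝ) 1 ∧ D.s ρ e (-e) y ∈ Ioo (0 : ℝ) 1 := by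
  obtain ⟨-, -, hr, hs, -⟩ := parameter_bounds F he heδ hec hy
  have hc := F.c_pos
  have : Icc (c / 8) (1 - c / 8) ⊆ Ioo 0 1 := Icc_subset_Ioo (by linarith) (by linarith)
  exact ⟨this hr, this hs⟩

/-- The effect of `g(e, -e, ·)` on the parameters along a flow line. -/
theorem g_spec (F : TransverseFlow ρ D.S c L δ) (he : 0 < e) (heδ : 5 * e < δ)
    (hec : 5 * e ≤ c * δ) {y : Euc m} (hy : |ρ y| < 3 * e) :
    |ρ (D.g ρ e (-e) y)| < 3 * e ∧ D.span ρ e (D.g ρ e (-e) y) = D.span ρ e y ∧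
      D.r ρ e (-e) (D.g ρ e (-e) y) = D.r ρ e (-e) y ∧
      D.s ρ e (-e) (D.g ρ e (-e) y) = D.s ρ e (-e) y ∧
      D.q ρ e (-e) (D.g ρ e (-e) y) =
        D.u (D.r ρ e (-e) y) (D.s ρ e (-e) y) (D.q ρ e (-e) y) := by
  have hpos : 0 < D.span ρ e y := by linarith [(parameter_bounds F he heδ hec hy).1]
  obtain ⟨hr, hs⟩ := parameters_mem_Ioo F he heδ hec hy
  have hg : D.g ρ e (-e) y = D.S (D.span ρ e y *
      (D.u (D.r ρ e (-e) y) (D.s ρ e (-e) y) (D.q ρ e (-e) y) - D.q ρ e (-e) y)) y := by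
    rw [g_eq F, moveTime, if_pos hy, w_eq F he heδ hec hy]
  obtain ⟨h1, h2, h3, h4⟩ := parameters_apply F he heδ hec hy (D.span ρ e y *
    (D.u (D.r ρ e (-e) y) (D.s ρ e (-e) y) (D.q ρ e (-e) y) - D.q ρ e (-e) y))
  rw [mul_div_cancel_left₀ _ hpos.ne', add_sub_cancel] at h4
  rw [hg]
  refine ⟨?_, h1, h2, h3, h4⟩
  by_cases hq : D.q ρ e (-e) y ∈ Icc (0 : ℝ) 1
  · have := abs_level_le_of_mem_Icc F he heδ hec hy (D.diffeo_u.mapsTo_Icc hr hs hq)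
    linarith
  · rw [D.diffeo_u.fixed _ hr _ hs _ hq, sub_self, mul_zero, F.zero]
    exact hy

theorem r_lt_q_iff (F : TransverseFlow ρ D.S c L δ) (he : 0 < e) (heδ : 5 * e < δ)
    (hec : 5 * e ≤ c * δ) {y : Euc m} (hy : |ρ y| < 3 * e) :
    (D.r ρ e (-e) y < D.q ρ e (-e) y ↔ e < ρ y) ∧ (D.q ρ e (-e) y < D.r ρ e (-e) y ↔ ρ y < e) := by
  have hpos : 0 < D.span ρ e y := by linarith [(parameter_bounds F he heδ hec hy).1]
  have h := levelTime_lt_iff F he heδ hec hy (τ := e) (by rw [abs_of_pos he]; linarith) 0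
  rw [F.zero] at h
  rw [← h.1, ← h.2]
  change ((D.levelTime ρ e y - D.levelTime ρ (2 * -e) y) / D.span ρ e y <
    -D.levelTime ρ (2 * -e) y / D.span ρ e y ↔ _) ∧ (-D.levelTime ρ (2 * -e) y / D.span ρ e y <
    (D.levelTime ρ e y - D.levelTime ρ (2 * -e) y) / D.span ρ e y ↔ _)
  rw [div_lt_div_iff_of_pos_right hpos, div_lt_div_iff_of_pos_right hpos]
  constructor <;> constructor <;> intro h <;> linarith

theorem s_lt_q_iff (F : TransverseFlow ρ D.S c L δ) (he : 0 < e) (heδ : 5 * e < δ)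
    (hec : 5 * e ≤ c * δ) {y : Euc m} (hy : |ρ y| < 3 * e) :
    (D.s ρ e (-e) y < D.q ρ e (-e) y ↔ -e < ρ y) ∧
      (D.q ρ e (-e) y < D.s ρ e (-e) y ↔ ρ y < -e) := by
  have hpos : 0 < D.span ρ e y := by linarith [(parameter_bounds F he heδ hec hy).1]
  have h := levelTime_lt_iff F he heδ hec hy (τ := -e)
    (by rw [abs_neg, abs_of_pos he]; linarith) 0
  rw [F.zero] at h
  rw [← h.1, ← h.2]
  change ((D.levelTime ρ (-e) y - D.levelTime ρ (2 * -e) y) / D.span ρ e y <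
    -D.levelTime ρ (2 * -e) y / D.span ρ e y ↔ _) ∧ (-D.levelTime ρ (2 * -e) y / D.span ρ e y <
    (D.levelTime ρ (-e) y - D.levelTime ρ (2 * -e) y) / D.span ρ e y ↔ _)
  rw [div_lt_div_iff_of_pos_right hpos, div_lt_div_iff_of_pos_right hpos]
  constructor <;> constructor <;> intro h <;> linarith

/-- `g(e, -e, ·)` carries the level `e` to the level `-e`. -/
theorem level_g_lt_iff (F : TransverseFlow ρ D.S c L δ) (he : 0 < e) (heδ : 5 * e < δ)
    (hec : 5 * e ≤ c * δ) (y : Euc m) :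
    (-e < ρ (D.g ρ e (-e) y) ↔ e < ρ y) ∧ (ρ (D.g ρ e (-e) y) < -e ↔ ρ y < e) := by
  by_cases hy : |ρ y| < 3 * e
  · obtain ⟨hg, -, -, hs, hq⟩ := g_spec F he heδ hec hy
    obtain ⟨hr0, hs0⟩ := parameters_mem_Ioo F he heδ hec hy
    have hm := D.diffeo_u.strictMono hr0 hs0
    have h := s_lt_q_iff F he heδ hec hg
    rw [← h.1, ← h.2, ← (r_lt_q_iff F he heδ hec hy).1, ← (r_lt_q_iff F he heδ hec hy).2, hs, hq]
    -- Since u(r, s, ·) is increasing and sends r to s, comparing q with r before the map is the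
    -- same as comparing the new q with s after it.
    have hrs := D.diffeo_u.apply_self _ hr0 _ hs0
    have h1 := hm.lt_iff_lt (a := D.r ρ e (-e) y) (b := D.q ρ e (-e) y)
    have h2 := hm.lt_iff_lt (a := D.q ρ e (-e) y) (b := D.r ρ e (-e) y)
    rw [hrs] at h1 h2
    exact ⟨h1, h2⟩
  · rw [g_eq F, moveTime, if_neg hy, F.zero]
    rw [not_lt] at hy
    rcases le_abs.1 hy with h | h
    · constructor <;> constructor <;> intro h <;> linarith
    · constructor <;> constructor <;> intro h <;> linarith

/-- On each flow line, u(r, s, ·) maps [0,1] onto itself; all other points are fixed. -/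
theorem surjective_g (F : TransverseFlow ρ D.S c L δ) (he : 0 < e) (heδ : 5 * e < δ)
    (hec : 5 * e ≤ c * δ) : Function.Surjective (D.g ρ e (-e)) := by
  intro z
  by_cases hz : |ρ z| < 3 * e
  · obtain ⟨hr, hs⟩ := parameters_mem_Ioo F he heδ hec hz
    have hpos : 0 < D.span ρ e z := by linarith [(parameter_bounds F he heδ hec hz).1]
    by_cases hq : D.q ρ e (-e) z ∈ Icc (0 : ℝ) 1
    · obtain ⟨q', hq', hu⟩ := D.diffeo_u.exists_apply_eq hr hs hq
      have h0 := abs_level_le_of_mem_Icc F he heδ hec hz hq'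
      set t := D.span ρ e z * (q' - D.q ρ e (-e) z) with ht
      obtain ⟨h1, h2, h3, h4⟩ := parameters_apply F he heδ hec hz t
      have hy : |ρ (D.S t z)| < 3 * e := by linarith
      refine ⟨D.S t z, ?_⟩
      rw [ht, mul_div_cancel_left₀ _ hpos.ne', add_sub_cancel, ← ht] at h4
      rw [g_eq F, moveTime, if_pos hy, w_eq F he heδ hec hy, h1, h2, h3, h4, hu, ← F.add]
      have : D.span ρ e z * (D.q ρ e (-e) z - q') + t = 0 := by rw [ht]; ring
      rw [this, F.zero]
    · refine ⟨z, ?_⟩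
      rw [g_eq F, moveTime, if_pos hz, w_eq F he heδ hec hz, D.diffeo_u.fixed _ hr _ hs _ hq,
        sub_self, mul_zero, F.zero]
  · exact ⟨z, by rw [g_eq F, moveTime, if_neg hz, F.zero]⟩

/-- Only points with q in [0,1] move, and they stay between the levels ±2e. The gap up to the levels
±3e, where the definition of g switches, is used to compare points on the two sides of the switch.
-/
theorem moveTime_spec (F : TransverseFlow ρ D.S c L δ) (he : 0 < e) (heδ : 5 * e < δ)
    (hec : 5 * e ≤ c * δ) (y : Euc m) : D.moveTime ρ e y = 0 ∨
      (c * |D.moveTime ρ e y| ≤ 4 * e ∧ |ρ y| ≤ 2 * e ∧ |ρ (D.g ρ e (-e) y)| ≤ 2 * e) := by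
  by_cases hy : |ρ y| < 3 * e
  · obtain ⟨hr, hs⟩ := parameters_mem_Ioo F he heδ hec hy
    obtain ⟨hΔ, hΔ', -, -, -⟩ := parameter_bounds F he heδ hec hy
    rw [moveTime, if_pos hy, w_eq F he heδ hec hy]
    by_cases hq : D.q ρ e (-e) y ∈ Icc (0 : ℝ) 1
    · right
      have hu := D.diffeo_u.mapsTo_Icc hr hs hq
      refine ⟨?_, (q_mem_Icc_iff F he heδ hec hy).1 hq, ?_⟩
      · have h1 : |D.u (D.r ρ e (-e) y) (D.s ρ e (-e) y) (D.q ρ e (-e) y) - D.q ρ e (-e) y| ≤ 1 :=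
          abs_le.2 ⟨by linarith [hu.1, hq.2], by linarith [hu.2, hq.1]⟩
        have hpos : 0 < D.span ρ e y := by linarith
        rw [abs_mul, abs_of_pos hpos]
        have := mul_le_of_le_one_right (mul_nonneg F.c_pos.le hpos.le) h1
        linarith
      · obtain ⟨h1, -, -, -, h5⟩ := g_spec F he heδ hec hy
        rw [← q_mem_Icc_iff F he heδ hec h1, h5]
        exact hu
    · left
      rw [D.diffeo_u.fixed _ hr _ hs _ hq, sub_self, mul_zero]
  · exact Or.inl (if_neg hy)

/-- The maps `g(e, -e, ·)`, `e > 0` small, are uniformly bi-Lipschitz. -/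
theorem exists_g_biLipschitz (D : BallZarnescuData U) (F : TransverseFlow ρ D.S c L δ) :
    ∃ K ≥ 0, ∀ e, 0 < e → 5 * e < δ → 5 * e ≤ c * δ →
      BiLipschitzOnWith K (D.g ρ e (-e)) univ := by
  have hc := F.c_pos
  have hL := F.one_le_L
  obtain ⟨M, hM0, hM⟩ := D.exists_parameter_lipschitz F
  set Q := 1 + 5 / (2 * c) with hQ
  have hQ0 : 0 ≤ Q := by positivity
  obtain ⟨N, hN0, μ, hμ, hN⟩ := D.diffeo_u.exists_bounds (κ := c / 8) (by linarith) Q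
  -- A₁ serves the source estimate, A₂ the target estimate, and 8/c the pairs of which one point
  -- lies outside the levels ±3e.
  set A₁ := M * (2 * Q) + 4 / c * ((3 * N + 1) * M) with hA₁
  set A₂ := M * (2 * Q) + 4 / c * (M + (1 + 2 * N) * M / μ) with hA₂
  set A := A₁ + A₂ + 8 / c with hA
  have hA₁0 : 0 ≤ A₁ := by positivity
  have hA₂0 : 0 ≤ A₂ := by positivity
  have hA0 : 0 ≤ A := by positivity
  refine ⟨L + A, by linarith, fun e he heδ hec => ?_⟩
  have hWc : ∀ y, c * |D.moveTime ρ e y| ≤ 4 * e := by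
    intro y
    rcases moveTime_spec F he heδ hec y with h | ⟨h, -⟩
    · rw [h, abs_zero, mul_zero]; linarith
    · exact h
  have hin : ∀ y z, |ρ y| < 3 * e → |ρ z| < 3 * e →
      |D.moveTime ρ e y - D.moveTime ρ e z| ≤ A * dist y z ∧
      |D.moveTime ρ e y - D.moveTime ρ e z| ≤ A * dist (D.g ρ e (-e) y) (D.g ρ e (-e) z) := by
    intro y z hy hz
    obtain ⟨-, -, hry, hsy, hqy⟩ := parameter_bounds F he heδ hec hy
    obtain ⟨hΔz, hΔz', hrz, hsz, hqz⟩ := parameter_bounds F he heδ hec hz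
    obtain ⟨hgy, g1, g2, g3, g4⟩ := g_spec F he heδ hec hy
    obtain ⟨hgz, g1', g2', g3', g4'⟩ := g_spec F he heδ hec hz
    obtain ⟨-, -, -, -, huy⟩ := parameter_bounds F he heδ hec hgy
    rw [g4] at huy
    obtain ⟨l1, l2, l3, l4⟩ := hM e he heδ hec y z hy hz
    obtain ⟨k1, k2, k3, k4⟩ := hM e he heδ hec _ _ hgy hgz
    rw [g1, g1'] at k1
    rw [g2, g2'] at k2
    rw [g3, g3'] at k3
    rw [g4, g4'] at k4
    have hqy' : D.q ρ e (-e) y ∈ Icc (-Q) Q := abs_le.1 (by linarith)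
    have hqz' : D.q ρ e (-e) z ∈ Icc (-Q) Q := abs_le.1 (by linarith)
    have hN1 := (hN _ hry _ hsy _ hqy').1 _ hrz _ hsz _ hqz'
    have hN2 := (hN _ hry _ hsy _ hqy').2 _ hqz'
    have hN3 := (hN _ hry _ hsy _ hqz').1 _ hrz _ hsz _ hqz'
    rw [sub_self, abs_zero, add_zero] at hN3
    rw [moveTime, moveTime, if_pos hy, if_pos hz, w_eq F he heδ hec hy, w_eq F he heδ hec hz]
    set uy := D.u (D.r ρ e (-e) y) (D.s ρ e (-e) y) (D.q ρ e (-e) y)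
    set uz := D.u (D.r ρ e (-e) z) (D.s ρ e (-e) z) (D.q ρ e (-e) z)
    set um := D.u (D.r ρ e (-e) y) (D.s ρ e (-e) y) (D.q ρ e (-e) z)
    set qy := D.q ρ e (-e) y
    set qz := D.q ρ e (-e) z
    have hΔpos : 0 < D.span ρ e z := by linarith
    have hΔle : D.span ρ e z ≤ 4 / c * e := by
      rw [div_mul_eq_mul_div, le_div_iff₀ hc]; linarith
    have hmain : |D.span ρ e y * (uy - qy) - D.span ρ e z * (uz - qz)| ≤
        |D.span ρ e y - D.span ρ e z| * (2 * Q) + 4 / c * e * (|uy - uz| + |qy - qz|) := by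
      have e1 : D.span ρ e y * (uy - qy) - D.span ρ e z * (uz - qz) =
        (D.span ρ e y - D.span ρ e z) * (uy - qy) + D.span ρ e z * ((uy - uz) - (qy - qz)) := by
        ring
      rw [e1]
      refine (abs_add_le _ _).trans ?_
      rw [abs_mul, abs_mul, abs_of_pos hΔpos]
      have h1 : |uy - qy| ≤ 2 * Q := (abs_sub _ _).trans (by linarith)
      have h2 := abs_sub (uy - uz) (qy - qz)
      gcongr
    -- The cancellation that makes the constants independent of e: a span of at most 4e/c against
    -- parameters with Lipschitz constant O(1/e).
    have hce : 4 / c * e * (1 / e) = 4 / c := by field_simp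
    have hfin : ∀ {d B : ℝ}, |D.span ρ e y - D.span ρ e z| ≤ M * d →
        |uy - uz| + |qy - qz| ≤ B * d * (1 / e) →
        |D.span ρ e y * (uy - qy) - D.span ρ e z * (uz - qz)| ≤
          (M * (2 * Q) + 4 / c * B) * d := by
      intro d B h1 h2
      refine hmain.trans ?_
      calc _ ≤ M * d * (2 * Q) + 4 / c * e * (B * d * (1 / e)) := by gcongr
        _ = M * d * (2 * Q) + (4 / c * e * (1 / e)) * (B * d) := by ring
        _ = _ := by rw [hce]; ring
    constructor
    · have h1 := hfin (d := dist y z) (B := (3 * N + 1) * M) l1 (by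
        have h2 : N * (|D.r ρ e (-e) y - D.r ρ e (-e) z| + |D.s ρ e (-e) y - D.s ρ e (-e) z| +
            |qy - qz|) ≤ N * (M * dist y z / e + M * dist y z / e + M * dist y z / e) := by gcongr
        have e1 : (3 * N + 1) * M * dist y z * (1 / e) =
          N * (M * dist y z / e + M * dist y z / e + M * dist y z / e) + M * dist y z / e := by ring
        linarith)
      refine h1.trans (mul_le_mul_of_nonneg_right ?_ dist_nonneg)
      have : 0 ≤ 8 / c := by positivity
      linarith
    · set d := dist (D.g ρ e (-e) y) (D.g ρ e (-e) z)
      have hd : 0 ≤ d := dist_nonneg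
      have h1 := hfin (d := d) (B := M + (1 + 2 * N) * M / μ) k1 (by
        have h2 : N * (|D.r ρ e (-e) y - D.r ρ e (-e) z| + |D.s ρ e (-e) y - D.s ρ e (-e) z|) ≤
          N * (M * d / e + M * d / e) := by gcongr
        have h3 := abs_sub_le uy uz um
        rw [abs_sub_comm uz um] at h3
        -- To express q in terms of the image, the points are first given the same r and s (the
        -- value `um`); then the lower bound μ on the slope of u recovers the difference of the q's.
        have h4 : |qy - qz| ≤ (M * d / e + N * (M * d / e + M * d / e)) / μ := by
          rw [le_div_iff₀ hμ]; linarith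
        have e1 : (M + (1 + 2 * N) * M / μ) * d * (1 / e) =
          M * d / e + (M * d / e + N * (M * d / e + M * d / e)) / μ := by ring
        linarith)
      refine h1.trans (mul_le_mul_of_nonneg_right ?_ hd)
      have : 0 ≤ 8 / c := by positivity
      linarith
  have hcross : ∀ y z, 3 * e ≤ |ρ z| →
      |D.moveTime ρ e y - D.moveTime ρ e z| ≤ A * dist y z ∧
      |D.moveTime ρ e y - D.moveTime ρ e z| ≤ A * dist (D.g ρ e (-e) y) (D.g ρ e (-e) z) := by
    intro y z hz
    have hWz : D.moveTime ρ e z = 0 := if_neg (not_lt.2 hz)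
    have hgz : D.g ρ e (-e) z = z := by rw [g_eq F, hWz, F.zero]
    rw [hWz, hgz, sub_zero]
    rcases moveTime_spec F he heδ hec y with h | ⟨h, h1, h2⟩
    · rw [h, abs_zero]
      exact ⟨mul_nonneg hA0 dist_nonneg, mul_nonneg hA0 dist_nonneg⟩
    · have key : ∀ x, |ρ x| ≤ 2 * e → |D.moveTime ρ e y| ≤ A * dist x z := by
        intro x hx
        have h3 := F.lip x z
        have h4 := abs_sub_abs_le_abs_sub (ρ z) (ρ x)
        rw [abs_sub_comm] at h4
        -- The levels of x and z differ by at least e, so dist x z ≥ e/2, while the moving time is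
        -- at most 4e/c.
        have h5 : |D.moveTime ρ e y| ≤ 8 / c * dist x z := by
          rw [div_mul_eq_mul_div, le_div_iff₀ hc]; linarith
        exact h5.trans (mul_le_mul_of_nonneg_right (by linarith) dist_nonneg)
      exact ⟨key y h1, key _ h2⟩
  have hall : ∀ y z, |D.moveTime ρ e y - D.moveTime ρ e z| ≤ A * dist y z ∧
      |D.moveTime ρ e y - D.moveTime ρ e z| ≤ A * dist (D.g ρ e (-e) y) (D.g ρ e (-e) z) := by
    intro y z
    rcases lt_or_ge (|ρ z|) (3 * e) with hz | hz
    · rcases lt_or_ge (|ρ y|) (3 * e) with hy | hy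
      · exact hin y z hy hz
      · have := hcross z y hy
        rwa [abs_sub_comm, dist_comm z y, dist_comm (D.g ρ e (-e) z)] at this
    · exact hcross y z hz
  refine F.biLipschitzOnWith (T := D.moveTime ρ e) (fun y _ => g_eq F y) (fun y _ => ?_)
    (fun y _ z _ => (hall y z).1) (fun y _ z _ => (hall y z).2)
  have h1 := hWc y
  have h2 : c * δ ≤ c * 1 := mul_le_mul_of_nonneg_left F.δ_le hc.le
  by_contra! h3
  nlinarith

end BallZarnescuData

/-! ### The main theorem -/

theorem BiLipschitzOnWith.mono {X Y : Type*} [PseudoMetricSpace X] [PseudoMetricSpace Y] {K K' : ℝ}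
    {Φ : X → Y} {s : Set X} (h : BiLipschitzOnWith K Φ s) (hK : K ≤ K') :
    BiLipschitzOnWith K' Φ s := fun x hx y hy =>
  ⟨(h x hx y hy).1.trans (mul_le_mul_of_nonneg_right hK dist_nonneg),
    (h x hx y hy).2.trans (mul_le_mul_of_nonneg_right hK dist_nonneg)⟩

theorem BiLipschitzOnWith.comp {X Y Z : Type*} [PseudoMetricSpace X] [PseudoMetricSpace Y]
    [PseudoMetricSpace Z] {K K' : ℝ} {Φ : X → Y} {Φ' : Y → Z} {s : Set X} {t : Set Y}
    (h' : BiLipschitzOnWith K' Φ' t) (h : BiLipschitzOnWith K Φ s) (hs : MapsTo Φ s t)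
    (hK : 0 ≤ K) (hK' : 0 ≤ K') : BiLipschitzOnWith (K' * K) (Φ' ∘ Φ) s := fun x hx y hy => by
  obtain ⟨h1, h2⟩ := h x hx y hy
  obtain ⟨h3, h4⟩ := h' _ (hs hx) _ (hs hy)
  constructor
  · exact h3.trans (by rw [mul_assoc]; gcongr)
  · exact h2.trans (by rw [mul_comm K', mul_assoc]; gcongr; exact h4)

theorem frontier_nonempty_of_isBounded {m : ℕ} {U : Set (Euc m)} (hne : U.Nonempty)
    (hb : Bornology.IsBounded U) : (frontier U).Nonempty := by
  by_contra! h
  rcases isClopen_iff.1 (isClopen_iff_frontier_eq_empty.2 h) with h | h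
  · exact hne.ne_empty h
  · exact NormedSpace.unbounded_univ ℝ (Euc m) (h ▸ hb)

namespace BallZarnescuData

variable {m : ℕ} {U : Set (Euc m)} {ρ : Euc m → ℝ} {c L δ : ℝ}

/-- Conclusions about the maps `f(ε, ·)`, for a function `ρ` to which the flow is transverse. -/
theorem exists_f_bounds (D : BallZarnescuData U) (F : TransverseFlow ρ D.S c L δ)
    (hcl : closure U = {x | 0 ≤ ρ x}) (hfr : frontier U = {x | ρ x = 0})
    (hU : U = {x | 0 < ρ x}) : ∃ ε₀ : ℝ, 0 < ε₀ ∧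
      (∃ K : ℝ, ∀ ε ∈ Ioo (-ε₀) ε₀,
        D.f ρ ε '' closure U = closure (superlevel ρ ε) ∧
        D.f ρ ε '' frontier U = frontier (superlevel ρ ε) ∧
        BiLipschitzOnWith K (D.f ρ ε) (closure U)) ∧
      ∀ ε₁ ∈ Ioo 0 ε₀, IsLipschitzDeformation U (fun x τ => D.f ρ (τ * ε₁) x) := by
  have hc := F.c_pos
  have hδ := F.δ_pos
  have hL := F.one_le_L
  have hcδ : 0 < c * δ := mul_pos hc hδ
  obtain ⟨ε', hε', K₁, hK₁, H⟩ := D.exists_fpos_bounds F (fun x => by rw [hcl]; rfl)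
  obtain ⟨K₂, hK₂, G⟩ := D.exists_g_biLipschitz F
  set ε₀ := min ε' (min (δ / 5) (c * δ / 5)) with hε₀
  have hε₀' : 0 < ε₀ := by positivity
  have b1 : ε₀ ≤ ε' := min_le_left _ _
  have b2 : ε₀ ≤ δ / 5 := (min_le_right _ _).trans (min_le_left _ _)
  have b3 : ε₀ ≤ c * δ / 5 := (min_le_right _ _).trans (min_le_right _ _)
  have hpos : ∀ ε, 0 < ε → D.f ρ ε = D.fpos ρ ε := fun ε h => by
    funext x; rw [f, if_pos h]
  have hneg : ∀ ε, ε < 0 → D.f ρ ε = D.g ρ (-ε) ε ∘ D.fpos ρ (-ε) := fun ε h => by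
    funext x; rw [f, if_neg (not_lt.2 h.le), if_pos h]; rfl
  have hzero : D.f ρ 0 = id := by
    funext x; rw [f, if_neg (lt_irrefl _), if_neg (lt_irrefl _)]; rfl
  have himage : ∀ ε ∈ Ioo (-ε₀) ε₀, D.f ρ ε '' closure U = closure (superlevel ρ ε) ∧
      D.f ρ ε '' frontier U = frontier (superlevel ρ ε) ∧
      BiLipschitzOnWith (K₁ + K₂ * K₁) (D.f ρ ε) (closure U) := by
    intro ε hε
    have hKK : 0 ≤ K₂ * K₁ := mul_nonneg hK₂ (by linarith)
    rw [F.closure_superlevel (abs_lt.2 ⟨by linarith [hε.1], by linarith [hε.2]⟩),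
      F.frontier_superlevel (abs_lt.2 ⟨by linarith [hε.1], by linarith [hε.2]⟩), hcl, hfr]
    rcases lt_trichotomy ε 0 with h | rfl | h
    · obtain ⟨e, rfl⟩ : ∃ e, ε = -e := ⟨-ε, by ring⟩
      have he : 0 < e := by linarith
      have heε : e < ε₀ := by linarith [hε.1]
      obtain ⟨h1, h2, h3, -⟩ := H e he (by linarith)
      rw [hneg _ h, neg_neg, image_comp, image_comp, h1, h2]
      have heδ : 5 * e < δ := by linarith
      have hec : 5 * e ≤ c * δ := by linarith
      refine ⟨?_, ?_, ((G e he heδ hec).comp h3 (mapsTo_univ _ _) (by linarith) hK₂).mono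
        (by linarith)⟩
      · ext z
        constructor
        · rintro ⟨y, hy, rfl⟩
          exact not_lt.1 fun h => not_lt.2 hy ((level_g_lt_iff F he heδ hec y).2.1 h)
        · intro hz
          obtain ⟨y, rfl⟩ := surjective_g F he heδ hec z
          exact ⟨y, not_lt.1 fun h => not_lt.2 hz ((level_g_lt_iff F he heδ hec y).2.2 h), rfl⟩
      · have key : ∀ y, ρ y = e ↔ ρ (D.g ρ e (-e) y) = -e := by
          intro y
          obtain ⟨g1, g2⟩ := level_g_lt_iff F he heδ hec y
          rw [eq_iff_le_not_lt, eq_iff_le_not_lt, ← not_lt, ← not_lt, g1, g2]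
        ext z
        constructor
        · rintro ⟨y, hy, rfl⟩
          exact (key y).1 hy
        · intro hz
          obtain ⟨y, rfl⟩ := surjective_g F he heδ hec z
          exact ⟨y, (key y).2 hz, rfl⟩
    · rw [hzero, image_id, image_id]
      refine ⟨rfl, rfl, fun x _ y _ => ?_⟩
      have : dist x y ≤ (K₁ + K₂ * K₁) * dist x y :=
        le_mul_of_one_le_left dist_nonneg (by linarith)
      exact ⟨this, this⟩
    · obtain ⟨h1, h2, h3, -⟩ := H ε h (by linarith [hε.2])
      rw [hpos ε h]
      exact ⟨h1, h2, h3.mono (by linarith)⟩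
  refine ⟨ε₀, hε₀', ⟨K₁ + K₂ * K₁, himage⟩, fun ε₁ hε₁ => ?_⟩
  have hτ : ∀ τ ∈ Icc (0 : ℝ) 1, 0 ≤ τ * ε₁ ∧ τ * ε₁ < ε₀ := fun τ hτ =>
    ⟨mul_nonneg hτ.1 hε₁.1.le, (mul_le_of_le_one_left hε₁.1.le hτ.2).trans_lt hε₁.2⟩
  have hex : ∀ p : Euc m × ℝ, p ∈ frontier U ×ˢ Icc (0 : ℝ) 1 → ∃ t, |t| ≤ δ ∧
      D.f ρ (p.2 * ε₁) p.1 = D.S t p.1 ∧ ρ (D.S t p.1) = p.2 * ε₁ := by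
    rintro ⟨x, τ⟩ ⟨hx, hτI⟩
    rw [hfr] at hx
    have hx : ρ x = 0 := hx
    obtain ⟨h1, h2⟩ := hτ τ hτI
    rcases h1.eq_or_lt with h | h
    · refine ⟨0, by simpa using hδ.le, ?_, ?_⟩
      · simp only [← h, hzero, F.zero, id]
      · simp only [← h, F.zero, hx]
    · obtain ⟨-, -, -, h4⟩ := H _ h (by linarith)
      rw [hpos _ h]
      exact h4 x hx
  refine ⟨fun x hx τ hτI => ?_, ?_, fun x _ => by simp only [zero_mul, hzero, id],
    fun τ hτI => ?_⟩
  · obtain ⟨t, -, h1, h2⟩ := hex (x, τ) ⟨hx, hτI⟩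
    rw [hcl]
    change 0 ≤ ρ (D.f ρ (τ * ε₁) x)
    rw [h1, h2]
    exact (hτ τ hτI).1
  · choose! T hT hTf hTρ using hex
    -- The time needed to reach the level τε₁ from x in ∂U is Lipschitz in (x, τ): the level
    -- contributes ε₁/c and the starting point 2L/c.
    set A := (ε₁ + 2 * L) / c with hA
    have hε₁0 := hε₁.1
    have hA0 : 0 ≤ A := by positivity
    have hlow : BiLipschitzOnWith (L + A + 2 / ε₁) (fun p : Euc m × ℝ => D.f ρ (p.2 * ε₁) p.1)
        (frontier U ×ˢ Icc (0 : ℝ) 1) := by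
      intro p hp p' hp'
      have hρ : ∀ p ∈ frontier U ×ˢ Icc (0 : ℝ) 1, ρ p.1 = 0 := fun p hp => by
        have := hp.1
        rw [hfr] at this
        exact this
      have hd1 : dist p.1 p'.1 ≤ dist p p' := le_max_left _ _
      have hd2 : dist p.2 p'.2 ≤ dist p p' := le_max_right _ _
      have hd0 : 0 ≤ dist p p' := dist_nonneg
      simp only [hTf p hp, hTf p' hp']
      set X := D.S (T p) p.1 with hX
      set X' := D.S (T p') p'.1 with hX'
      have hXX : 0 ≤ dist X X' := dist_nonneg
      have hdiv : 0 ≤ 2 / ε₁ := by positivity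
      have hρX : ρ X = p.2 * ε₁ := hTρ p hp
      have hρX' : ρ X' = p'.2 * ε₁ := hTρ p' hp'
      constructor
      · have h1 := F.mul_abs_time_sub_le (x := p.1) (by rw [hρ p hp, abs_zero]; exact hδ) p'.1
          (hT p hp) (hT p' hp')
        rw [← hX, ← hX', hρX, hρX', ← sub_mul, abs_mul, abs_of_pos hε₁0, ← Real.dist_eq p.2] at h1
        have h2 : |T p - T p'| ≤ A * dist p p' := by
          rw [hA, div_mul_eq_mul_div, le_div_iff₀ hc]
          have := mul_le_mul_of_nonneg_right hd2 hε₁0.le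
          have := mul_le_mul_of_nonneg_left hd1 (show 0 ≤ 2 * L by linarith)
          linarith
        have h3 := dist_triangle X (D.S (T p) p'.1) X'
        have h4 := F.dist_space (T p) p.1 p'.1 ((hT p hp).trans F.δ_le)
        have h5 := F.dist_time (T p) (T p') p'.1
        rw [← hX] at h4
        rw [← hX'] at h5
        have h6 := mul_le_mul_of_nonneg_left hd1 (show 0 ≤ L by linarith)
        have h7 := mul_nonneg hdiv hd0
        linarith
      · have e1 : D.S (-T p) X = p.1 := F.neg_apply _ _
        have e2 : D.S (-T p') X' = p'.1 := F.neg_apply _ _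
        have b4 := (hτ p.2 hp.2)
        have h1 := F.mul_abs_time_sub_le (x := X) (by
          rw [hρX, abs_of_nonneg b4.1]; linarith [b4.2]) X'
          (a := -T p) (b := -T p') (by rw [abs_neg]; exact hT p hp)
          (by rw [abs_neg]; exact hT p' hp')
        rw [e1, e2, hρ p hp, hρ p' hp', sub_self, abs_zero, zero_add, neg_sub_neg,
          abs_sub_comm] at h1
        have h2 : |T p - T p'| ≤ A * dist X X' := by
          rw [hA, div_mul_eq_mul_div, le_div_iff₀ hc]
          have := mul_nonneg hε₁0.le hXX
          linarith
        have h3 := dist_triangle p.1 (D.S (-T p) X') p'.1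
        have h4 := F.dist_space (-T p) X X' (by rw [abs_neg]; exact (hT p hp).trans F.δ_le)
        have h5 := F.dist_time (-T p) (-T p') X'
        rw [e1] at h4
        rw [e2, neg_sub_neg, abs_sub_comm] at h5
        have h6 := F.lip X X'
        rw [hρX, hρX', ← sub_mul, abs_mul, abs_of_pos hε₁0, ← Real.dist_eq p.2] at h6
        -- The parameter τ is read off from the image, since ρ equals τε₁ there and is 2-Lipschitz.
        -- This constant depends on ε₁.
        have h7 : dist p.2 p'.2 ≤ 2 / ε₁ * dist X X' := by
          rw [div_mul_eq_mul_div, le_div_iff₀ hε₁0]; exact h6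
        have h8 := mul_nonneg hdiv hXX
        have h9 := mul_nonneg (show 0 ≤ L + A by linarith) hXX
        exact max_le (by linarith) (by linarith)
    exact ⟨_, hlow⟩
  · obtain ⟨h1, h2⟩ := hτ τ ⟨hτI.1.le, hτI.2⟩
    refine ⟨superlevel ρ (τ * ε₁), F.isOpen_superlevel _, fun x hx => ?_,
      (himage _ ⟨by linarith, h2⟩).2.1.symm⟩
    rw [hU]
    exact lt_of_le_of_lt h1 hx

end BallZarnescuData

theorem mainTheorem8 {m : ℕ} (U : Set (Euc m)) (hU : IsLipschitzDomain U)
    (hb : Bornology.IsBounded U) (η : Euc m → ℝ) (hη : IsMollifier η) :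
    IsLipschitzDeformable U ∧
    Nonempty (BallZarnescuData U) ∧
    ∀ D : BallZarnescuData U, ∃ ε₀ : ℝ, 0 < ε₀ ∧
      (∃ K : ℝ, ∀ ε ∈ Set.Ioo (-ε₀) ε₀,
        D.f (regularizedDist U η) ε '' closure U =
          closure (superlevel (regularizedDist U η) ε) ∧
        D.f (regularizedDist U η) ε '' frontier U =
          frontier (superlevel (regularizedDist U η) ε) ∧
        BiLipschitzOnWith K (D.f (regularizedDist U η) ε) (closure U)) ∧
      ∀ ε₁ ∈ Set.Ioo 0 ε₀,
        IsLipschitzDeformation U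
          (fun x τ => D.f (regularizedDist U η) (τ * ε₁) x) := by
  have hne := frontier_nonempty_of_isBounded hU.isConnected.nonempty hb
  have hc : IsCompact (frontier U) :=
    isCompact_of_isClosed_isBounded isClosed_frontier (hb.closure.subset frontier_subset_closure)
  have hD := nonempty_ballZarnescuData hU.isOpen hU.lipschitz hc
  have key := fun D : BallZarnescuData U =>
    let ⟨_, _, _, F⟩ := D.exists_transverseFlow hU.isOpen hc hne hη
    D.exists_f_bounds F (ext fun _ => (regularizedDist_nonneg_iff hU.isOpen hne hη).symm)
      (ext fun _ => (regularizedDist_eq_zero_iff hne hη).symm)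
      (ext fun _ => (regularizedDist_pos_iff hU.isOpen hne hη).symm)
  obtain ⟨D⟩ := hD
  obtain ⟨ε₀, hε₀, -, h⟩ := key D
  exact ⟨⟨hU.lipschitz, _, h (ε₀ / 2) ⟨half_pos hε₀, half_lt_self hε₀⟩⟩, ⟨D⟩, key⟩
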